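/- Let $X$ be a connected finite CW complex with base point $x_0$, let $\nu\colon \pi_1(X,x_0)\twoheadrightarrow\mathbb{Z}$ be a surjective group homomorphism, let $\mathbb{K}$ be a field and let $i\ge 0$. Let $X^{\nu}\to X$ be the connected covering associated to $\ker\nu$, and for every integer $N\ge 1$ let $X^{\nu,N}\to X$ be the connected covering associated to the kernel of $\pi_1(X,x_0)\overset{\nu}{\twoheadrightarrow}\mathbb{Z}\twoheadrightarrow\mathbb{Z}/N\mathbb{Z}$. The deck transformation group of $X^{\nu}\to X$ is identified with $\mathbb{Z}$ through $\nu$, and $H_i(X^{\nu},\mathbb{K})$ is a module over $\mathbb{K}[t^{\pm1}]$ (the $i$-th Alexander module), where $t$ acts by the map induced by the deck transformation corresponding to $1\in\mathbb{Z}$. For $\rho\in\mathbb{K}^*$ let $L_\rho$ be the rank one $\mathbb{K}$-local system on $X$ with monodromy $g\mapsto\rho^{\nu(g)}$. Then $H_i(X^{\nu,N},\mathbb{K})$ (for all $N\ge1$) and $H_i(X,L_\rho)$ (for all $\rho\in\mathbb{K}^*$) are finite dimensional over $\mathbb{K}$, $H_i(X^{\nu},\mathbb{K})$ is finitely generated over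 $\mathbb{K}[t^{\pm1}]$, the limit $$\alpha_i(X^\nu,\mathbb{K})=\lim_{N\to\infty}\frac{\dim_{\mathbb{K}} H_i(X^{\nu,N},\mathbb{K})}{N}$$ exists, and $$\alpha_i(X^\nu,\mathbb{K})=\operatorname{rank}_{\mathbb{K}[t^{\pm1}]}H_i(X^\nu,\mathbb{K})=\dim_{\mathbb{K}}H_i(X,L_\rho)\quad\text{for all but finitely many }\rho\in\mathbb{K}^*.$$ In particular $\alpha_i(X^\nu,\mathbb{K})$ is an integer. -/

import Mathlib

/-! ## Singular homology with coefficients in a local system -/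

universe u v w w'

noncomputable section

open CategoryTheory Limits

instance simplyConnectedSpace_toTop (n : SimplexCategory) :
    SimplyConnectedSpace (SimplexCategory.toTop.{u}.obj n) := by
  have : ContractibleSpace (stdSimplex ℝ (Fin (n.len + 1))) :=
    (convex_stdSimplex ℝ _).contractibleSpace Set.Nonempty.of_subtype
  have : ContractibleSpace (ULift.{u} (stdSimplex ℝ (Fin (n.len + 1)))) :=
    Homeomorph.ulift.contractibleSpace
  exact inferInstanceAs (SimplyConnectedSpace (ULift.{u} (stdSimplex ℝ (Fin (n.len + 1)))))

/-- The `0`-th vertex of the standard topological simplex. -/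
def simplexBase (n : SimplexCategory) : SimplexCategory.toTop.{u}.obj n :=
  ULift.up (stdSimplex.vertex (S := ℝ) 0)

instance subsingleton_hom_toTop (n : SimplexCategory)
    (x y : FundamentalGroupoid (SimplexCategory.toTop.{u}.obj n)) : Subsingleton (x ⟶ y) :=
  inferInstanceAs (Subsingleton (Path.Homotopic.Quotient x.as y.as))

/-- The unique homotopy class of paths, in the simplex `Δⁿ`, from the `0`-th vertex of `Δⁿ` to the
image of the `0`-th vertex of `Δᵐ` under the affine map `Δᵐ → Δⁿ` given by `f`. -/
def simplexEdge {m n : SimplexCategory} (f : m ⟶ n) :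
    FundamentalGroupoid.mk (simplexBase.{u} n) ⟶
      FundamentalGroupoid.mk (SimplexCategory.toTop.{u}.map f (simplexBase.{u} m)) :=
  Path.Homotopic.Quotient.mk (PathConnectedSpace.somePath _ _)

/-- The singular simplices of `X` of dimension `n`. -/
abbrev SingularSimplex (X : Type u) [TopologicalSpace X] (n : SimplexCategoryᵒᵖ) : Type u :=
  (TopCat.toSSet.obj (TopCat.of X)).obj n

/-- The continuous map `Δⁿ → X` underlying a singular simplex. -/
abbrev SingularSimplex.toMap {X : Type u} [TopologicalSpace X] {n : SimplexCategoryᵒᵖ}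
    (σ : SingularSimplex X n) : C(SimplexCategory.toTop.{u}.obj n.unop, X) :=
  TopCat.Hom.hom σ.down

variable {C : Type w} [Category.{w'} C]
/-- A local system on `X` with values in `C`: a functor from the fundamental groupoid. -/
abbrev LocalSystem (X : Type u) [TopologicalSpace X] (C : Type w) [Category.{w'} C] :=
  FundamentalGroupoid X ⥤ C

variable {X : Type u} [TopologicalSpace X]

/-- The value of a local system at the `0`-th vertex of a singular simplex. -/
abbrev LocalSystem.coeff (L : LocalSystem X C) {n : SimplexCategoryᵒᵖ}
    (σ : SingularSimplex X n) : C :=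
  L.obj (FundamentalGroupoid.mk (σ.toMap (simplexBase n.unop)))

/-- Parallel transport inside a singular simplex `σ`, from its `0`-th vertex to the `0`-th vertex of
the simplex obtained from `σ` by a simplicial operator `f` (for instance a face of `σ`). -/
def LocalSystem.transport (L : LocalSystem X C) {n m : SimplexCategoryᵒᵖ} (f : n ⟶ m)
    (σ : SingularSimplex X n) :
    L.coeff σ ⟶ L.coeff ((TopCat.toSSet.obj (TopCat.of X)).map f σ) :=
  L.map ((FundamentalGroupoid.map σ.toMap).map (simplexEdge f.unop))

theorem LocalSystem.map_ι [HasCoproducts.{u} C] (L : LocalSystem X C) {n : SimplexCategoryᵒᵖ}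
    {x : FundamentalGroupoid X} {σ τ : SingularSimplex X n} (h : σ = τ)
    (e : x ⟶ FundamentalGroupoid.mk (σ.toMap (simplexBase n.unop)))
    (e' : x ⟶ FundamentalGroupoid.mk (τ.toMap (simplexBase n.unop)))
    (he : e ≫ eqToHom (by rw [h]) = e') :
    L.map e ≫ Sigma.ι (fun σ : SingularSimplex X n => L.coeff σ) σ =
      L.map e' ≫ Sigma.ι (fun σ : SingularSimplex X n => L.coeff σ) τ := by
  subst h
  simp [← he]

theorem simplexMap_id (n : SimplexCategory) (x : SimplexCategory.toTop.{u}.obj n) :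
    SimplexCategory.toTop.{u}.map (𝟙 n) x = x := by
  rw [SimplexCategory.toTop.{u}.map_id, TopCat.id_app]

theorem simplexMap_comp {k m n : SimplexCategory} (g : k ⟶ m) (f : m ⟶ n)
    (x : SimplexCategory.toTop.{u}.obj k) :
    SimplexCategory.toTop.{u}.map (g ≫ f) x =
      SimplexCategory.toTop.{u}.map f (SimplexCategory.toTop.{u}.map g x) := by
  rw [SimplexCategory.toTop.{u}.map_comp, TopCat.comp_app]

theorem LocalSystem.transport_id [HasCoproducts.{u} C] (L : LocalSystem X C)
    (n : SimplexCategoryᵒᵖ) (σ : SingularSimplex X n) :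
    L.transport (𝟙 n) σ ≫ Sigma.ι (fun σ : SingularSimplex X n => L.coeff σ)
      ((TopCat.toSSet.obj (TopCat.of X)).map (𝟙 n) σ) =
    Sigma.ι (fun σ : SingularSimplex X n => L.coeff σ) σ := by
  have h : (TopCat.toSSet.obj (TopCat.of X)).map (𝟙 n) σ = σ := by simp
  have hv := (simplexMap_id.{u} n.unop (simplexBase.{u} n.unop)).symm
  refine (L.map_ι h _ (𝟙 _) ?_).trans ?_
  · have key : simplexEdge.{u} (𝟙 n.unop) =
      eqToHom (congrArg FundamentalGroupoid.mk hv) := Subsingleton.elim _ _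
    have key2 := (congrArg (FundamentalGroupoid.map σ.toMap).map key).trans (eqToHom_map _ _)
    exact (congrArg (· ≫ eqToHom _) key2).trans (eqToHom_trans _ _)
  · exact (congrArg (· ≫ _) (L.map_id _)).trans (Category.id_comp _)

theorem LocalSystem.transport_comp [HasCoproducts.{u} C] (L : LocalSystem X C)
    {n m k : SimplexCategoryᵒᵖ} (f : n ⟶ m) (g : m ⟶ k) (σ : SingularSimplex X n) :
    L.transport (f ≫ g) σ ≫ Sigma.ι (fun σ : SingularSimplex X k => L.coeff σ)
      ((TopCat.toSSet.obj (TopCat.of X)).map (f ≫ g) σ) =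
    L.transport f σ ≫ L.transport g ((TopCat.toSSet.obj (TopCat.of X)).map f σ) ≫
      Sigma.ι (fun σ : SingularSimplex X k => L.coeff σ)
        ((TopCat.toSSet.obj (TopCat.of X)).map g ((TopCat.toSSet.obj (TopCat.of X)).map f σ)) := by
  have h : (TopCat.toSSet.obj (TopCat.of X)).map (f ≫ g) σ =
      (TopCat.toSSet.obj (TopCat.of X)).map g ((TopCat.toSSet.obj (TopCat.of X)).map f σ) := by simp
  have hv := simplexMap_comp.{u} g.unop f.unop (simplexBase.{u} k.unop)
  refine Eq.trans ?_ ((congrArg (· ≫ _) (L.map_comp _ _)).trans (Category.assoc _ _ _))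
  refine L.map_ι h _ _ ?_
  have key : simplexEdge.{u} (g.unop ≫ f.unop) ≫ eqToHom (congrArg FundamentalGroupoid.mk hv) =
      simplexEdge.{u} f.unop ≫
        (FundamentalGroupoid.map (SimplexCategory.toTop.{u}.map f.unop).hom).map
          (simplexEdge.{u} g.unop) := Subsingleton.elim _ _
  have key2 := congrArg (FundamentalGroupoid.map σ.toMap).map key
  have key3 := (Functor.map_comp (FundamentalGroupoid.map σ.toMap) _ _).symm.trans
    (key2.trans (Functor.map_comp (FundamentalGroupoid.map σ.toMap) _ _))
  refine (congrArg (_ ≫ ·) (eqToHom_map _ _).symm).trans (key3.trans ?_)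
  refine congrArg (_ ≫ ·) ?_
  generalize simplexEdge.{u} g.unop = q
  induction q using Quotient.inductionOn with | _ q => rfl

/-- The simplicial object of singular chains with coefficients in `L`: in dimension `n` it is the
direct sum of the `L(σ(v₀))` over all singular `n`-simplices `σ`; a simplicial operator acts on the
simplices by precomposition and on the coefficients by parallel transport. -/
def LocalSystem.simplicialObject [HasCoproducts.{u} C] (L : LocalSystem X C) :
    SimplicialObject C where
  obj n := ∐ fun σ : SingularSimplex X n => L.coeff σ
  map f := Sigma.map' ((TopCat.toSSet.obj (TopCat.of X)).map f) (L.transport f)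
  map_id n := by
    refine Sigma.hom_ext _ _ fun σ => ?_
    rw [Sigma.ι_comp_map']
    exact (L.transport_id n σ).trans (Category.comp_id _).symm
  map_comp {n m k} f g := by
    refine Sigma.hom_ext _ _ fun σ => ?_
    rw [Sigma.ι_comp_map', Sigma.ι_comp_map'_assoc, Sigma.ι_comp_map']
    exact L.transport_comp f g σ

/-- The singular chain complex of `X` with coefficients in the local system `L`, with boundary the
alternating sum of the faces. -/
def LocalSystem.chainComplex [HasCoproducts.{u} C] [Preadditive C] (L : LocalSystem X C) :
    ChainComplex C ℕ :=
  (AlgebraicTopology.alternatingFaceMapComplex C).obj L.simplicialObject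

/-- `H_i(X, L)`: the homology of `X` with coefficients in the local system `L`. -/
def LocalSystem.homology [HasCoproducts.{u} C] [Preadditive C] [CategoryWithHomology C]
    (L : LocalSystem X C) (i : ℕ) : C :=
  L.chainComplex.homology i

/-! ## The rank one local system of a character -/

/-- The stalk at `x` of the rank one local system with monodromy `χ`: functions `s` on the homotopy
classes of paths from `x₀` to `x` with `s(q) = χ(g) s(g · q)` for all loops `g` at `x₀`, where
`g · q` runs first through `g`, then through `q`. It is a line if `X` is path connected. -/
def characterStalk {K : Type v} [Field K] {x₀ : X} (χ : FundamentalGroup X x₀ →* Kˣ)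
    (x : FundamentalGroupoid X) : Submodule K ((FundamentalGroupoid.mk x₀ ⟶ x) → K) where
  carrier := {s | ∀ (g : FundamentalGroup X x₀) (q : FundamentalGroupoid.mk x₀ ⟶ x),
    s q = (χ g : K) * s (FundamentalGroup.toArrow g ≫ q)}
  add_mem' {s t} hs ht g q := by
    simp only [Pi.add_apply, mul_add]
    rw [hs g q, ht g q]
  zero_mem' g q := by simp
  smul_mem' c s hs g q := by
    simp only [Pi.smul_apply, smul_eq_mul]
    rw [hs g q]
    ring

/-- Parallel transport along `γ`: `(γ s)(q) = s(q · γ⁻¹)`. -/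
def characterTransport {K : Type v} [Field K] {x₀ : X} (χ : FundamentalGroup X x₀ →* Kˣ)
    {x y : FundamentalGroupoid X} (γ : x ⟶ y) : characterStalk χ x →ₗ[K] characterStalk χ y where
  toFun s := ⟨fun q => s.1 (q ≫ Groupoid.inv γ), fun g q => by
    show s.1 (q ≫ Groupoid.inv γ) = _ * s.1 ((FundamentalGroup.toArrow g ≫ q) ≫ Groupoid.inv γ)
    rw [Category.assoc]
    exact s.2 g _⟩
  map_add' _ _ := rfl
  map_smul' _ _ := rfl

/-- The rank one `K`-local system on `X` with monodromy the character `χ` of `π₁(X, x₀)`. -/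
def characterLocalSystem {K : Type v} [Field K] {x₀ : X} (χ : FundamentalGroup X x₀ →* Kˣ) :
    LocalSystem X (ModuleCat.{max u v} K) where
  obj x := ModuleCat.of K (characterStalk χ x)
  map γ := ModuleCat.ofHom (characterTransport χ γ)
  map_id x := by
    ext s q
    simp [characterTransport]
  map_comp γ δ := by
    ext s q
    simp [characterTransport]

/-- The local system `L_ρ`: the pullback by `ν` of the rank one local system given by `ρ ∈ Kˣ`, that
is, the one with monodromy `g ↦ ρ ^ ν(g)`. -/
def pulledBackLocalSystem {K : Type v} [Field K] {x₀ : X}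
    (ν : FundamentalGroup X x₀ →* Multiplicative ℤ) (ρ : Kˣ) :
    LocalSystem X (ModuleCat.{max u v} K) :=
  characterLocalSystem ((zpowersHom Kˣ ρ).comp ν)

/-! ## Singular homology and the Alexander module -/

/-- Singular homology with coefficients in the field `K`, as a functor to `K`-vector spaces. -/
abbrev fieldHomologyFunctor (K : Type v) [Field K] (i : ℕ) : TopCat.{u} ⥤ ModuleCat.{max u v} K :=
  (AlgebraicTopology.singularHomologyFunctor (ModuleCat.{max u v} K) i).obj
    (ModuleCat.of K (ULift.{u} K))

/-- Singular homology `H_i(Y, K)`. -/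
abbrev fieldHomology (K : Type v) [Field K] (Y : Type u) [TopologicalSpace Y] (i : ℕ) :
    ModuleCat.{max u v} K :=
  (fieldHomologyFunctor K i).obj (TopCat.of Y)

/-- The map in singular homology induced by a continuous map. -/
def fieldHomologyMap (K : Type v) [Field K] {Y Z : Type u} [TopologicalSpace Y]
    [TopologicalSpace Z] (f : C(Y, Z)) (i : ℕ) : fieldHomology K Y i →ₗ[K] fieldHomology K Z i :=
  ((fieldHomologyFunctor K i).map (TopCat.ofHom f)).hom

theorem fieldHomologyMap_id (K : Type v) [Field K] (Y : Type u) [TopologicalSpace Y] (i : ℕ) :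
    fieldHomologyMap K (ContinuousMap.id Y) i = LinearMap.id :=
  congrArg ModuleCat.Hom.hom ((fieldHomologyFunctor K i).map_id (TopCat.of Y))

theorem fieldHomologyMap_comp (K : Type v) [Field K] {Y Z W : Type u} [TopologicalSpace Y]
    [TopologicalSpace Z] [TopologicalSpace W] (g : C(Z, W)) (f : C(Y, Z)) (i : ℕ) :
    fieldHomologyMap K (g.comp f) i = fieldHomologyMap K g i ∘ₗ fieldHomologyMap K f i :=
  congrArg ModuleCat.Hom.hom
    ((fieldHomologyFunctor K i).map_comp (TopCat.ofHom f) (TopCat.ofHom g))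

/-- The automorphism of `H_i(Y, K)` induced by a homeomorphism of `Y`. -/
def fieldHomologyUnit (K : Type v) [Field K] {Y : Type u} [TopologicalSpace Y] (T : Y ≃ₜ Y)
    (i : ℕ) : (Module.End K (fieldHomology K Y i))ˣ where
  val := fieldHomologyMap K (T : C(Y, Y)) i
  inv := fieldHomologyMap K (T.symm : C(Y, Y)) i
  val_inv := by
    have h : (T : C(Y, Y)).comp (T.symm : C(Y, Y)) = ContinuousMap.id Y :=
      ContinuousMap.ext T.apply_symm_apply
    rw [Module.End.mul_eq_comp, ← fieldHomologyMap_comp, h, fieldHomologyMap_id]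
    rfl
  inv_val := by
    have h : (T.symm : C(Y, Y)).comp (T : C(Y, Y)) = ContinuousMap.id Y :=
      ContinuousMap.ext T.symm_apply_apply
    rw [Module.End.mul_eq_comp, ← fieldHomologyMap_comp, h, fieldHomologyMap_id]
    rfl

/-- The Alexander module: `H_i(Y, K)` as a module over `K[t, t⁻¹]`, where `t` acts by the map
induced by the homeomorphism `T`. -/
@[nolint unusedArguments]
def AlexanderModule (K : Type v) [Field K] {Y : Type u} [TopologicalSpace Y] (_ : Y ≃ₜ Y)
    (i : ℕ) : Type (max u v) :=
  fieldHomology K Y i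

instance AlexanderModule.instAddCommGroup (K : Type v) [Field K] {Y : Type u} [TopologicalSpace Y]
    (T : Y ≃ₜ Y) (i : ℕ) : AddCommGroup (AlexanderModule K T i) :=
  inferInstanceAs (AddCommGroup (fieldHomology K Y i))

/-- The ring homomorphism `K[t, t⁻¹] → End_K(H_i(Y, K))` that sends `t` to the map induced by `T`. -/
def laurentAction (K : Type v) [Field K] {Y : Type u} [TopologicalSpace Y] (T : Y ≃ₜ Y) (i : ℕ) :
    LaurentPolynomial K →ₐ[K] Module.End K (fieldHomology K Y i) :=
  AddMonoidAlgebra.lift K (Module.End K (fieldHomology K Y i)) ℤ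
    ((Units.coeHom _).comp (zpowersHom _ (fieldHomologyUnit K T i)))

instance AlexanderModule.instModule (K : Type v) [Field K] {Y : Type u} [TopologicalSpace Y]
    (T : Y ≃ₜ Y) (i : ℕ) : Module (LaurentPolynomial K) (AlexanderModule K T i) :=
  Module.compHom (fieldHomology K Y i) (laurentAction K T i).toRingHom

/-! ## Covering spaces -/

/-- `p : E → X` is the covering space of `X` associated to the subgroup `H` of `π₁(X, x₀)`: a
covering map with path connected total space such that `p_* π₁(E, e₀) = H` for a point `e₀` over
`x₀`. -/
structure IsCoverOfSubgroup {E : Type u} [TopologicalSpace E] (p : E → X) (x₀ : X)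
    (H : Subgroup (FundamentalGroup X x₀)) : Prop where
  isCoveringMap : IsCoveringMap p
  pathConnectedSpace : PathConnectedSpace E
  exists_range_eq : ∃ (e₀ : E) (h : p e₀ = x₀),
    (FundamentalGroup.mapOfEq (⟨p, isCoveringMap.continuous⟩ : C(E, X)) h).range = H

/-- `p : E → X` is the infinite cyclic covering associated to `ν : π₁(X, x₀) → ℤ`, and `T` is its
deck transformation corresponding to `1 ∈ ℤ`: for a point `e₀` over `x₀`, the lift starting at `e₀`
of a loop `γ` at `x₀` ends at `T ^ ν(γ) e₀`. -/
structure IsInfiniteCyclicCover {E : Type u} [TopologicalSpace E] (p : E → X) (T : E ≃ₜ E)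
    {x₀ : X} (ν : FundamentalGroup X x₀ →* Multiplicative ℤ) : Prop
    extends IsCoverOfSubgroup p x₀ ν.ker where
  map_deck (e : E) : p (T e) = p e
  exists_monodromy_eq : ∃ (e₀ : E) (h : p e₀ = x₀), ∀ γ : FundamentalGroup X x₀,
    (isCoveringMap.monodromy (FundamentalGroup.toPath γ) ⟨e₀, h⟩ : E) =
      (T ^ Multiplicative.toAdd (ν γ)) e₀

/-- The composition of `ν : π₁(X, x₀) → ℤ` with the projection `ℤ → ℤ/Nℤ`. -/
def reduceMod {x₀ : X} (ν : FundamentalGroup X x₀ →* Multiplicative ℤ) (N : ℕ) :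
    FundamentalGroup X x₀ →* Multiplicative (ZMod N) :=
  (AddMonoidHom.toMultiplicative (Int.castAddHom (ZMod N))).comp ν

end

/-! Write Λ = K[t, t⁻¹]. The deck group acts freely on the singular simplices of X^ν, and both other
chain complexes are quotients of the chains C of X^ν: C/(t^N - 1) is the chain complex of X^{ν,N}
(`finiteCover_exact`), and C/(t - ρ) is the complex with coefficients in L_ρ
(`pulledBackLocalSystem_exact`). For g = t^N - 1 or g = t - ρ, multiplication by g on C is
injective, and the long exact sequence gives dim H_i(C/g) = dim coker(g on H_i(X^ν)) + dim ker(g on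
H_{i-1}(X^ν)).

Once H_i(X^ν) is finitely generated over the principal ideal domain Λ, it is Λ^r ⊕ P with P finite
dimensional. On Λ^r the map g is injective with cokernel of dimension r deg g. On P the dimensions
of kernel and cokernel agree, so the difference of the two dimensions on the whole module is r deg
g, and the kernel embeds in P (`LaurentPolynomial.exists_hasCoindex`). For g = t^N - 1 this puts dim
H_i(X^{ν,N}) between rN and rN + d with d independent of N, and dividing by N gives the limit. For g
= t - ρ the kernel vanishes unless ρ is an eigenvalue of t on P, which excludes only finitely many ρ
(`LaurentPolynomial.finite_setOf_ker_ne_bot`).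

Finite generation is proved with singular chains, by induction over the cells
(`CoverFG.univ_of_finite`). For B ⊆ X the statement `CoverFG` concerns the chains lying in p⁻¹(B).
It holds for a point because the fibre is a single orbit of T, it passes along deformations of B by
homotopy lifting, and it satisfies a Mayer-Vietoris principle (`CoverFG.union`). A new cell is
attached by covering with the complement of its centre, which retracts onto the old part, and the
open cell. They meet in a punctured ball, a union of finitely many convex sets.

Mayer-Vietoris and homotopy invariance need barycentric subdivision and prisms. These are first
built on formal tuples of vertices, by coning, and then pushed forward to singular simplices. Chains
are indexed by the number of vertices, so index 0 carries the augmentation and the inductive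
formulas have no exceptional bottom degree. -/

noncomputable section

open CategoryTheory Limits

/-! ## Ordered affine chains -/

namespace TupleChain

variable {K : Type v} [Field K] {V V' S : Type*}

/-- The augmented boundary of the chains on tuples of elements of `V`. -/
def boundary (m : ℕ) : ((Fin (m + 1) → V) →₀ K) →ₗ[K] ((Fin m → V) →₀ K) :=
  ∑ i : Fin (m + 1), (-1 : K) ^ (i : ℕ) • Finsupp.lmapDomain K K (fun w => w ∘ i.succAbove)

/-- The map of chains induced by a map of vertices. -/
abbrev map (f : V → V') (m : ℕ) : ((Fin m → V) →₀ K) →ₗ[K] ((Fin m → V') →₀ K) :=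
  Finsupp.lmapDomain K K (fun w => f ∘ w)

/-- The cone with apex `b`. -/
def cone (b : V) (m : ℕ) : ((Fin m → V) →₀ K) →ₗ[K] ((Fin (m + 1) → V) →₀ K) :=
  Finsupp.lmapDomain K K (fun w => Fin.cons b w)

theorem boundary_single (m : ℕ) (w : Fin (m + 1) → V) (a : K) :
    boundary m (Finsupp.single w a) =
      ∑ i : Fin (m + 1), (-1 : K) ^ (i : ℕ) • Finsupp.single (w ∘ i.succAbove) a := by
  simp [boundary, LinearMap.sum_apply, Finsupp.mapDomain_single]

theorem cone_single (b : V) (m : ℕ) (w : Fin m → V) (a : K) :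
    cone b m (Finsupp.single w a) = Finsupp.single (Fin.cons b w : Fin (m + 1) → V) a := by
  simp [cone, Finsupp.mapDomain_single]

theorem boundary_cone_zero (b : V) (c : (Fin 0 → V) →₀ K) : boundary 0 (cone b 0 c) = c := by
  induction c using Finsupp.induction_linear with
  | zero => simp
  | add x y hx hy => simp [hx, hy]
  | single w a =>
    rw [cone_single, boundary_single]
    simp [Subsingleton.elim _ w]

/-- The face opposite the apex returns the base, and every other face is the cone on a face of the
base, with its sign shifted by one. -/
theorem boundary_cone_succ (b : V) (m : ℕ) (c : (Fin (m + 1) → V) →₀ K) :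
    boundary (m + 1) (cone b (m + 1) c) = c - cone b m (boundary m c) := by
  induction c using Finsupp.induction_linear with
  | zero => simp
  | add x y hx hy => simp only [map_add, hx, hy]; abel
  | single w a =>
    rw [cone_single, boundary_single, boundary_single, Fin.sum_univ_succ, map_sum]
    have h0 : (Fin.cons b w : Fin (m + 2) → V) ∘ (0 : Fin (m + 2)).succAbove = w := by
      ext i; simp
    have h1 (i : Fin (m + 1)) : (Fin.cons b w : Fin (m + 2) → V) ∘ i.succ.succAbove =
        Fin.cons b (w ∘ i.succAbove) := by
      ext j
      refine Fin.cases ?_ (fun j => ?_) j <;> simp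
    simp only [h0, h1, Fin.val_zero, pow_zero, one_smul, map_smul, cone_single, Fin.val_succ,
      pow_succ, mul_neg, mul_one, neg_smul, Finset.sum_neg_distrib, sub_eq_add_neg]

/-- Every tuple is the cone on its tail with its own first entry as apex, so the cone formula turns
the claim into the same claim for the tail. No cancellation of pairs of faces is needed. -/
theorem boundary_boundary (m : ℕ) (c : (Fin (m + 2) → V) →₀ K) :
    boundary m (boundary (m + 1) c) = 0 := by
  induction c using Finsupp.induction_linear with
  | zero => simp
  | add x y hx hy => simp [hx, hy]
  | single w a =>
    have hw : Finsupp.single w a = cone (w 0) (m + 1) (Finsupp.single (Fin.tail w) a) := by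
      rw [cone_single, Fin.cons_self_tail]
    rw [hw, boundary_cone_succ, map_sub]
    induction m with
    | zero => rw [boundary_cone_zero, sub_self]
    | succ m ih =>
      rw [boundary_cone_succ]
      have hw' : Finsupp.single (Fin.tail w) a =
          cone (Fin.tail w 0) (m + 1) (Finsupp.single (Fin.tail (Fin.tail w)) a) := by
        rw [cone_single, Fin.cons_self_tail]
      have := ih (Fin.tail w) hw'
      rw [← map_sub, ← boundary_cone_succ, ← hw'] at this
      rw [this, map_zero]
      abel

theorem map_boundary (f : V → V') (m : ℕ) (c : (Fin (m + 1) → V) →₀ K) :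
    map f m (boundary m c) = boundary m (map f (m + 1) c) := by
  induction c using Finsupp.induction_linear with
  | zero => simp
  | add x y hx hy => simp only [map_add, hx, hy]
  | single w a =>
    simp only [boundary_single, map_sum, map_smul, Finsupp.lmapDomain_apply,
      Finsupp.mapDomain_single, Function.comp_assoc]

theorem map_cone (f : V → V') (b : V) (m : ℕ) (c : (Fin m → V) →₀ K) :
    map f (m + 1) (cone b m c) = cone (f b) m (map f m c) := by
  induction c using Finsupp.induction_linear with
  | zero => simp
  | add x y hx hy => simp only [map_add, hx, hy]
  | single w a =>
    simp only [cone_single, Finsupp.lmapDomain_apply, Finsupp.mapDomain_single]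
    congr 1
    ext j
    refine Fin.cases ?_ (fun j => ?_) j <;> simp

theorem map_map {V'' : Type*} (f : V → V') (g : V' → V'') (m : ℕ) (c : (Fin m → V) →₀ K) :
    map g m (map f m c) = map (g ∘ f) m c := by
  simp [← Finsupp.mapDomain_comp, Function.comp_def]

section Subdivision

variable (b : ∀ m : ℕ, (Fin (m + 1) → V) → V) (b' : ∀ m : ℕ, (Fin (m + 1) → V') → V')

/-- The subdivision operator obtained by coning off inductively at the points `b`. -/
def subdivision : ∀ m : ℕ, ((Fin m → V) →₀ K) →ₗ[K] ((Fin m → V) →₀ K)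
  | 0 => LinearMap.id
  | m + 1 => Finsupp.linearCombination K fun w =>
      cone (b m w) m (subdivision m (boundary m (Finsupp.single w 1)))

theorem subdivision_single (m : ℕ) (w : Fin (m + 1) → V) :
    subdivision b (m + 1) (Finsupp.single w (1 : K)) =
      cone (b m w) m (subdivision b m (boundary m (Finsupp.single w 1))) := by
  simp [subdivision]

/-- Two linear maps on finitely supported functions are equal if they agree on the basis. -/
theorem linearMap_eq_of_single {α W : Type*} [AddCommGroup W] [Module K W]
    {f g : (α →₀ K) →ₗ[K] W}
    (h : ∀ w, f (Finsupp.single w 1) = g (Finsupp.single w 1)) (c : α →₀ K) : f c = g c :=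
  LinearMap.congr_fun (Finsupp.lhom_ext' fun w => LinearMap.ext_ring (h w)) c

/-- The chain coned off is the subdivision of a boundary. By induction its own boundary vanishes, so
the boundary of the cone is just that chain. -/
theorem boundary_subdivision (m : ℕ) (c : (Fin (m + 1) → V) →₀ K) :
    boundary m (subdivision b (m + 1) c) = subdivision b m (boundary m c) := by
  induction m with
  | zero =>
    refine linearMap_eq_of_single (f := boundary 0 ∘ₗ subdivision b 1)
      (g := subdivision b 0 ∘ₗ boundary 0) (fun w => ?_) c
    simp only [LinearMap.comp_apply]
    rw [subdivision_single, boundary_cone_zero]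
  | succ m ih =>
    refine linearMap_eq_of_single (f := boundary (m + 1) ∘ₗ subdivision b (m + 2))
      (g := subdivision b (m + 1) ∘ₗ boundary (m + 1)) (fun w => ?_) c
    simp only [LinearMap.comp_apply]
    rw [subdivision_single, boundary_cone_succ, ih, boundary_boundary, map_zero, map_zero,
      sub_zero]

-- With affine maps for `f` and barycenters for `b` and `b'`, this naturality lets the subdivision
-- descend to singular simplices.
variable {b b'} in
theorem map_subdivision {f : V → V'} (hf : ∀ m w, f (b m w) = b' m (f ∘ w)) (m : ℕ)
    (c : (Fin m → V) →₀ K) :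
    map f m (subdivision b m c) = subdivision b' m (map f m c) := by
  induction m with
  | zero => rfl
  | succ m ih =>
    refine linearMap_eq_of_single (f := map f (m + 1) ∘ₗ subdivision b (m + 1))
      (g := subdivision b' (m + 1) ∘ₗ map f (m + 1)) (fun w => ?_) c
    simp only [LinearMap.comp_apply]
    rw [subdivision_single, map_cone, ih, map_boundary, hf]
    simp only [Finsupp.lmapDomain_apply, Finsupp.mapDomain_single]
    rw [subdivision_single]

/-- The prism operator: a chain homotopy, in `V × S`, between the inclusion at the level `s₁` and
the subdivision at the level `s₀`. -/
def prism (s₀ s₁ : S) : ∀ m : ℕ, ((Fin m → V) →₀ K) →ₗ[K] ((Fin (m + 1) → V × S) →₀ K)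
  | 0 => 0
  | m + 1 => Finsupp.linearCombination K fun w =>
      cone (b m w, s₀) (m + 1) (map (fun x => (x, s₁)) (m + 1) (Finsupp.single w 1) -
        map (fun x => (x, s₀)) (m + 1) (subdivision b (m + 1) (Finsupp.single w 1)) -
        prism s₀ s₁ m (boundary m (Finsupp.single w 1)))

theorem prism_single (s₀ s₁ : S) (m : ℕ) (w : Fin (m + 1) → V) :
    prism b s₀ s₁ (m + 1) (Finsupp.single w (1 : K)) =
      cone (b m w, s₀) (m + 1) (map (fun x => (x, s₁)) (m + 1) (Finsupp.single w 1) -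
        map (fun x => (x, s₀)) (m + 1) (subdivision b (m + 1) (Finsupp.single w 1)) -
        prism b s₀ s₁ m (boundary m (Finsupp.single w 1))) := by
  simp [prism]

/-- The boundary of a cone returns its base when the base is a cycle. Here the base is a cycle by
induction, because subdivision commutes with the boundary. -/
theorem boundary_prism (s₀ s₁ : S) (m : ℕ) (c : (Fin (m + 1) → V) →₀ K) :
    boundary (m + 1) (prism b s₀ s₁ (m + 1) c) =
      map (fun x => (x, s₁)) (m + 1) c -
        map (fun x => (x, s₀)) (m + 1) (subdivision b (m + 1) c) -
        prism b s₀ s₁ m (boundary m c) := by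
  induction m with
  | zero =>
    refine linearMap_eq_of_single (f := boundary 1 ∘ₗ prism b s₀ s₁ 1)
      (g := map (fun x => (x, s₁)) 1 - map (fun x => (x, s₀)) 1 ∘ₗ subdivision b 1 -
        prism b s₀ s₁ 0 ∘ₗ boundary 0) (fun w => ?_) c
    simp only [LinearMap.comp_apply, LinearMap.sub_apply]
    rw [prism_single, boundary_cone_succ, sub_eq_self, map_sub (boundary 0 (K := K)),
      map_sub (boundary 0 (K := K)), ← map_boundary,
      ← map_boundary, boundary_subdivision]
    -- The empty tuple has the same image at both levels, so the augmentation terms cancel although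
    -- the prism is zero at the bottom.
    have h : (fun w : Fin 0 → V => (fun x => (x, s₁)) ∘ w) = fun w => (fun x => (x, s₀)) ∘ w :=
      funext fun w => Subsingleton.elim _ _
    simp only [map, h, subdivision, prism, LinearMap.id_apply, LinearMap.zero_apply, map_zero,
      sub_self]
  | succ m ih =>
    refine linearMap_eq_of_single (f := boundary (m + 2) ∘ₗ prism b s₀ s₁ (m + 2))
      (g := map (fun x => (x, s₁)) (m + 2) - map (fun x => (x, s₀)) (m + 2) ∘ₗ
        subdivision b (m + 2) - prism b s₀ s₁ (m + 1) ∘ₗ boundary (m + 1)) (fun w => ?_) c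
    simp only [LinearMap.comp_apply, LinearMap.sub_apply]
    rw [prism_single, boundary_cone_succ, sub_eq_self, map_sub (boundary (m + 1) (K := K)),
      map_sub (boundary (m + 1) (K := K)), ← map_boundary,
      ← map_boundary, boundary_subdivision, ih, boundary_boundary, map_zero, sub_zero, sub_self,
      map_zero]

variable {b b'} in
theorem map_prism {f : V → V'} (hf : ∀ m w, f (b m w) = b' m (f ∘ w)) (s₀ s₁ : S) (m : ℕ)
    (c : (Fin m → V) →₀ K) :
    map (Prod.map f id) (m + 1) (prism b s₀ s₁ m c) = prism b' s₀ s₁ m (map f m c) := by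
  induction m with
  | zero => simp [prism]
  | succ m ih =>
    refine linearMap_eq_of_single (f := map (Prod.map f id) (m + 2) ∘ₗ prism b s₀ s₁ (m + 1))
      (g := prism b' s₀ s₁ (m + 1) ∘ₗ map f (m + 1)) (fun w => ?_) c
    have h (s : S) : Prod.map f id ∘ (fun x => (x, s)) = (fun x => (x, s)) ∘ f := rfl
    simp only [LinearMap.comp_apply]
    rw [prism_single, map_cone, map_sub (map (K := K) (Prod.map f id) (m + 1)),
      map_sub (map (K := K) (Prod.map f id) (m + 1)), ih, map_map, map_map, map_boundary, h, h,
      ← map_map, ← map_map, map_subdivision hf]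
    simp only [Finsupp.lmapDomain_apply, Finsupp.mapDomain_single, Prod.map_apply, id_eq, hf]
    rw [prism_single]
    simp only [Finsupp.lmapDomain_apply, Finsupp.mapDomain_single]

end Subdivision

end TupleChain

/-! ## Affine simplices and singular chains -/

/-- The affine map from a standard simplex to a standard simplex with prescribed vertices. -/
def affineSimplex {m n : ℕ} (w : Fin m → stdSimplex ℝ (Fin n)) :
    C(stdSimplex ℝ (Fin m), stdSimplex ℝ (Fin n)) where
  toFun x := ⟨∑ i, x i • (w i : Fin n → ℝ), (convex_stdSimplex ℝ (Fin n)).sum_mem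
    (fun i _ => x.2.1 i) x.2.2 (fun i _ => (w i).2)⟩
  continuous_toFun := by
    refine Continuous.subtype_mk ?_ _
    refine continuous_finsetSum _ fun i _ => ?_
    exact ((continuous_apply i).comp continuous_subtype_val).smul continuous_const

theorem affineSimplex_coe {m n : ℕ} (w : Fin m → stdSimplex ℝ (Fin n))
    (x : stdSimplex ℝ (Fin m)) :
    (affineSimplex w x : Fin n → ℝ) = ∑ i, x i • (w i : Fin n → ℝ) := rfl

theorem affineSimplex_affineSimplex {k m n : ℕ} (f : Fin m → stdSimplex ℝ (Fin n))
    (w : Fin k → stdSimplex ℝ (Fin m)) :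
    (affineSimplex f).comp (affineSimplex w) = affineSimplex (affineSimplex f ∘ w) := by
  ext x j
  simp only [ContinuousMap.comp_apply, affineSimplex_coe, Function.comp_apply]
  simp only [Finset.sum_smul, Finset.smul_sum, Finset.sum_apply, Pi.smul_apply, smul_eq_mul]
  rw [Finset.sum_comm]
  simp only [mul_assoc]

theorem affineSimplex_vertex (m : ℕ) :
    affineSimplex (fun i : Fin m => stdSimplex.vertex (S := ℝ) i) = ContinuousMap.id _ := by
  ext x j
  simp [affineSimplex_coe, stdSimplex.vertex_coe, Pi.single_apply]

theorem affineSimplex_apply_vertex {m n : ℕ} (w : Fin m → stdSimplex ℝ (Fin n)) (i : Fin m) :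
    affineSimplex w (stdSimplex.vertex (S := ℝ) i) = w i := by
  ext j
  have h (l : Fin m) : (stdSimplex.vertex (S := ℝ) i) l = (Pi.single i 1 : Fin m → ℝ) l := rfl
  simp [affineSimplex_coe, h, Pi.single_apply, Finset.sum_apply, ite_apply]

theorem affineSimplex_const {m n : ℕ} (y : stdSimplex ℝ (Fin n)) :
    affineSimplex (fun _ : Fin m => y) = ContinuousMap.const _ y := by
  ext x j
  simp only [affineSimplex_coe, ← Finset.sum_smul]
  have : ∑ i, x i = 1 := x.2.2
  simp [this]

/-- The `i`-th face of the standard simplex. -/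
def faceMap {m : ℕ} (i : Fin (m + 1)) : C(stdSimplex ℝ (Fin m), stdSimplex ℝ (Fin (m + 1))) :=
  ⟨stdSimplex.map i.succAbove, stdSimplex.continuous_map _⟩

theorem faceMap_eq {m : ℕ} (i : Fin (m + 1)) :
    faceMap i = affineSimplex fun j => stdSimplex.vertex (S := ℝ) (i.succAbove j) := by
  ext x j
  simp [faceMap, affineSimplex_coe, stdSimplex.vertex_coe, FunOnFinite.linearMap_apply_apply,
    Pi.single_apply, Finset.sum_filter, eq_comm]

theorem affineSimplex_comp_faceMap {m n : ℕ} (w : Fin (m + 1) → stdSimplex ℝ (Fin n))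
    (i : Fin (m + 1)) : (affineSimplex w).comp (faceMap i) = affineSimplex (w ∘ i.succAbove) := by
  rw [faceMap_eq, affineSimplex_affineSimplex]
  congr 1
  ext1 j
  exact affineSimplex_apply_vertex _ _

/-- The barycenter of a tuple of points of a standard simplex. -/
def tupleBarycenter {n : ℕ} (m : ℕ) (w : Fin (m + 1) → stdSimplex ℝ (Fin n)) :
    stdSimplex ℝ (Fin n) :=
  affineSimplex w stdSimplex.barycenter

/-- Barycenters are affine combinations; this is the compatibility that `TupleChain.map_subdivision`
and `TupleChain.map_prism` require. -/
theorem affineSimplex_tupleBarycenter {k n : ℕ} (f : Fin k → stdSimplex ℝ (Fin n)) (m : ℕ)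
    (w : Fin (m + 1) → stdSimplex ℝ (Fin k)) :
    affineSimplex f (tupleBarycenter m w) = tupleBarycenter m (affineSimplex f ∘ w) :=
  DFunLike.congr_fun (affineSimplex_affineSimplex f w) _

namespace SingularChain

variable (K : Type v) [Field K] {Y Z W : Type*} [TopologicalSpace Y] [TopologicalSpace Z]
  [TopologicalSpace W]

/-- Singular chains, indexed by the number of vertices of the simplices (so that the chains with
index `0` are a copy of `K`, for the augmentation). -/
abbrev Chain (Y : Type*) [TopologicalSpace Y] (m : ℕ) : Type _ :=
  C(stdSimplex ℝ (Fin m), Y) →₀ K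

variable {K}

/-- The boundary of singular chains. -/
def boundary (m : ℕ) : Chain K Y (m + 1) →ₗ[K] Chain K Y m :=
  ∑ i : Fin (m + 1), (-1 : K) ^ (i : ℕ) • Finsupp.lmapDomain K K (fun σ => σ.comp (faceMap i))

/-- The map of singular chains induced by a continuous map. -/
def map (f : C(Y, Z)) (m : ℕ) : Chain K Y m →ₗ[K] Chain K Z m :=
  Finsupp.lmapDomain K K f.comp

theorem boundary_single (m : ℕ) (σ : C(stdSimplex ℝ (Fin (m + 1)), Y)) (a : K) :
    boundary m (Finsupp.single σ a) =
      ∑ i : Fin (m + 1), (-1 : K) ^ (i : ℕ) • Finsupp.single (σ.comp (faceMap i)) a := by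
  simp [boundary, LinearMap.sum_apply, Finsupp.mapDomain_single]

@[simp]
theorem map_single (f : C(Y, Z)) (m : ℕ) (σ : C(stdSimplex ℝ (Fin m), Y)) (a : K) :
    map f m (Finsupp.single σ a) = Finsupp.single (f.comp σ) a := by
  simp [map, Finsupp.mapDomain_single]

theorem map_boundary (f : C(Y, Z)) (m : ℕ) (c : Chain K Y (m + 1)) :
    map f m (boundary m c) = boundary m (map f (m + 1) c) := by
  induction c using Finsupp.induction_linear with
  | zero => simp
  | add x y hx hy => simp only [map_add, hx, hy]
  | single w a =>
    simp only [boundary_single, map_sum, map_smul, map_single, ContinuousMap.comp_assoc]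

theorem map_map (f : C(Y, Z)) (g : C(Z, W)) (m : ℕ) (c : Chain K Y m) :
    map g m (map f m c) = map (g.comp f) m c := by
  induction c using Finsupp.induction_linear with
  | zero => simp
  | add x y hx hy => simp only [map_add, hx, hy]
  | single w a => simp [ContinuousMap.comp_assoc]

theorem map_id (m : ℕ) (c : Chain K Y m) : map (ContinuousMap.id Y) m c = c := by
  induction c using Finsupp.induction_linear with
  | zero => simp
  | add x y hx hy => simp only [map_add, hx, hy]
  | single w a => simp

/-- The map of chains induced by a realization of tuples as singular simplices. -/
def realize {V : Type*} (r : ∀ m : ℕ, (Fin m → V) → C(stdSimplex ℝ (Fin m), Y)) (m : ℕ) :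
    ((Fin m → V) →₀ K) →ₗ[K] Chain K Y m :=
  Finsupp.lmapDomain K K (r m)

@[simp]
theorem realize_single {V : Type*} (r : ∀ m : ℕ, (Fin m → V) → C(stdSimplex ℝ (Fin m), Y))
    (m : ℕ) (w : Fin m → V) (a : K) :
    realize r m (Finsupp.single w a) = Finsupp.single (r m w) a := by
  simp [realize, Finsupp.mapDomain_single]

theorem boundary_realize {V : Type*} {r : ∀ m : ℕ, (Fin m → V) → C(stdSimplex ℝ (Fin m), Y)}
    (hr : ∀ (m : ℕ) (w : Fin (m + 1) → V) (i : Fin (m + 1)),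
      (r (m + 1) w).comp (faceMap i) = r m (w ∘ i.succAbove)) (m : ℕ)
    (c : (Fin (m + 1) → V) →₀ K) :
    boundary m (realize r (m + 1) c) = realize r m (TupleChain.boundary m c) := by
  induction c using Finsupp.induction_linear with
  | zero => simp
  | add x y hx hy => simp only [map_add, hx, hy]
  | single w a =>
    simp only [realize_single, boundary_single, TupleChain.boundary_single, map_sum, map_smul, hr]

/-- The chain in `Y` obtained by applying a singular simplex to a chain of affine simplices. -/
def push {n : ℕ} (σ : C(stdSimplex ℝ (Fin n), Y)) (m : ℕ) :
    ((Fin m → stdSimplex ℝ (Fin n)) →₀ K) →ₗ[K] Chain K Y m :=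
  realize (fun _ w => σ.comp (affineSimplex w)) m

/-- The chain in `Y` obtained by applying a singular prism to a chain of affine simplices. -/
def pushPrism {n k : ℕ} (σ : C(stdSimplex ℝ (Fin n) × stdSimplex ℝ (Fin k), Y)) (m : ℕ) :
    ((Fin m → stdSimplex ℝ (Fin n) × stdSimplex ℝ (Fin k)) →₀ K) →ₗ[K] Chain K Y m :=
  realize (fun _ w => σ.comp
    ((affineSimplex (Prod.fst ∘ w)).prodMk (affineSimplex (Prod.snd ∘ w)))) m

theorem boundary_push {n : ℕ} (σ : C(stdSimplex ℝ (Fin n), Y)) (m : ℕ)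
    (c : (Fin (m + 1) → stdSimplex ℝ (Fin n)) →₀ K) :
    boundary m (push σ (m + 1) c) = push σ m (TupleChain.boundary m c) :=
  boundary_realize (fun m w i => by
    rw [ContinuousMap.comp_assoc, affineSimplex_comp_faceMap]) m c

theorem boundary_pushPrism {n k : ℕ} (σ : C(stdSimplex ℝ (Fin n) × stdSimplex ℝ (Fin k), Y))
    (m : ℕ) (c : (Fin (m + 1) → stdSimplex ℝ (Fin n) × stdSimplex ℝ (Fin k)) →₀ K) :
    boundary m (pushPrism σ (m + 1) c) = pushPrism σ m (TupleChain.boundary m c) :=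
  boundary_realize (fun m w i => by
    rw [ContinuousMap.comp_assoc]
    exact congrArg σ.comp (congrArg₂ ContinuousMap.prodMk (affineSimplex_comp_faceMap _ _)
      (affineSimplex_comp_faceMap _ _))) m c

/-- The tautological chain of the standard simplex. -/
def vertices (m : ℕ) : Fin m → stdSimplex ℝ (Fin m) := fun i => stdSimplex.vertex (S := ℝ) i

theorem push_vertices {m : ℕ} (σ : C(stdSimplex ℝ (Fin m), Y)) (a : K) :
    push σ m (Finsupp.single (vertices m) a) = Finsupp.single σ a := by
  rw [push, realize_single]
  congr 1
  exact (congrArg σ.comp (affineSimplex_vertex m)).trans (ContinuousMap.comp_id σ)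

theorem map_affineSimplex_vertices {m n : ℕ} (w : Fin m → stdSimplex ℝ (Fin n)) (a : K) :
    TupleChain.map (affineSimplex w) m (Finsupp.single (vertices m) a) = Finsupp.single w a := by
  simp only [Finsupp.lmapDomain_apply, Finsupp.mapDomain_single]
  congr 1
  ext1 i
  exact affineSimplex_apply_vertex w i

theorem push_comp_affineSimplex {k n : ℕ} (σ : C(stdSimplex ℝ (Fin n), Y))
    (w : Fin k → stdSimplex ℝ (Fin n)) (m : ℕ) (c : (Fin m → stdSimplex ℝ (Fin k)) →₀ K) :
    push (σ.comp (affineSimplex w)) m c = push σ m (TupleChain.map (affineSimplex w) m c) := by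
  induction c using Finsupp.induction_linear with
  | zero => simp
  | add x y hx hy => simp only [map_add, hx, hy]
  | single w a =>
    simp [push, Finsupp.mapDomain_single, ContinuousMap.comp_assoc, affineSimplex_affineSimplex]

/-- The barycentric subdivision of singular chains. -/
def subdivision (m : ℕ) : Chain K Y m →ₗ[K] Chain K Y m :=
  Finsupp.linearCombination K fun σ => push σ m
    (TupleChain.subdivision tupleBarycenter m (Finsupp.single (vertices m) 1))

theorem subdivision_single (m : ℕ) (σ : C(stdSimplex ℝ (Fin m), Y)) :
    subdivision m (Finsupp.single σ (1 : K)) = push σ m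
      (TupleChain.subdivision tupleBarycenter m (Finsupp.single (vertices m) 1)) := by
  simp [subdivision]

/-- The singular subdivision is defined from the tautological tuple of vertices only. Naturality
under the affine map with vertices `w` carries it to every tuple, which allows subdivisions to be
iterated inside one fixed simplex. -/
theorem subdivision_push {n : ℕ} (σ : C(stdSimplex ℝ (Fin n), Y)) (m : ℕ)
    (c : (Fin m → stdSimplex ℝ (Fin n)) →₀ K) :
    subdivision m (push σ m c) = push σ m (TupleChain.subdivision tupleBarycenter m c) := by
  refine TupleChain.linearMap_eq_of_single (f := subdivision m ∘ₗ push σ m)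
    (g := push σ m ∘ₗ TupleChain.subdivision tupleBarycenter m) (fun w => ?_) c
  simp only [LinearMap.comp_apply]
  have h : push σ m (Finsupp.single w (1 : K)) = Finsupp.single (σ.comp (affineSimplex w)) 1 := by
    simp [push]
  rw [h, subdivision_single, push_comp_affineSimplex,
    TupleChain.map_subdivision (affineSimplex_tupleBarycenter w), map_affineSimplex_vertices]

theorem boundary_subdivision (m : ℕ) (c : Chain K Y (m + 1)) :
    boundary m (subdivision (m + 1) c) = subdivision m (boundary m c) := by
  refine TupleChain.linearMap_eq_of_single (f := boundary m ∘ₗ subdivision (m + 1))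
    (g := subdivision m ∘ₗ boundary m) (fun σ => ?_) c
  simp only [LinearMap.comp_apply]
  rw [subdivision_single, boundary_push, TupleChain.boundary_subdivision, ← push_vertices,
    boundary_push, subdivision_push]

theorem boundary_boundary (m : ℕ) (c : Chain K Y (m + 2)) :
    boundary m (boundary (m + 1) c) = 0 := by
  refine TupleChain.linearMap_eq_of_single (f := boundary m ∘ₗ boundary (m + 1))
    (g := 0) (fun σ => ?_) c
  simp only [LinearMap.comp_apply]
  rw [← push_vertices, boundary_push, boundary_push, TupleChain.boundary_boundary, map_zero,
    LinearMap.zero_apply]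

/-- The two vertices of the standard `1`-simplex, used as the parameter space of homotopies. -/
abbrev endpoint (i : Fin 2) : stdSimplex ℝ (Fin 2) := stdSimplex.vertex (S := ℝ) i

/-- The slice of a homotopy at a given time. -/
def slice (H : C(Y × stdSimplex ℝ (Fin 2), Z)) (s : stdSimplex ℝ (Fin 2)) : C(Y, Z) :=
  H.comp ((ContinuousMap.id Y).prodMk (ContinuousMap.const Y s))

/-- The chain homotopy defined by a homotopy of continuous maps. -/
def prism (H : C(Y × stdSimplex ℝ (Fin 2), Z)) (m : ℕ) : Chain K Y m →ₗ[K] Chain K Z (m + 1) :=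
  Finsupp.linearCombination K fun σ =>
    pushPrism (H.comp (σ.prodMap (ContinuousMap.id _))) (m + 1)
      (TupleChain.prism tupleBarycenter (endpoint 0) (endpoint 1) m
        (Finsupp.single (vertices m) 1))

theorem prism_single (H : C(Y × stdSimplex ℝ (Fin 2), Z)) (m : ℕ)
    (σ : C(stdSimplex ℝ (Fin m), Y)) :
    prism H m (Finsupp.single σ (1 : K)) =
      pushPrism (H.comp (σ.prodMap (ContinuousMap.id _))) (m + 1)
      (TupleChain.prism tupleBarycenter (endpoint 0) (endpoint 1) m
        (Finsupp.single (vertices m) 1)) := by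
  simp [prism]

theorem pushPrism_comp_affineSimplex {k n l : ℕ}
    (τ : C(stdSimplex ℝ (Fin n) × stdSimplex ℝ (Fin l), Y))
    (w : Fin k → stdSimplex ℝ (Fin n)) (m : ℕ)
    (c : (Fin m → stdSimplex ℝ (Fin k) × stdSimplex ℝ (Fin l)) →₀ K) :
    pushPrism (τ.comp ((affineSimplex w).prodMap (ContinuousMap.id _))) m c =
      pushPrism τ m (TupleChain.map (Prod.map (affineSimplex w) id) m c) := by
  induction c using Finsupp.induction_linear with
  | zero => simp
  | add x y hx hy => simp only [map_add, hx, hy]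
  | single v a =>
    simp only [pushPrism, realize_single, Finsupp.lmapDomain_apply, Finsupp.mapDomain_single,
      ContinuousMap.comp_assoc]
    congr 2
    have h : Prod.fst ∘ Prod.map (affineSimplex w) id ∘ v = affineSimplex w ∘ Prod.fst ∘ v := rfl
    rw [h, ← affineSimplex_affineSimplex]
    rfl

theorem prism_push {n : ℕ} (H : C(Y × stdSimplex ℝ (Fin 2), Z)) (σ : C(stdSimplex ℝ (Fin n), Y))
    (m : ℕ) (c : (Fin m → stdSimplex ℝ (Fin n)) →₀ K) :
    prism H m (push σ m c) = pushPrism (H.comp (σ.prodMap (ContinuousMap.id _))) (m + 1)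
      (TupleChain.prism tupleBarycenter (endpoint 0) (endpoint 1) m c) := by
  refine TupleChain.linearMap_eq_of_single (f := prism H m ∘ₗ push σ m)
    (g := pushPrism (H.comp (σ.prodMap (ContinuousMap.id _))) (m + 1) ∘ₗ
      TupleChain.prism tupleBarycenter (endpoint 0) (endpoint 1) m) (fun w => ?_) c
  simp only [LinearMap.comp_apply]
  have h : push σ m (Finsupp.single w (1 : K)) = Finsupp.single (σ.comp (affineSimplex w)) 1 := by
    simp [push]
  have h2 : H.comp ((σ.comp (affineSimplex w)).prodMap (ContinuousMap.id _)) =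
      (H.comp (σ.prodMap (ContinuousMap.id _))).comp
        ((affineSimplex w).prodMap (ContinuousMap.id _)) := rfl
  rw [h, prism_single, h2, pushPrism_comp_affineSimplex,
    TupleChain.map_prism (affineSimplex_tupleBarycenter w), map_affineSimplex_vertices]

theorem pushPrism_level {n : ℕ} (H : C(Y × stdSimplex ℝ (Fin 2), Z))
    (σ : C(stdSimplex ℝ (Fin n), Y)) (s : stdSimplex ℝ (Fin 2)) (m : ℕ)
    (c : (Fin m → stdSimplex ℝ (Fin n)) →₀ K) :
    pushPrism (H.comp (σ.prodMap (ContinuousMap.id _))) m (TupleChain.map (fun x => (x, s)) m c) =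
      map (slice H s) m (push σ m c) := by
  induction c using Finsupp.induction_linear with
  | zero => simp
  | add x y hx hy => simp only [map_add, hx, hy]
  | single v a =>
    simp only [pushPrism, push, realize_single, Finsupp.lmapDomain_apply, Finsupp.mapDomain_single,
      map_single]
    congr 1
    have h : Prod.snd ∘ (fun x => (x, s)) ∘ v = fun _ => s := rfl
    rw [h, affineSimplex_const]
    rfl

/-- A single formula serves two purposes: the constant homotopy shows that subdivision is homotopic
to the identity, and a general one, combined with this, gives homotopy invariance. -/
theorem boundary_prism (H : C(Y × stdSimplex ℝ (Fin 2), Z)) (m : ℕ) (c : Chain K Y (m + 1)) :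
    boundary (m + 1) (prism H (m + 1) c) = map (slice H (endpoint 1)) (m + 1) c -
      map (slice H (endpoint 0)) (m + 1) (subdivision (m + 1) c) - prism H m (boundary m c) := by
  refine TupleChain.linearMap_eq_of_single (f := boundary (m + 1) ∘ₗ prism H (m + 1))
    (g := map (slice H (endpoint 1)) (m + 1) -
      map (slice H (endpoint 0)) (m + 1) ∘ₗ subdivision (m + 1) - prism H m ∘ₗ boundary m)
    (fun σ => ?_) c
  simp only [LinearMap.comp_apply, LinearMap.sub_apply]
  rw [prism_single, boundary_pushPrism, TupleChain.boundary_prism, map_sub, map_sub,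
    pushPrism_level, pushPrism_level, ← prism_push, ← boundary_push, ← subdivision_push,
    push_vertices]

end SingularChain

/-! ## Small chains -/

namespace TupleChain

variable {K : Type v} [Field K] {V : Type*}

/-- A linear map defined on finitely supported functions sends the functions supported in `s` to
`P` if it does so for the basis elements. -/
theorem map_mem_of_single_mem {α W : Type*} [AddCommGroup W] [Module K W] {f : (α →₀ K) →ₗ[K] W}
    {s : Set α} {P : Submodule K W} (h : ∀ a ∈ s, f (Finsupp.single a 1) ∈ P) {c : α →₀ K}
    (hc : c ∈ Finsupp.supported K K s) : f c ∈ P := by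
  rw [Finsupp.supported_eq_span_single] at hc
  have : Submodule.span K ((fun i => Finsupp.single i (1 : K)) '' s) ≤ P.comap f := by
    rw [Submodule.span_le]
    rintro _ ⟨a, ha, rfl⟩
    exact h a ha
  exact this hc

theorem boundary_mem_supported {s : ∀ m, Set (Fin m → V)}
    (hs : ∀ m, ∀ w ∈ s (m + 1), ∀ i : Fin (m + 1), w ∘ i.succAbove ∈ s m) {m : ℕ}
    {c : (Fin (m + 1) → V) →₀ K} (hc : c ∈ Finsupp.supported K K (s (m + 1))) :
    boundary m c ∈ Finsupp.supported K K (s m) := by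
  refine map_mem_of_single_mem (fun w hw => ?_) hc
  rw [boundary_single]
  exact Submodule.sum_mem _ fun i _ => Submodule.smul_mem _ _
    (Finsupp.single_mem_supported K _ (hs m w hw i))

/-- Applied with `Q` a closed ball, this keeps all the vertices of a subdivided face close to the
apex of the next cone. -/
theorem subdivision_mem_supported {b : ∀ m : ℕ, (Fin (m + 1) → V) → V} {Q : Set V}
    (hQ : ∀ m w, (∀ i, w i ∈ Q) → b m w ∈ Q) {m : ℕ} {c : (Fin m → V) →₀ K}
    (hc : c ∈ Finsupp.supported K K {w : Fin m → V | ∀ i, w i ∈ Q}) :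
    subdivision b m c ∈ Finsupp.supported K K {w : Fin m → V | ∀ i, w i ∈ Q} := by
  induction m with
  | zero => exact hc
  | succ m ih =>
    refine map_mem_of_single_mem (fun w hw => ?_) hc
    rw [subdivision_single]
    have h1 : boundary m (Finsupp.single w (1 : K)) ∈
        Finsupp.supported K K {w : Fin m → V | ∀ i, w i ∈ Q} :=
      boundary_mem_supported (s := fun m => {w : Fin m → V | ∀ i, w i ∈ Q})
        (fun m w hw i j => hw _) (Finsupp.single_mem_supported K _ hw)
    refine map_mem_of_single_mem (f := cone (b m w) m) (fun w' hw' => ?_) (ih h1)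
    rw [cone_single]
    refine Finsupp.single_mem_supported K _ fun j => ?_
    refine Fin.cases ?_ (fun j => ?_) j
    · simpa using hQ m w hw
    · simpa using hw' j

end TupleChain

theorem affineSimplex_mem_closedBall {m n : ℕ} {w : Fin m → stdSimplex ℝ (Fin n)}
    {y : stdSimplex ℝ (Fin n)} {r : ℝ} (h : ∀ i, w i ∈ Metric.closedBall y r)
    (x : stdSimplex ℝ (Fin m)) : affineSimplex w x ∈ Metric.closedBall y r :=
  (convex_closedBall (y : Fin n → ℝ) r).sum_mem (fun i _ => x.2.1 i) x.2.2 (fun i _ => h i)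

/-- The difference between the barycenter and `w k` is the average of the m + 1 differences `w i - w
k`. One of them is zero, which produces the factor m/(m + 1). -/
theorem dist_tupleBarycenter_le {m n : ℕ} {w : Fin (m + 1) → stdSimplex ℝ (Fin n)} {d : ℝ}
    (h : ∀ i j, dist (w i) (w j) ≤ d) (k : Fin (m + 1)) :
    dist (w k) (tupleBarycenter m w) ≤ (1 - ((m + 1 : ℕ) : ℝ)⁻¹) * d := by
  rw [dist_comm, Subtype.dist_eq, dist_eq_norm]
  have hpos : (0 : ℝ) < ((m + 1 : ℕ) : ℝ) := by positivity
  have e : (tupleBarycenter m w).1 - (w k).1 =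
      ((m + 1 : ℕ) : ℝ)⁻¹ • ∑ i ∈ Finset.univ.erase k, ((w i).1 - (w k).1) := by
    rw [Finset.sum_erase _ (sub_self _), Finset.sum_sub_distrib, smul_sub, Finset.sum_const,
      Finset.card_univ, Fintype.card_fin, ← Nat.cast_smul_eq_nsmul ℝ, smul_smul,
      inv_mul_cancel₀ hpos.ne', one_smul, Finset.smul_sum]
    congr 1
    refine (affineSimplex_coe w stdSimplex.barycenter).trans ?_
    refine Finset.sum_congr rfl fun i _ => congrArg (fun a : ℝ => a • (w i).1) ?_
    exact (stdSimplex.barycenter_apply (𝕜 := ℝ) i).trans (by rw [Fintype.card_fin])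
  rw [e, norm_smul, norm_inv, Real.norm_of_nonneg hpos.le]
  have hs : ‖∑ i ∈ Finset.univ.erase k, ((w i).1 - (w k).1)‖ ≤ m * d := by
    refine (norm_sum_le_of_le _ (f := fun i => (w i).1 - (w k).1) (n := fun _ => d)
      fun i _ => ?_).trans ?_
    · have := h i k
      rwa [Subtype.dist_eq, dist_eq_norm] at this
    · simp [Finset.card_erase_of_mem]
  calc ((m + 1 : ℕ) : ℝ)⁻¹ * ‖∑ i ∈ Finset.univ.erase k, ((w i).1 - (w k).1)‖
      ≤ ((m + 1 : ℕ) : ℝ)⁻¹ * (m * d) := by gcongr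
    _ = (1 - ((m + 1 : ℕ) : ℝ)⁻¹) * d := by
      field_simp
      push_cast
      ring

namespace TupleChain

variable {K : Type v} [Field K]

/-- Two vertices of a subdivided simplex either both come from a subdivided face, where the factor
is smaller by induction, or one of them is the apex, which is within the required distance of the
whole convex hull. -/
theorem subdivision_mem_supported_dist {m n : ℕ} {d : ℝ}
    {c : (Fin m → stdSimplex ℝ (Fin n)) →₀ K}
    (hc : c ∈ Finsupp.supported K K {w | ∀ i j, dist (w i) (w j) ≤ d}) :
    subdivision tupleBarycenter m c ∈
      Finsupp.supported K K {w | ∀ i j, dist (w i) (w j) ≤ (1 - (m : ℝ)⁻¹) * d} := by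
  induction m with
  | zero => exact (Finsupp.supported_mono fun w _ i => i.elim0 : _ ≤ _) hc
  | succ m ih =>
    refine map_mem_of_single_mem (fun w hw => ?_) hc
    have hd : 0 ≤ d := dist_nonneg.trans (hw 0 0)
    rw [subdivision_single]
    have h1 : boundary m (Finsupp.single w (1 : K)) ∈
        Finsupp.supported K K {w | ∀ i j, dist (w i) (w j) ≤ d} :=
      boundary_mem_supported
        (s := fun m => {w : Fin m → stdSimplex ℝ (Fin n) | ∀ i j, dist (w i) (w j) ≤ d})
        (fun m w hw i j k => hw _ _) (Finsupp.single_mem_supported K _ hw)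
    set r := (1 - ((m + 1 : ℕ) : ℝ)⁻¹) * d with hr
    have h2 : boundary m (Finsupp.single w (1 : K)) ∈
        Finsupp.supported K K {w' | ∀ i, w' i ∈ Metric.closedBall (tupleBarycenter m w) r} :=
      boundary_mem_supported
        (s := fun m => {w' : Fin m → stdSimplex ℝ (Fin n) |
          ∀ i, w' i ∈ Metric.closedBall (tupleBarycenter _ w) r})
        (fun m w hw i j => hw _) (Finsupp.single_mem_supported K _
          fun i => dist_tupleBarycenter_le hw i)
    have h3 := subdivision_mem_supported (b := tupleBarycenter)
      (fun m w' hw' => affineSimplex_mem_closedBall hw' _) h2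
    have h4 : subdivision tupleBarycenter m (boundary m (Finsupp.single w (1 : K))) ∈ _ :=
      Submodule.mem_inf.2 ⟨ih h1, h3⟩
    rw [← Finsupp.supported_inter] at h4
    refine map_mem_of_single_mem (f := cone (tupleBarycenter m w) m) (fun w' hw' => ?_) h4
    rw [cone_single]
    have hr0 : 0 ≤ r := by
      refine mul_nonneg (sub_nonneg.2 (inv_le_one_of_one_le₀ ?_)) hd
      exact_mod_cast Nat.le_add_left 1 m
    refine Finsupp.single_mem_supported K _ fun i j => ?_
    refine Fin.cases ?_ (fun i => ?_) i <;> refine Fin.cases ?_ (fun j => ?_) j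
    · simpa using hr0
    · simpa [dist_comm] using hw'.2 j
    · simpa using hw'.2 i
    · simp only [Fin.cons_succ]
      refine (hw'.1 i j).trans ?_
      -- An element of `Fin m` excludes m = 0, where the convention for the inverse of 0 would make
      -- the inductive factor 1 and break the comparison.
      have hm : (0 : ℝ) < m := by exact_mod_cast i.pos
      rw [hr]
      gcongr
      exact_mod_cast Nat.le_succ m

theorem subdivision_pow_mem_supported_dist {m n : ℕ} {d : ℝ}
    {c : (Fin m → stdSimplex ℝ (Fin n)) →₀ K}
    (hc : c ∈ Finsupp.supported K K {w | ∀ i j, dist (w i) (w j) ≤ d}) (N : ℕ) :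
    (subdivision tupleBarycenter m ^ N : Module.End K _) c ∈
      Finsupp.supported K K {w | ∀ i j, dist (w i) (w j) ≤ (1 - (m : ℝ)⁻¹) ^ N * d} := by
  induction N with
  | zero => simpa using hc
  | succ N ih =>
    rw [pow_succ' (subdivision _ _), Module.End.mul_apply, pow_succ', mul_assoc]
    exact subdivision_mem_supported_dist ih

end TupleChain

/-! ### Chains contained in a subset, and small chains up to homology. -/

namespace SingularChain

variable (K : Type v) [Field K] {Y Z : Type*} [TopologicalSpace Y] [TopologicalSpace Z]

/-- The singular chains of `Y` that lie in the subset `A`. -/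
def within (A : Set Y) (m : ℕ) : Submodule K (Chain K Y m) :=
  Finsupp.supported K K {σ | ∀ x, σ x ∈ A}

variable {K}

theorem single_mem_within {A : Set Y} {m : ℕ} {σ : C(stdSimplex ℝ (Fin m), Y)}
    (h : ∀ x, σ x ∈ A) (a : K) : Finsupp.single σ a ∈ within K A m :=
  Finsupp.single_mem_supported K _ h

theorem within_mono {A B : Set Y} (h : A ⊆ B) (m : ℕ) : within K A m ≤ within K B m :=
  Finsupp.supported_mono fun _ hσ x => h (hσ x)

theorem within_inter (A B : Set Y) (m : ℕ) :
    within K (A ∩ B) m = within K A m ⊓ within K B m := by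
  rw [within, within, within, ← Finsupp.supported_inter]
  congr 1
  ext σ
  exact forall_and

theorem boundary_mem_within {A : Set Y} {m : ℕ} {c : Chain K Y (m + 1)}
    (hc : c ∈ within K A (m + 1)) : boundary m c ∈ within K A m := by
  refine TupleChain.map_mem_of_single_mem (fun σ hσ => ?_) hc
  rw [boundary_single]
  exact Submodule.sum_mem _ fun i _ => Submodule.smul_mem _ _
    (single_mem_within (σ := σ.comp (faceMap i)) (fun x => hσ _) 1)

theorem map_mem_within {f : C(Y, Z)} {A : Set Y} {B : Set Z} (h : ∀ y ∈ A, f y ∈ B) {m : ℕ}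
    {c : Chain K Y m} (hc : c ∈ within K A m) : map f m c ∈ within K B m := by
  refine TupleChain.map_mem_of_single_mem (fun σ hσ => ?_) hc
  rw [map_single]
  exact single_mem_within (fun x => h _ (hσ x)) 1

theorem realize_mem_within {V : Type*} {r : ∀ m : ℕ, (Fin m → V) → C(stdSimplex ℝ (Fin m), Y)}
    {A : Set Y} (m : ℕ) (h : ∀ w x, r m w x ∈ A) (c : (Fin m → V) →₀ K) :
    realize r m c ∈ within K A m := by
  refine TupleChain.map_mem_of_single_mem (s := Set.univ) (fun w _ => ?_) (by simp)
  rw [realize_single]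
  exact single_mem_within (h w) 1

theorem subdivision_mem_within {A : Set Y} {m : ℕ} {c : Chain K Y m} (hc : c ∈ within K A m) :
    subdivision m c ∈ within K A m := by
  refine TupleChain.map_mem_of_single_mem (fun σ hσ => ?_) hc
  rw [subdivision_single]
  exact realize_mem_within m (fun _ _ => hσ _) _

theorem subdivision_pow_mem_within {A : Set Y} {m : ℕ} {c : Chain K Y m} (hc : c ∈ within K A m)
    (N : ℕ) : (subdivision m ^ N : Module.End K _) c ∈ within K A m := by
  induction N with
  | zero => simpa using hc
  | succ N ih =>
    rw [pow_succ', Module.End.mul_apply]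
    exact subdivision_mem_within ih

theorem prism_mem_within {H : C(Y × stdSimplex ℝ (Fin 2), Z)} {A : Set Y} {B : Set Z}
    (h : ∀ y ∈ A, ∀ s, H (y, s) ∈ B) {m : ℕ} {c : Chain K Y m} (hc : c ∈ within K A m) :
    prism H m c ∈ within K B (m + 1) := by
  refine TupleChain.map_mem_of_single_mem (fun σ hσ => ?_) hc
  rw [prism_single]
  exact realize_mem_within (m + 1) (fun _ _ => h _ (hσ _) _) _

theorem subdivision_pow_push {n : ℕ} (σ : C(stdSimplex ℝ (Fin n), Y)) (m N : ℕ)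
    (c : (Fin m → stdSimplex ℝ (Fin n)) →₀ K) :
    (subdivision m ^ N : Module.End K _) (push σ m c) =
      push σ m ((TupleChain.subdivision tupleBarycenter m ^ N : Module.End K _) c) := by
  induction N with
  | zero => simp
  | succ N ih =>
    rw [pow_succ', Module.End.mul_apply, ih, subdivision_push, pow_succ', Module.End.mul_apply]

/-- Pull the two open sets back to the simplex and take a Lebesgue number. Mesh sizes of iterated
subdivisions decay geometrically, so eventually each small simplex lies in one of the two preimages.
-/
theorem exists_subdivision_pow_single_mem {W O₁ O₂ : Set Y} (h₁ : IsOpen O₁) (h₂ : IsOpen O₂)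
    (hW : W ⊆ O₁ ∪ O₂) {m : ℕ} (σ : C(stdSimplex ℝ (Fin m), Y)) (hσ : ∀ x, σ x ∈ W) :
    ∃ N : ℕ, (subdivision m ^ N : Module.End K _) (Finsupp.single σ 1) ∈
      within K (W ∩ O₁) m ⊔ within K (W ∩ O₂) m := by
  rcases m with _ | m
  -- The standard simplex on no vertices is empty, so containment is vacuous.
  · exact ⟨0, Submodule.mem_sup_left (single_mem_within (fun x => absurd x.2.2 (by simp)) 1)⟩
  obtain ⟨δ, hδ, hball⟩ := lebesgue_number_lemma_of_metric (s := Set.univ)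
    (c := fun b : Bool => σ ⁻¹' (bif b then O₁ else O₂)) isCompact_univ
    (by rintro (_ | _); exacts [h₂.preimage σ.continuous, h₁.preimage σ.continuous])
    (fun x _ => by
      rcases hW (hσ x) with h | h
      exacts [Set.mem_iUnion.2 ⟨true, h⟩, Set.mem_iUnion.2 ⟨false, h⟩])
  have hlim : Filter.Tendsto (fun N : ℕ => (1 - ((m + 1 : ℕ) : ℝ)⁻¹) ^ N * 1)
      Filter.atTop (nhds 0) := by
    simp only [mul_one]
    refine tendsto_pow_atTop_nhds_zero_of_lt_one (sub_nonneg.2 (inv_le_one_of_one_le₀ ?_)) ?_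
    · exact_mod_cast Nat.le_add_left 1 m
    · exact sub_lt_self _ (by positivity)
  -- Half of the Lebesgue number leaves room to pass from the closed ball around a vertex, which is
  -- convex, to the open ball.
  obtain ⟨N, hN⟩ := (hlim.eventually (gt_mem_nhds (half_pos hδ))).exists
  refine ⟨N, ?_⟩
  rw [← push_vertices, subdivision_pow_push, within, within, ← Finsupp.supported_union]
  have hv : Finsupp.single (vertices (m + 1)) (1 : K) ∈
      Finsupp.supported K K {w | ∀ i j, dist (w i) (w j) ≤ (1 : ℝ)} := by
    refine Finsupp.single_mem_supported K _ fun i j => ?_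
    refine (Metric.dist_le_diam_of_mem (bounded_stdSimplex (Fin (m + 1)))
      (Subtype.prop _) (Subtype.prop _)).trans diam_stdSimplex_le
  refine TupleChain.map_mem_of_single_mem (f := push σ (m + 1)) (fun w hw => ?_)
    (TupleChain.subdivision_pow_mem_supported_dist hv N)
  rw [push, realize_single]
  refine Finsupp.single_mem_supported K _ ?_
  obtain ⟨b, hb⟩ := hball (w 0) trivial
  have hmem (x) : affineSimplex w x ∈ σ ⁻¹' (bif b then O₁ else O₂) := by
    refine hb (Metric.closedBall_subset_ball (half_lt_self hδ) ?_)
    exact affineSimplex_mem_closedBall (fun i => (hw i 0).trans hN.le) x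
  cases b
  · exact Or.inr fun x => ⟨hσ _, hmem x⟩
  · exact Or.inl fun x => ⟨hσ _, hmem x⟩

/-- Different simplices need different numbers of subdivisions, but subdividing further preserves
smallness, so the numbers can be added. -/
theorem exists_subdivision_pow_mem {W O₁ O₂ : Set Y} (h₁ : IsOpen O₁) (h₂ : IsOpen O₂)
    (hW : W ⊆ O₁ ∪ O₂) {m : ℕ} {c : Chain K Y m} (hc : c ∈ within K W m) :
    ∃ N : ℕ, (subdivision m ^ N : Module.End K _) c ∈
      within K (W ∩ O₁) m ⊔ within K (W ∩ O₂) m := by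
  have hstep {N : ℕ} {c : Chain K Y m}
      (h : c ∈ within K (W ∩ O₁) m ⊔ within K (W ∩ O₂) m) :
      (subdivision m ^ N : Module.End K _) c ∈
        within K (W ∩ O₁) m ⊔ within K (W ∩ O₂) m := by
    obtain ⟨u, hu, v, hv, rfl⟩ := Submodule.mem_sup.1 h
    rw [map_add]
    exact Submodule.add_mem_sup (subdivision_pow_mem_within hu N) (subdivision_pow_mem_within hv N)
  rw [within, Finsupp.supported_eq_span_single] at hc
  induction hc using Submodule.span_induction with
  | mem x hx =>
    obtain ⟨σ, hσ, rfl⟩ := hx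
    exact exists_subdivision_pow_single_mem h₁ h₂ hW σ hσ
  | zero => exact ⟨0, by simp⟩
  | add x y _ _ hx hy =>
    obtain ⟨N, hN⟩ := hx
    obtain ⟨M, hM⟩ := hy
    refine ⟨N + M, ?_⟩
    rw [map_add]
    refine add_mem ?_ ?_
    · rw [add_comm, pow_add, Module.End.mul_apply]
      exact hstep hN
    · rw [pow_add, Module.End.mul_apply]
      exact hstep hM
  | smul a x _ hx =>
    obtain ⟨N, hN⟩ := hx
    refine ⟨N, ?_⟩
    rw [map_smul]
    exact Submodule.smul_mem _ _ hN

/-- The cycles of `Y` that lie in `A`. -/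
def cyclesWithin (K : Type v) [Field K] (A : Set Y) : ∀ m : ℕ, Submodule K (Chain K Y m)
  | 0 => within K A 0
  | m + 1 => within K A (m + 1) ⊓ LinearMap.ker (boundary m)

/-- The boundaries of the chains of `Y` that lie in `A`. -/
def boundariesWithin (K : Type v) [Field K] (A : Set Y) (m : ℕ) : Submodule K (Chain K Y m) :=
  (within K A (m + 1)).map (boundary m)

theorem slice_fst (s : stdSimplex ℝ (Fin 2)) :
    slice (⟨Prod.fst, continuous_fst⟩ : C(Y × stdSimplex ℝ (Fin 2), Y)) s =
      ContinuousMap.id Y := rfl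

/-- The prism of the constant homotopy is the bounding chain. -/
theorem sub_subdivision_mem {A : Set Y} {m : ℕ} {z : Chain K Y (m + 1)}
    (hz : z ∈ cyclesWithin K A (m + 1)) :
    z - subdivision (m + 1) z ∈ boundariesWithin K A (m + 1) := by
  obtain ⟨hA, hz⟩ := hz
  refine ⟨prism ⟨Prod.fst, continuous_fst⟩ (m + 1) z,
    prism_mem_within (A := A) (fun y hy s => hy) hA, ?_⟩
  have hz : boundary m z = 0 := hz
  rw [boundary_prism, hz, slice_fst, slice_fst, map_id, map_id, map_zero, sub_zero]

theorem subdivision_mem_cyclesWithin {A : Set Y} {m : ℕ} {z : Chain K Y (m + 1)}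
    (hz : z ∈ cyclesWithin K A (m + 1)) : subdivision (m + 1) z ∈ cyclesWithin K A (m + 1) := by
  obtain ⟨hA, hz⟩ := hz
  have hz : boundary m z = 0 := hz
  refine ⟨subdivision_mem_within hA, ?_⟩
  change boundary m (subdivision (m + 1) z) = 0
  rw [boundary_subdivision, hz, map_zero]

theorem sub_subdivision_pow_mem {A : Set Y} {m : ℕ} {z : Chain K Y (m + 1)}
    (hz : z ∈ cyclesWithin K A (m + 1)) (N : ℕ) :
    z - (subdivision (m + 1) ^ N : Module.End K _) z ∈ boundariesWithin K A (m + 1) := by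
  have h (N : ℕ) : (subdivision (m + 1) ^ N : Module.End K _) z ∈ cyclesWithin K A (m + 1) := by
    induction N with
    | zero => simpa using hz
    | succ N ih =>
      rw [pow_succ', Module.End.mul_apply]
      exact subdivision_mem_cyclesWithin ih
  induction N with
  | zero => simp
  | succ N ih =>
    rw [pow_succ', Module.End.mul_apply]
    have := add_mem ih (sub_subdivision_mem (h N))
    rwa [sub_add_sub_cancel] at this

/-- A cycle in a space covered by two open sets is homologous to a sum of chains in each of them. -/
theorem exists_sub_mem_boundariesWithin {W O₁ O₂ : Set Y} (h₁ : IsOpen O₁) (h₂ : IsOpen O₂)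
    (hW : W ⊆ O₁ ∪ O₂) {m : ℕ} {z : Chain K Y (m + 1)} (hz : z ∈ cyclesWithin K W (m + 1)) :
    ∃ u ∈ within K (W ∩ O₁) (m + 1), ∃ v ∈ within K (W ∩ O₂) (m + 1),
      z - (u + v) ∈ boundariesWithin K W (m + 1) := by
  obtain ⟨N, hN⟩ := exists_subdivision_pow_mem h₁ h₂ hW hz.1
  obtain ⟨u, hu, v, hv, h⟩ := Submodule.mem_sup.1 hN
  exact ⟨u, hu, v, hv, h ▸ sub_subdivision_pow_mem hz N⟩

/-- A cycle that can be deformed is homologous to its image. -/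
theorem sub_map_mem_boundariesWithin {A : Set Y} {B : Set Z}
    {H : C(Y × stdSimplex ℝ (Fin 2), Z)} (hH : ∀ y ∈ A, ∀ s, H (y, s) ∈ B) {m : ℕ}
    {z : Chain K Y (m + 1)} (hz : z ∈ cyclesWithin K A (m + 1)) :
    map (slice H (endpoint 0)) (m + 1) z - map (slice H (endpoint 1)) (m + 1) z ∈
      boundariesWithin K B (m + 1) := by
  obtain ⟨x, hx, hxz⟩ := sub_subdivision_mem hz
  -- The prism compares the end of the homotopy with the subdivision of its beginning; this first
  -- term removes the subdivision.
  have h1 : map (slice H (endpoint 0)) (m + 1) z -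
      map (slice H (endpoint 0)) (m + 1) (subdivision (m + 1) z) ∈
        boundariesWithin K B (m + 1) := by
    refine ⟨map (slice H (endpoint 0)) (m + 2) x,
      map_mem_within (fun y hy => hH y hy _) hx, ?_⟩
    rw [← map_boundary, hxz, map_sub]
  have h2 : map (slice H (endpoint 1)) (m + 1) z -
      map (slice H (endpoint 0)) (m + 1) (subdivision (m + 1) z) ∈
        boundariesWithin K B (m + 1) := by
    refine ⟨prism H (m + 1) z, prism_mem_within hH hz.1, ?_⟩
    have hz' : boundary m z = 0 := hz.2
    rw [boundary_prism, hz', map_zero, sub_zero]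
  have := sub_mem h1 h2
  rwa [sub_sub_sub_cancel_right] at this

end SingularChain

/-! ## Modules over Laurent polynomials -/

section UnitModule

variable {K : Type v} [Field K] {V W : Type*} [AddCommGroup V] [Module K V] [AddCommGroup W]
  [Module K W]

/-- The vector space `V` as a module over `K[t, t⁻¹]`, where `t` acts by the automorphism `u`. -/
@[nolint unusedArguments]
def UnitModule (_ : (Module.End K V)ˣ) : Type _ := V

instance (u : (Module.End K V)ˣ) : AddCommGroup (UnitModule u) := inferInstanceAs (AddCommGroup V)

instance (u : (Module.End K V)ˣ) : Module K (UnitModule u) := inferInstanceAs (Module K V)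

/-- The action of Laurent polynomials by an automorphism. -/
def unitAction (u : (Module.End K V)ˣ) : LaurentPolynomial K →ₐ[K] Module.End K V :=
  AddMonoidAlgebra.lift K (Module.End K V) ℤ ((Units.coeHom _).comp (zpowersHom _ u))

instance (u : (Module.End K V)ˣ) : Module (LaurentPolynomial K) (UnitModule u) :=
  Module.compHom V (unitAction u).toRingHom

theorem unitModule_smul_def (u : (Module.End K V)ˣ) (f : LaurentPolynomial K) (x : UnitModule u) :
    f • x = (unitAction u f (show V from x) : V) := rfl

theorem unitAction_T (u : (Module.End K V)ˣ) (n : ℤ) :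
    unitAction u (LaurentPolynomial.T n) = ((u ^ n : (Module.End K V)ˣ) : Module.End K V) := by
  rw [unitAction, LaurentPolynomial.T, AddMonoidAlgebra.lift_single]
  simp

theorem unitModule_T_smul (u : (Module.End K V)ˣ) (n : ℤ) (x : UnitModule u) :
    (LaurentPolynomial.T n : LaurentPolynomial K) • x =
      (((u ^ n : (Module.End K V)ˣ) : Module.End K V) (show V from x) : V) := by
  rw [unitModule_smul_def, unitAction_T]

instance (u : (Module.End K V)ˣ) : IsScalarTower K (LaurentPolynomial K) (UnitModule u) where
  smul_assoc a f x := by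
    rw [unitModule_smul_def, map_smul]
    rfl

theorem unit_zpow_comm {u : (Module.End K V)ˣ} {w : (Module.End K W)ˣ} {φ : V →ₗ[K] W}
    (h : ∀ x, φ ((u : Module.End K V) x) = (w : Module.End K W) (φ x)) (n : ℤ) (x : V) :
    φ (((u ^ n : (Module.End K V)ˣ) : Module.End K V) x) =
      ((w ^ n : (Module.End K W)ˣ) : Module.End K W) (φ x) := by
  have hinv (x : V) : φ (((u⁻¹ : (Module.End K V)ˣ) : Module.End K V) x) =
      ((w⁻¹ : (Module.End K W)ˣ) : Module.End K W) (φ x) := by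
    have h1 := h (((u⁻¹ : (Module.End K V)ˣ) : Module.End K V) x)
    rw [← Module.End.mul_apply, Units.mul_inv, Module.End.one_apply] at h1
    rw [h1, ← Module.End.mul_apply, Units.inv_mul, Module.End.one_apply]
  induction n with
  | zero => simp
  | succ n ih =>
    rw [add_comm, zpow_one_add, zpow_one_add,
      Units.val_mul, Units.val_mul, Module.End.mul_apply, Module.End.mul_apply, h, ih]
  | pred n ih =>
    rw [sub_eq_neg_add, zpow_add, zpow_add, zpow_neg_one, zpow_neg_one,
      Units.val_mul, Units.val_mul, Module.End.mul_apply, Module.End.mul_apply, hinv, ih]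

theorem unitAction_comm {u : (Module.End K V)ˣ} {w : (Module.End K W)ˣ} {φ : V →ₗ[K] W}
    (h : ∀ x, φ ((u : Module.End K V) x) = (w : Module.End K W) (φ x))
    (f : LaurentPolynomial K) (x : V) : φ (unitAction u f x) = unitAction w f (φ x) := by
  induction f using LaurentPolynomial.induction_on' with
  | add f g hf hg => simp only [map_add, LinearMap.add_apply, hf, hg]
  | C_mul_T n a =>
    simp only [← LaurentPolynomial.smul_eq_C_mul, map_smul, unitAction_T, LinearMap.smul_apply,
      unit_zpow_comm h n x]

theorem unitAction_mem {u : (Module.End K V)ˣ} {P : Submodule K V}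
    (h : ∀ x ∈ P, (u : Module.End K V) x ∈ P)
    (h' : ∀ x ∈ P, ((u⁻¹ : (Module.End K V)ˣ) : Module.End K V) x ∈ P)
    (f : LaurentPolynomial K) {x : V} (hx : x ∈ P) : unitAction u f x ∈ P := by
  have hn (n : ℤ) : ((u ^ n : (Module.End K V)ˣ) : Module.End K V) x ∈ P := by
    induction n with
    | zero => simpa using hx
    | succ n ih =>
      rw [add_comm, zpow_one_add, Units.val_mul, Module.End.mul_apply]
      exact h _ ih
    | pred n ih =>
      rw [sub_eq_neg_add, zpow_add, zpow_neg_one, Units.val_mul, Module.End.mul_apply]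
      exact h' _ ih
  induction f using LaurentPolynomial.induction_on' with
  | add f g hf hg =>
    rw [map_add, LinearMap.add_apply]
    exact P.add_mem hf hg
  | C_mul_T n a =>
    rw [← LaurentPolynomial.smul_eq_C_mul, map_smul, unitAction_T, LinearMap.smul_apply]
    exact P.smul_mem a (hn n)

/-- A linear map that commutes with the automorphisms is linear over `K[t, t⁻¹]`. -/
def UnitModule.map {u : (Module.End K V)ˣ} {w : (Module.End K W)ˣ} (φ : V →ₗ[K] W)
    (h : ∀ x, φ ((u : Module.End K V) x) = (w : Module.End K W) (φ x)) :
    UnitModule u →ₗ[LaurentPolynomial K] UnitModule w where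
  toFun := φ
  map_add' := φ.map_add
  map_smul' f x := unitAction_comm h f x

/-- A subspace that is stable under an automorphism and its inverse is a submodule
over `K[t, t⁻¹]`. -/
def UnitModule.submodule (u : (Module.End K V)ˣ) (P : Submodule K V)
    (h : ∀ x ∈ P, (u : Module.End K V) x ∈ P)
    (h' : ∀ x ∈ P, ((u⁻¹ : (Module.End K V)ˣ) : Module.End K V) x ∈ P) :
    Submodule (LaurentPolynomial K) (UnitModule u) where
  carrier := (P : Set V)
  add_mem' := P.add_mem
  zero_mem' := P.zero_mem
  smul_mem' f _ hx := unitAction_mem h h' f hx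

end UnitModule

instance LaurentPolynomial.instIsNoetherianRing (K : Type v) [Field K] :
    IsNoetherianRing (LaurentPolynomial K) :=
  IsLocalization.isNoetherianRing (Submonoid.powers (Polynomial.X : Polynomial K)) _ inferInstance

/-! ## Finite generation modulo a submodule -/

section FGModulo

variable {R : Type*} [CommRing R] {M N : Type*} [AddCommGroup M] [Module R M]
  [AddCommGroup N] [Module R N]

/-- The submodule `Z` is finitely generated modulo the submodule `B`. -/
def FGModulo (Z B : Submodule R M) : Prop := ∃ G : Submodule R M, G.FG ∧ Z ≤ G ⊔ B

/-- The image of `D` is finitely generated by Noetherianity. Lift its generators to `D`; an element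
of `D` then differs from a combination of the lifts by an element of the kernel. -/
theorem exists_fg_le_sup_ker [IsNoetherianRing R] {D : Submodule R M} {φ : M →ₗ[R] N}
    {G : Submodule R N} (hG : G.FG) (h : D.map φ ≤ G) :
    ∃ F : Submodule R M, F.FG ∧ F ≤ D ∧ D ≤ F ⊔ (D ⊓ LinearMap.ker φ) := by
  obtain ⟨S, hS⟩ := hG.of_le h
  have hsub : (S : Set N) ⊆ φ '' D := by
    have : Submodule.span R (S : Set N) ≤ D.map φ := hS.le
    exact Submodule.span_le.1 this
  classical
  obtain ⟨S', hS', rfl⟩ := Finset.subset_set_image_iff.1 hsub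
  refine ⟨Submodule.span R S', ⟨S', rfl⟩, Submodule.span_le.2 hS', fun x hx => ?_⟩
  have hφ : φ x ∈ (Submodule.span R (S' : Set M)).map φ := by
    rw [Submodule.map_span, ← Finset.coe_image, hS]
    exact Submodule.mem_map_of_mem hx
  obtain ⟨y, hy, hyx⟩ := hφ
  refine Submodule.mem_sup.2 ⟨y, hy, x - y, ⟨D.sub_mem hx (Submodule.span_le.2 hS' hy), ?_⟩, by abel⟩
  simp [hyx]

/-- The algebraic content of the Mayer-Vietoris sequence. -/
theorem FGModulo.mayerVietoris [IsNoetherianRing R] (d : M →ₗ[R] N)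
    {ZW BW U V ZU BU ZV BV : Submodule R M} {Z' B' : Submodule R N} (hBU : BU ≤ BW)
    (hBV : BV ≤ BW) (hU : FGModulo ZU BU) (hV : FGModulo ZV BV) (hUV : FGModulo Z' B')
    (hsplit : ∀ z ∈ ZW, ∃ u ∈ U, ∃ v ∈ V, z - (u + v) ∈ BW)
    (hBZ : BW ≤ ZW)
    (hd : ∀ u ∈ U, ∀ v ∈ V, u + v ∈ ZW → d u ∈ Z')
    (hker : ∀ u ∈ U, ∀ v ∈ V, u + v ∈ ZW → d u ∈ B' → u + v ∈ ZU ⊔ ZV) : FGModulo ZW BW := by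
  obtain ⟨GU, hGU, hZU⟩ := hU
  obtain ⟨GV, hGV, hZV⟩ := hV
  obtain ⟨G', hG', hZ'⟩ := hUV
  let s : M × M →ₗ[R] M := LinearMap.fst R M M + LinearMap.snd R M M
  let D : Submodule R (M × M) := U.prod V ⊓ ZW.comap s
  -- This is the connecting homomorphism: a decomposition `u + v` of a cycle is sent to the class of
  -- `d u`.
  let φ : M × M →ₗ[R] N ⧸ B' := B'.mkQ ∘ₗ d ∘ₗ LinearMap.fst R M M
  have hD : D.map φ ≤ G'.map B'.mkQ := by
    rintro _ ⟨⟨a, b⟩, ⟨⟨ha, hb⟩, hab⟩, rfl⟩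
    obtain ⟨g, hg, c, hc, hgc⟩ := Submodule.mem_sup.1 (hZ' (hd a ha b hb hab))
    refine ⟨g, hg, ?_⟩
    change B'.mkQ g = B'.mkQ (d a)
    rw [← hgc, map_add, (B'.mkQ_apply c).trans ((Submodule.Quotient.mk_eq_zero B').2 hc), add_zero]
  obtain ⟨F, hF, hFD, hDF⟩ := exists_fg_le_sup_ker (hG'.map _) hD
  -- Generators are those of the two pieces, together with lifts of generators of the image of the
  -- connecting homomorphism.
  refine ⟨GU ⊔ GV ⊔ F.map s, (hGU.sup hGV).sup (hF.map s), fun z hz => ?_⟩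
  obtain ⟨a, ha, b, hb, hab⟩ := hsplit z hz
  have habZ : a + b ∈ ZW := by
    have := ZW.sub_mem hz (hBZ hab)
    rwa [sub_sub_cancel] at this
  have hmem : ((a, b) : M × M) ∈ D := ⟨⟨ha, hb⟩, habZ⟩
  obtain ⟨f, hf, k, ⟨⟨⟨hk1, hk2⟩, hk⟩, hkφ⟩, hfk⟩ := Submodule.mem_sup.1 (hDF hmem)
  have hkB : d k.1 ∈ B' := (Submodule.Quotient.mk_eq_zero B').1 hkφ
  have hks := hker k.1 hk1 k.2 hk2 hk hkB
  have hle : ZU ⊔ ZV ≤ GU ⊔ GV ⊔ F.map s ⊔ BW := by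
    refine sup_le (hZU.trans (sup_le ?_ (hBU.trans le_sup_right)))
      (hZV.trans (sup_le ?_ (hBV.trans le_sup_right)))
    · exact le_sup_left.trans (le_sup_left.trans le_sup_left)
    · exact le_sup_right.trans (le_sup_left.trans le_sup_left)
  have hz' : z = s f + (k.1 + k.2) + (z - (a + b)) := by
    have h1 : f.1 + k.1 = a := congrArg Prod.fst hfk
    have h2 : f.2 + k.2 = b := congrArg Prod.snd hfk
    change z = f.1 + f.2 + (k.1 + k.2) + (z - (a + b))
    rw [← h1, ← h2]
    abel
  rw [hz']
  refine add_mem (add_mem ?_ (hle hks)) (Submodule.mem_sup_right hab)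
  exact Submodule.mem_sup_left (Submodule.mem_sup_right (Submodule.mem_map_of_mem hf))

end FGModulo

/-! ## Homology of the part of a covering over a subset of the base -/

namespace SingularChain

variable (K : Type v) [Field K] {E X : Type*} [TopologicalSpace E] [TopologicalSpace X]

/-- The automorphism of the singular chains induced by a homeomorphism. -/
def chainUnit (T : E ≃ₜ E) (m : ℕ) : (Module.End K (Chain K E m))ˣ where
  val := map (T : C(E, E)) m
  inv := map (T.symm : C(E, E)) m
  val_inv := by
    have h : (T : C(E, E)).comp (T.symm : C(E, E)) = ContinuousMap.id E :=
      ContinuousMap.ext T.apply_symm_apply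
    refine LinearMap.ext fun c => ?_
    rw [Module.End.mul_apply, map_map, h, map_id, Module.End.one_apply]
  inv_val := by
    have h : (T.symm : C(E, E)).comp (T : C(E, E)) = ContinuousMap.id E :=
      ContinuousMap.ext T.symm_apply_apply
    refine LinearMap.ext fun c => ?_
    rw [Module.End.mul_apply, map_map, h, map_id, Module.End.one_apply]

theorem chainUnit_zpow (T : E ≃ₜ E) (m : ℕ) (k : ℤ) :
    chainUnit K T m ^ k = chainUnit K (T ^ k) m := by
  let φ : (E ≃ₜ E) →* (Module.End K (Chain K E m))ˣ :=
    MonoidHom.mk' (fun T => chainUnit K T m) fun S T => Units.ext (LinearMap.ext fun c =>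
      (map_map (K := K) (T : C(E, E)) (S : C(E, E)) m c).symm)
  exact (map_zpow φ T k).symm

/-- The singular chains as a module over `K[t, t⁻¹]`. -/
abbrev TwistedChain (T : E ≃ₜ E) (m : ℕ) : Type _ := UnitModule (chainUnit K T m)

/-- The boundary as a linear map over `K[t, t⁻¹]`. -/
def twistedBoundary (T : E ≃ₜ E) (m : ℕ) :
    TwistedChain K T (m + 1) →ₗ[LaurentPolynomial K] TwistedChain K T m :=
  UnitModule.map (boundary m) fun c => (map_boundary _ m c).symm

variable {K}

theorem map_mem_cyclesWithin {Y : Type*} [TopologicalSpace Y] {f : C(Y, E)} {A : Set Y}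
    {B : Set E} (h : ∀ y ∈ A, f y ∈ B) {m : ℕ}
    {c : Chain K Y m} (hc : c ∈ cyclesWithin K A m) : map f m c ∈ cyclesWithin K B m := by
  cases m with
  | zero => exact map_mem_within h hc
  | succ m =>
    obtain ⟨hA, hc⟩ := hc
    have hc : boundary m c = 0 := hc
    refine ⟨map_mem_within h hA, ?_⟩
    change boundary m (map f (m + 1) c) = 0
    rw [← map_boundary, hc, map_zero]

theorem map_mem_boundariesWithin {Y : Type*} [TopologicalSpace Y] {f : C(Y, E)} {A : Set Y}
    {B : Set E} (h : ∀ y ∈ A, f y ∈ B) {m : ℕ} {c : Chain K Y m}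
    (hc : c ∈ boundariesWithin K A m) : map f m c ∈ boundariesWithin K B m := by
  obtain ⟨x, hx, rfl⟩ := hc
  exact ⟨map f (m + 1) x, map_mem_within h hx, (map_boundary f m x).symm⟩

theorem boundariesWithin_le_cyclesWithin (A : Set E) (m : ℕ) :
    boundariesWithin K A m ≤ cyclesWithin K A m := by
  rintro _ ⟨x, hx, rfl⟩
  cases m with
  | zero => exact boundary_mem_within hx
  | succ m => exact ⟨boundary_mem_within hx, boundary_boundary m x⟩

theorem boundariesWithin_mono {A B : Set E} (h : A ⊆ B) (m : ℕ) :
    boundariesWithin K A m ≤ boundariesWithin K B m :=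
  Submodule.map_mono (within_mono h _)

theorem symm_deck {X : Type*} {p : E → X} {T : E ≃ₜ E} (hT : ∀ e, p (T e) = p e) (e : E) : p (T.symm e) = p e := by
  rw [← hT (T.symm e), T.apply_symm_apply]

variable {p : E → X} {T : E ≃ₜ E}

variable (K) (hT : ∀ e, p (T e) = p e) (B : Set X) (m : ℕ)

/-- The chains over `B`, as a module over `K[t, t⁻¹]`. -/
def twistedWithin : Submodule (LaurentPolynomial K) (TwistedChain K T m) :=
  UnitModule.submodule _ (within K (p ⁻¹' B) m)
    (fun _ hx => map_mem_within (fun e (he : p e ∈ B) => show p (T e) ∈ B by rwa [hT]) hx)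
    (fun _ hx => map_mem_within
      (fun e (he : p e ∈ B) => show p (T.symm e) ∈ B by rwa [symm_deck hT]) hx)

/-- The cycles over `B`, as a module over `K[t, t⁻¹]`. -/
def twistedCycles : Submodule (LaurentPolynomial K) (TwistedChain K T m) :=
  UnitModule.submodule _ (cyclesWithin K (p ⁻¹' B) m)
    (fun _ hx => map_mem_cyclesWithin (fun e (he : p e ∈ B) => show p (T e) ∈ B by rwa [hT]) hx)
    (fun _ hx => map_mem_cyclesWithin
      (fun e (he : p e ∈ B) => show p (T.symm e) ∈ B by rwa [symm_deck hT]) hx)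

/-- The boundaries of the chains over `B`, as a module over `K[t, t⁻¹]`. -/
def twistedBoundaries : Submodule (LaurentPolynomial K) (TwistedChain K T m) :=
  UnitModule.submodule _ (boundariesWithin K (p ⁻¹' B) m)
    (fun _ hx => map_mem_boundariesWithin
      (fun e (he : p e ∈ B) => show p (T e) ∈ B by rwa [hT]) hx)
    (fun _ hx => map_mem_boundariesWithin
      (fun e (he : p e ∈ B) => show p (T.symm e) ∈ B by rwa [symm_deck hT]) hx)

theorem twistedBoundaries_le_twistedCycles : twistedBoundaries K hT B m ≤ twistedCycles K hT B m :=
  boundariesWithin_le_cyclesWithin (K := K) (p ⁻¹' B) m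

theorem twistedBoundaries_mono {B B' : Set X} (h : B ⊆ B') :
    twistedBoundaries K hT B m ≤ twistedBoundaries K hT B' m :=
  boundariesWithin_mono (K := K) (Set.preimage_mono h) m

/-- The (reduced) homology of the part of the covering over `B` is finitely generated
over `K[t, t⁻¹]` in all degrees. -/
def CoverFG : Prop :=
  ∀ m, FGModulo (twistedCycles K hT B (m + 1)) (twistedBoundaries K hT B (m + 1))

/-- There is exactly one map from the empty simplex, so the chains at index 0 form a line over `K`.
This handles the augmentation in the Mayer-Vietoris step. -/
theorem fgModulo_twisted_zero (Z B : Submodule (LaurentPolynomial K) (TwistedChain K T 0)) :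
    FGModulo Z B := by
  let σ : C(stdSimplex ℝ (Fin 0), E) := ⟨fun x => absurd x.2.2 (by simp), by
    refine continuous_iff_continuousAt.2 fun x => absurd x.2.2 (by simp)⟩
  have hσ (τ : C(stdSimplex ℝ (Fin 0), E)) : τ = σ :=
    ContinuousMap.ext fun x => absurd x.2.2 (by simp)
  let g : TwistedChain K T 0 := (Finsupp.single σ (1 : K) : Chain K E 0)
  refine ⟨Submodule.span _ {g}, Submodule.fg_span_singleton g, fun z _ => ?_⟩
  refine Submodule.mem_sup_left ?_
  have hz (c : Chain K E 0) : ∃ a : K, c = a • (Finsupp.single σ (1 : K) : Chain K E 0) := by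
    refine ⟨c σ, ?_⟩
    ext τ
    simp [hσ τ]
  obtain ⟨a, ha⟩ := hz z
  have : z = a • g := ha
  rw [this]
  exact Submodule.smul_of_tower_mem _ a (Submodule.mem_span_singleton_self g)

variable {K hT B}

/-- Subdivision splits a cycle over `B` as `u + v`. Then `∂u = -∂v` lies over both open sets, and
this is the connecting class. If it bounds a chain `w` over the intersection, then `u - w` and `v +
w` are cycles over the two pieces. -/
theorem CoverFG.union (hp : Continuous p) {O₁ O₂ : Set X} (h₁ : IsOpen O₁)
    (h₂ : IsOpen O₂) (hB : B ⊆ O₁ ∪ O₂) (hB₁ : CoverFG K hT (B ∩ O₁)) (hB₂ : CoverFG K hT (B ∩ O₂))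
    (hB₁₂ : CoverFG K hT (B ∩ (O₁ ∩ O₂))) : CoverFG K hT B := by
  intro m
  have hB' : FGModulo (twistedCycles K hT (B ∩ (O₁ ∩ O₂)) m)
      (twistedBoundaries K hT (B ∩ (O₁ ∩ O₂)) m) := by
    cases m with
    | zero => exact fgModulo_twisted_zero K _ _
    | succ m => exact hB₁₂ m
  have hinter : within K (p ⁻¹' (B ∩ (O₁ ∩ O₂))) m =
      within K (p ⁻¹' (B ∩ O₁)) m ⊓ within K (p ⁻¹' (B ∩ O₂)) m := by
    rw [← within_inter, ← Set.preimage_inter, Set.inter_inter_distrib_left]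
  have hd (u v : Chain K E (m + 1)) (huv : boundary m (u + v) = 0) :
      boundary m u = -boundary m v := by
    rw [map_add] at huv
    exact eq_neg_of_add_eq_zero_left huv
  refine FGModulo.mayerVietoris (twistedBoundary K T m)
    (U := twistedWithin K hT (B ∩ O₁) (m + 1)) (V := twistedWithin K hT (B ∩ O₂) (m + 1))
    (twistedBoundaries_mono K hT _ Set.inter_subset_left)
    (twistedBoundaries_mono K hT _ Set.inter_subset_left) (hB₁ m) (hB₂ m) hB'
    (fun z hz => ?_) (twistedBoundaries_le_twistedCycles K hT B _) ?_ ?_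
  · exact exists_sub_mem_boundariesWithin (h₁.preimage hp) (h₂.preimage hp)
      (W := p ⁻¹' B) (fun e he => hB he) hz
  · intro (u : Chain K E (m + 1)) hu (v : Chain K E (m + 1)) hv huv
    have hu : u ∈ within K (p ⁻¹' (B ∩ O₁)) (m + 1) := hu
    have hv : v ∈ within K (p ⁻¹' (B ∩ O₂)) (m + 1) := hv
    have huv : u + v ∈ cyclesWithin K (p ⁻¹' B) (m + 1) := huv
    change boundary m u ∈ cyclesWithin K (p ⁻¹' (B ∩ (O₁ ∩ O₂))) m
    have hmem : boundary m u ∈ within K (p ⁻¹' (B ∩ (O₁ ∩ O₂))) m := by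
      rw [hinter]
      refine ⟨boundary_mem_within hu, ?_⟩
      rw [hd u v huv.2]
      exact neg_mem (boundary_mem_within hv)
    cases m with
    | zero => exact hmem
    | succ m => exact ⟨hmem, boundary_boundary m u⟩
  · intro (u : Chain K E (m + 1)) hu (v : Chain K E (m + 1)) hv huv hdu
    have hu : u ∈ within K (p ⁻¹' (B ∩ O₁)) (m + 1) := hu
    have hv : v ∈ within K (p ⁻¹' (B ∩ O₂)) (m + 1) := hv
    have huv : u + v ∈ cyclesWithin K (p ⁻¹' B) (m + 1) := huv
    obtain ⟨w, hw, hwu⟩ : boundary m u ∈ boundariesWithin K (p ⁻¹' (B ∩ (O₁ ∩ O₂))) m := hdu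
    have hw₁ : w ∈ within K (p ⁻¹' (B ∩ O₁)) (m + 1) :=
      within_mono (Set.preimage_mono (Set.inter_subset_inter_right _ Set.inter_subset_left)) _ hw
    have hw₂ : w ∈ within K (p ⁻¹' (B ∩ O₂)) (m + 1) :=
      within_mono (Set.preimage_mono (Set.inter_subset_inter_right _ Set.inter_subset_right)) _ hw
    have e1 : u - w ∈ cyclesWithin K (p ⁻¹' (B ∩ O₁)) (m + 1) := by
      refine ⟨sub_mem hu hw₁, ?_⟩
      change boundary m (u - w) = 0
      rw [map_sub, hwu, sub_self]
    have e2 : v + w ∈ cyclesWithin K (p ⁻¹' (B ∩ O₂)) (m + 1) := by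
      refine ⟨add_mem hv hw₂, ?_⟩
      change boundary m (v + w) = 0
      rw [map_add, hwu, hd u v huv.2, add_neg_cancel]
    refine Submodule.mem_sup.2 ⟨u - w, e1, v + w, e2, ?_⟩
    change u - w + (v + w) = u + v
    abel

theorem CoverFG.empty : CoverFG K hT ∅ := by
  refine fun m => ⟨⊥, Submodule.fg_bot, fun z hz => ?_⟩
  have hz' : z ∈ cyclesWithin K (p ⁻¹' ∅) (m + 1) := hz
  have h : within K (p ⁻¹' (∅ : Set X)) (m + 1) = ⊥ := by
    rw [within, eq_bot_iff, Finsupp.supported_eq_span_single, Submodule.span_le]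
    rintro _ ⟨σ, hσ, rfl⟩
    exact (hσ (stdSimplex.vertex 0)).elim
  have hz0 : z ∈ (⊥ : Submodule K (Chain K E (m + 1))) := h ▸ hz'.1
  have : z = 0 := hz0
  rw [this]
  exact zero_mem _

/-- A simplex over a point is constant, because it is connected and the fibre is discrete. As T is
transitive on the fibre, a single constant simplex already generates all the chains over Λ. -/
theorem CoverFG.singleton (hp : IsCoveringMap p)
    (htrans : ∀ e e', p e = p e' → ∃ k : ℤ, e' = (T ^ k) e) (x : X) : CoverFG K hT {x} := by
  by_cases hx : ∃ e, p e = x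
  -- Surjectivity of `p` is not assumed, so an empty fibre is treated as the empty set.
  swap
  · have h : p ⁻¹' {x} = p ⁻¹' ∅ := by
      ext e
      exact ⟨fun he => hx ⟨e, he⟩, fun he => he.elim⟩
    have he := CoverFG.empty (K := K) (hT := hT)
    intro m
    obtain ⟨G, hG, hle⟩ := he m
    refine ⟨G, hG, fun z hz => ?_⟩
    have hz' : z ∈ cyclesWithin K (p ⁻¹' {x}) (m + 1) := hz
    rw [h] at hz'
    exact sup_le_sup_left (twistedBoundaries_mono K hT _ (Set.empty_subset _)) _ (hle hz')
  obtain ⟨e, rfl⟩ := hx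
  intro m
  let g : TwistedChain K T (m + 1) :=
    (Finsupp.single (ContinuousMap.const _ e) (1 : K) : Chain K E (m + 1))
  refine ⟨Submodule.span _ {g}, Submodule.fg_span_singleton g, fun z hz => ?_⟩
  refine Submodule.mem_sup_left ?_
  have hz : z ∈ within K (p ⁻¹' {p e}) (m + 1) := And.left hz
  have hsingle (σ : C(stdSimplex ℝ (Fin (m + 1)), E)) (hσ : ∀ x, σ x ∈ p ⁻¹' {p e}) :
      ((Finsupp.single σ (1 : K) : Chain K E (m + 1)) : TwistedChain K T (m + 1)) ∈
        Submodule.span (LaurentPolynomial K) {g} := by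
    obtain ⟨k, hk⟩ := htrans e (σ (stdSimplex.vertex 0)) (hσ _).symm
    have hconst : σ = ((T ^ k : E ≃ₜ E) : C(E, E)).comp (ContinuousMap.const _ e) := by
      ext y
      refine (hp.const_of_comp σ.continuous (fun a b => ?_) y (stdSimplex.vertex 0)).trans hk
      exact Eq.trans (hσ a) (hσ b).symm
    have h := Submodule.smul_mem _ (LaurentPolynomial.T k : LaurentPolynomial K)
      (Submodule.mem_span_singleton_self (R := LaurentPolynomial K) g)
    rw [unitModule_T_smul, chainUnit_zpow] at h
    have e1 : ((chainUnit K (T ^ k) (m + 1) : (Module.End K (Chain K E (m + 1)))ˣ) :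
        Module.End K (Chain K E (m + 1))) (Finsupp.single (ContinuousMap.const _ e) (1 : K)) =
        Finsupp.single σ (1 : K) := (map_single _ _ _ _).trans (by rw [← hconst])
    exact e1 ▸ h
  rw [within, Finsupp.supported_eq_span_single] at hz
  have hle : Submodule.span K ((fun i => Finsupp.single i (1 : K)) ''
      {σ : C(stdSimplex ℝ (Fin (m + 1)), E) | ∀ x, σ x ∈ p ⁻¹' {p e}}) ≤
      (show Submodule K (Chain K E (m + 1)) from
        (Submodule.span (LaurentPolynomial K) {g}).restrictScalars K) := by
    rw [Submodule.span_le]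
    rintro _ ⟨σ, hσ, rfl⟩
    exact hsingle σ hσ
  exact hle hz

/-- Finite generation of the homology of the covering passes along deformations in the base. -/
theorem CoverFG.of_deformation (hp : IsCoveringMap p) {B' : Set X} (hBB : B' ⊆ B)
    (h : C(unitInterval × B, X)) (h0 : ∀ b : B, h (0, b) = b) (hB : ∀ t b, h (t, b) ∈ B)
    (h1 : ∀ b, h (1, b) ∈ B') (hfg : CoverFG K hT B') : CoverFG K hT B := by
  let A : Type _ := p ⁻¹' B
  let incl : C(A, E) := ⟨Subtype.val, continuous_subtype_val⟩
  let pA : C(A, B) := ⟨fun a => ⟨p a.1, a.2⟩, (hp.continuous.comp continuous_subtype_val).subtype_mk _⟩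
  let H : C(unitInterval × A, X) := h.comp ((ContinuousMap.id _).prodMap pA)
  have H0 (a : A) : H (0, a) = p (incl a) := h0 (pA a)
  -- The deformation of `B` is lifted to a homotopy of p⁻¹(B) starting at the inclusion. The lift
  -- need not commute with T: it only serves to make each cycle over `B` homologous to one over
  -- `B'`, and the generators for `B'` then work unchanged.
  let G : C(unitInterval × A, E) := hp.liftHomotopy H incl H0
  have hG (t : unitInterval) (a : A) : p (G (t, a)) = h (t, pA a) :=
    congrFun (hp.liftHomotopy_lifts H incl H0) (t, a)
  let G' : C(A × stdSimplex ℝ (Fin 2), E) :=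
    ⟨fun x => G (stdSimplexHomeomorphUnitInterval x.2, x.1), by fun_prop⟩
  have hslice0 : slice G' (endpoint 0) = incl :=
    ContinuousMap.ext fun a => hp.liftHomotopy_zero H incl H0 a
  intro m
  obtain ⟨F, hF, hle⟩ := hfg m
  refine ⟨F, hF, fun (z : Chain K E (m + 1)) hz => ?_⟩
  have hz : z ∈ cyclesWithin K (p ⁻¹' B) (m + 1) := hz
  -- The cycle is regarded as a chain of the space p⁻¹(B), on which the lifted homotopy lives. It
  -- remains a cycle because the inclusion is injective on chains.
  obtain ⟨z', hz', rfl⟩ : ∃ z' ∈ cyclesWithin K (Set.univ : Set A) (m + 1),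
      map incl (m + 1) z' = z := by
    have hinj (n : ℕ) : Function.Injective (map (K := K) incl n) :=
      Finsupp.mapDomain_injective fun σ τ hστ => ContinuousMap.ext fun x =>
        Subtype.ext (DFunLike.congr_fun hστ x)
    obtain ⟨z', hz'⟩ : z ∈ LinearMap.range (map (K := K) incl (m + 1)) := by
      refine TupleChain.map_mem_of_single_mem (f := LinearMap.id) (fun σ hσ => ?_) hz.1
      refine ⟨Finsupp.single ⟨fun x => ⟨σ x, hσ x⟩, σ.continuous.subtype_mk _⟩ 1, ?_⟩
      rw [map_single]
      rfl
    refine ⟨z', ⟨by simp [within], ?_⟩, hz'⟩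
    have hb : boundary m z = 0 := hz.2
    refine hinj m ?_
    rw [map_boundary, hz', hb, map_zero]
  have h2 := sub_map_mem_boundariesWithin (H := G') (B := p ⁻¹' B)
    (fun a _ s => by
      change p (G (_, a)) ∈ B
      rw [hG]
      exact hB _ _) hz'
  rw [hslice0] at h2
  have h3 : map (slice G' (endpoint 1)) (m + 1) z' ∈ cyclesWithin K (p ⁻¹' B') (m + 1) := by
    refine map_mem_cyclesWithin (fun a _ => ?_) hz'
    change p (G (1, a)) ∈ B'
    rw [hG]
    exact h1 _
  have h4 := sup_le_sup_left (twistedBoundaries_mono K hT (m + 1) hBB) F (hle h3)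
  have h5 : (show TwistedChain K T (m + 1) from
      map incl (m + 1) z' - map (slice G' (endpoint 1)) (m + 1) z') ∈
      F ⊔ twistedBoundaries K hT B (m + 1) := Submodule.mem_sup_right h2
  have h6 := add_mem h5 h4
  have e : map incl (m + 1) z' - map (slice G' (endpoint 1)) (m + 1) z' +
    map (slice G' (endpoint 1)) (m + 1) z' = map incl (m + 1) z' := sub_add_cancel _ _
  exact e ▸ h6

end SingularChain

/-! ## Comparison with the singular chain complex -/

namespace SingularChain

open Simplicial

variable (K : Type v) [Field K] (Y : Type u) [TopologicalSpace Y]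

/-- The singular chain complex of a space, with coefficients in a field. -/
abbrev complex : ChainComplex (ModuleCat.{max u v} K) ℕ :=
  (TopCat.toSSet.obj (TopCat.of Y)).chainComplex (ModuleCat.of K (ULift.{u} K))

variable {K Y}

/-- The chain map of singular complexes induced by a continuous map. -/
abbrev complexMap {Z : Type u} [TopologicalSpace Z] (f : C(Y, Z)) :
    complex K Y ⟶ complex K Z :=
  SSet.chainComplexMap (TopCat.toSSet.map (TopCat.ofHom f)) (ModuleCat.of K (ULift.{u} K))

/-- A simplicial simplex of the singular set, from a continuous map. -/
def toSimplex {n : ℕ} (σ : C(stdSimplex ℝ (Fin (n + 1)), Y)) :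
    (TopCat.toSSet.obj (TopCat.of Y)) _⦋n⦌ :=
  (TopCat.toSSetObjEquiv (TopCat.of Y) (Opposite.op ⦋n⦌)).symm σ

theorem toSimplex_face {n : ℕ} (σ : C(stdSimplex ℝ (Fin (n + 2)), Y)) (i : Fin (n + 2)) :
    (TopCat.toSSet.obj (TopCat.of Y)).δ i (toSimplex σ) = toSimplex (σ.comp (faceMap i)) := rfl

/-- The inclusion of the summand of a simplex in the singular chains. -/
abbrev ιComplex {n : ℕ} (x : (TopCat.toSSet.obj (TopCat.of Y)) _⦋n⦌) :
    ModuleCat.of K (ULift.{u} K) ⟶ (complex K Y).X n :=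
  SSet.ιChainComplex _ x

/-- The comparison from concrete chains to the singular chain complex. -/
def toComplex (n : ℕ) : Chain K Y (n + 1) →ₗ[K] (complex K Y).X n :=
  Finsupp.lsum K fun σ =>
    (ιComplex (K := K) (toSimplex σ)).hom ∘ₗ
      (ULift.moduleEquiv (R := K) (M := K)).symm.toLinearMap

theorem toComplex_single (n : ℕ) (σ : C(stdSimplex ℝ (Fin (n + 1)), Y)) (a : K) :
    toComplex n (Finsupp.single σ a) =
      (ιComplex (K := K) (toSimplex σ)).hom (ULift.up a) := by
  rw [toComplex, Finsupp.lsum_single]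
  rfl

/-- The chain objects of the singular complex are coproducts over the simplices. Their universal
property gives the inverse, which reads off the coefficients. -/
theorem toComplex_bijective (n : ℕ) : Function.Bijective (toComplex (K := K) (Y := Y) n) := by
  let f : (complex K Y).X n ⟶ ModuleCat.of K (Chain K Y (n + 1)) :=
    ((TopCat.toSSet.obj (TopCat.of Y)).isColimitChainComplexXCofan
      (ModuleCat.of K (ULift.{u} K)) n).desc (Cofan.mk _ fun x => ModuleCat.ofHom
      (Finsupp.lsingle (TopCat.toSSetObjEquiv (TopCat.of Y) (Opposite.op ⦋n⦌) x) ∘ₗ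
        (ULift.moduleEquiv (R := K) (M := K)).toLinearMap))
  have hf (x) : ιComplex x ≫ f = ModuleCat.ofHom
      (Finsupp.lsingle (TopCat.toSSetObjEquiv (TopCat.of Y) (Opposite.op ⦋n⦌) x) ∘ₗ
        (ULift.moduleEquiv (R := K) (M := K)).toLinearMap) :=
    ((TopCat.toSSet.obj (TopCat.of Y)).isColimitChainComplexXCofan
      (ModuleCat.of K (ULift.{u} K)) n).fac _ ⟨x⟩
  refine Function.bijective_iff_has_inverse.2 ⟨f.hom, fun c => ?_, fun y => ?_⟩
  · induction c using Finsupp.induction_linear with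
    | zero => simp
    | add x y hx hy => rw [map_add, map_add, hx, hy]
    | single σ a =>
      rw [toComplex_single]
      refine (ConcreteCategory.congr_hom (hf (toSimplex σ)) (ULift.up a)).trans ?_
      change Finsupp.single (TopCat.toSSetObjEquiv _ _ (toSimplex σ)) a = _
      rw [toSimplex, Equiv.apply_symm_apply]
  · have : f ≫ ModuleCat.ofHom (toComplex n) = 𝟙 _ := by
      refine SSet.chainComplex_hom_ext fun x => ?_
      rw [← Category.assoc, hf, Category.comp_id]
      ext ⟨a⟩
      refine (toComplex_single n _ a).trans ?_
      rw [toSimplex, Equiv.symm_apply_apply]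
    exact ConcreteCategory.congr_hom this y

theorem d_toComplex (n : ℕ) (c : Chain K Y (n + 2)) :
    ((complex K Y).d (n + 1) n).hom (toComplex (n + 1) c) = toComplex n (boundary (n + 1) c) := by
  induction c using Finsupp.induction_linear with
  | zero => simp
  | add x y hx hy => rw [map_add, map_add, map_add, map_add, hx, hy]
  | single σ a =>
    rw [toComplex_single, boundary_single, map_sum]
    refine (ConcreteCategory.congr_hom (SSet.ιChainComplex_d _
      (R := ModuleCat.of K (ULift.{u} K)) (toSimplex σ)) (ULift.up a)).trans ?_
    change (∑ i : Fin (n + 2), (-1 : ℤ) ^ (i : ℕ) • ιComplex (K := K)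
      ((TopCat.toSSet.obj (TopCat.of Y)).δ i (toSimplex σ))).hom (ULift.up a) = _
    rw [ModuleCat.hom_sum, LinearMap.sum_apply]
    refine Finset.sum_congr rfl fun i _ => ?_
    rw [map_smul, toComplex_single, toSimplex_face, ModuleCat.hom_zsmul, LinearMap.smul_apply]
    -- The categorical boundary has integer signs and the concrete one has signs in `K`, so the two
    -- are compared by parity.
    rcases Nat.even_or_odd (i : ℕ) with h | h <;> simp [h]

theorem complexMap_toComplex {Z : Type u} [TopologicalSpace Z] (f : C(Y, Z)) (n : ℕ)
    (c : Chain K Y (n + 1)) :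
    ((complexMap f).f n).hom (toComplex n c) = toComplex n (map f (n + 1) c) := by
  induction c using Finsupp.induction_linear with
  | zero => simp
  | add x y hx hy => rw [map_add, map_add, map_add, map_add, hx, hy]
  | single σ a =>
    rw [toComplex_single, map_single, toComplex_single]
    exact ConcreteCategory.congr_hom (SSet.ι_chainComplexMap_f _ _
      (TopCat.toSSet.map (TopCat.ofHom f)) (ModuleCat.of K (ULift.{u} K)) (toSimplex σ)) (ULift.up a)

theorem complexMap_id : complexMap (K := K) (ContinuousMap.id Y) = 𝟙 _ :=
  ((SSet.chainComplexFunctor _).obj (ModuleCat.of K (ULift.{u} K))).map_id _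

theorem complexMap_comp {Z W : Type u} [TopologicalSpace Z] [TopologicalSpace W] (f : C(Y, Z))
    (g : C(Z, W)) : complexMap (K := K) (g.comp f) = complexMap f ≫ complexMap g := by
  rw [complexMap, TopCat.ofHom_comp, Functor.map_comp]
  exact Functor.map_comp _ _ _

variable (K) in
/-- The automorphism of the singular chains modulo boundaries induced by a homeomorphism. -/
def opcyclesUnit (T : Y ≃ₜ Y) (i : ℕ) : (Module.End K ((complex K Y).opcycles i))ˣ where
  val := (HomologicalComplex.opcyclesMap (complexMap (K := K) (T : C(Y, Y))) i).hom
  inv := (HomologicalComplex.opcyclesMap (complexMap (K := K) (T.symm : C(Y, Y))) i).hom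
  val_inv := by
    have h : (T : C(Y, Y)).comp (T.symm : C(Y, Y)) = ContinuousMap.id Y :=
      ContinuousMap.ext T.apply_symm_apply
    rw [Module.End.mul_eq_comp, ← ModuleCat.hom_comp, ← HomologicalComplex.opcyclesMap_comp,
      ← complexMap_comp, h, complexMap_id, HomologicalComplex.opcyclesMap_id]
    rfl
  inv_val := by
    have h : (T.symm : C(Y, Y)).comp (T : C(Y, Y)) = ContinuousMap.id Y :=
      ContinuousMap.ext T.symm_apply_apply
    rw [Module.End.mul_eq_comp, ← ModuleCat.hom_comp, ← HomologicalComplex.opcyclesMap_comp,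
      ← complexMap_comp, h, complexMap_id, HomologicalComplex.opcyclesMap_id]
    rfl

variable (K) in
/-- The quotient map from chains to chains modulo boundaries, over `K[t, t⁻¹]`. -/
def toOpcycles (T : Y ≃ₜ Y) (i : ℕ) :
    TwistedChain K T (i + 1) →ₗ[LaurentPolynomial K] UnitModule (opcyclesUnit K T i) :=
  UnitModule.map (((complex K Y).pOpcycles i).hom ∘ₗ toComplex i) fun c => by
    change ((complex K Y).pOpcycles i).hom (toComplex i (map (T : C(Y, Y)) (i + 1) c)) = _
    rw [← complexMap_toComplex]
    exact (ConcreteCategory.congr_hom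
      (HomologicalComplex.p_opcyclesMap (complexMap (K := K) (T : C(Y, Y))) i) (toComplex i c)).symm

variable (K) in
/-- The inclusion of the homology in the chains modulo boundaries, over `K[t, t⁻¹]`. -/
def homologyToOpcycles (T : Y ≃ₜ Y) (i : ℕ) :
    AlexanderModule K T i →ₗ[LaurentPolynomial K] UnitModule (opcyclesUnit K T i) :=
  UnitModule.map (u := fieldHomologyUnit K T i) ((complex K Y).homologyι i).hom fun c =>
    ConcreteCategory.congr_hom
      (HomologicalComplex.homologyι_naturality (complexMap (K := K) (T : C(Y, Y))) i) c

theorem homologyToOpcycles_injective (T : Y ≃ₜ Y) (i : ℕ) :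
    Function.Injective (homologyToOpcycles K T i) :=
  (ModuleCat.mono_iff_injective ((complex K Y).homologyι i)).1 inferInstance

theorem exists_toOpcycles_eq (T : Y ≃ₜ Y) (i : ℕ) (x : UnitModule (opcyclesUnit K T i)) :
    ∃ c, toOpcycles K T i c = x := by
  obtain ⟨y, hy⟩ := (ModuleCat.epi_iff_surjective ((complex K Y).pOpcycles i)).1 inferInstance x
  obtain ⟨c, rfl⟩ := (toComplex_bijective i).2 y
  exact ⟨c, hy⟩

variable {X : Type*} {p : Y → X} {T : Y ≃ₜ Y} {hT : ∀ e, p (T e) = p e}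

theorem toOpcycles_boundaries (i : ℕ) (b : TwistedChain K T (i + 1))
    (hb : b ∈ twistedBoundaries K hT Set.univ (i + 1)) : toOpcycles K T i b = 0 := by
  obtain ⟨x, -, rfl⟩ := hb
  change ((complex K Y).pOpcycles i).hom (toComplex i (boundary (i + 1) x)) = 0
  rw [← d_toComplex]
  exact ConcreteCategory.congr_hom ((complex K Y).d_pOpcycles (i + 1) i) (toComplex (i + 1) x)

theorem mem_within_univ {m : ℕ} (c : Chain K Y m) :
    c ∈ within K (p ⁻¹' Set.univ) m := by simp [within]

/-- The Alexander module is finitely generated if the chain level homology is. -/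
theorem CoverFG.moduleFinite (h : CoverFG K hT Set.univ) (i : ℕ) :
    Module.Finite (LaurentPolynomial K) (AlexanderModule K T i) := by
  have key : ∃ G : Submodule (LaurentPolynomial K) (TwistedChain K T (i + 1)), G.FG ∧
      ∀ c, toOpcycles K T i c ∈ LinearMap.range (homologyToOpcycles K T i) →
        c ∈ G ⊔ twistedBoundaries K hT Set.univ (i + 1) := by
    cases i with
    -- All 0-chains represent homology classes here, whereas `CoverFG` controls only those of
    -- augmentation zero. Lifting generators of the image of the augmentation makes up the
    -- difference.
    | zero =>
      obtain ⟨G, hG, hle⟩ := h 0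
      obtain ⟨G₀, hG₀, hG₀'⟩ := fgModulo_twisted_zero K (T := T) ⊤ ⊥
      obtain ⟨F, hF, -, hF'⟩ := exists_fg_le_sup_ker (D := ⊤) (φ := twistedBoundary K T 0) hG₀
        (by
          have : (⊤ : Submodule (LaurentPolynomial K) (TwistedChain K T 0)) ≤ G₀ := by
            simpa using hG₀'
          exact le_top.trans this)
      refine ⟨F ⊔ G, hF.sup hG, fun c _ => ?_⟩
      have hc := hF' (Submodule.mem_top (x := c))
      rw [sup_assoc]
      refine sup_le_sup_left (le_trans ?_ hle) F hc
      intro c hc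
      have hc : boundary 0 c = 0 := hc.2
      exact ⟨mem_within_univ c, hc⟩
    | succ i =>
      obtain ⟨G, hG, hle⟩ := h (i + 1)
      -- In positive degree, a chain whose class modulo boundaries comes from homology is a cycle.
      refine ⟨G, hG, fun (c : Chain K Y (i + 2)) ⟨y, hy⟩ => hle ⟨mem_within_univ c, ?_⟩⟩
      change boundary (i + 1) c = 0
      refine (toComplex_bijective i).1 ?_
      rw [map_zero, ← d_toComplex]
      have h1 : ((complex K Y).homologyι (i + 1)).hom y =
        ((complex K Y).pOpcycles (i + 1)).hom (toComplex (i + 1) c) := hy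
      have h2 := ConcreteCategory.congr_hom ((complex K Y).p_fromOpcycles (i + 1) i)
        (toComplex (i + 1) c)
      refine h2.symm.trans ?_
      change ((complex K Y).fromOpcycles (i + 1) i).hom
        (((complex K Y).pOpcycles (i + 1)).hom (toComplex (i + 1) c)) = 0
      rw [← h1]
      exact ConcreteCategory.congr_hom ((complex K Y).homologyι_comp_fromOpcycles (i + 1) i) y
  obtain ⟨G, hG, hle⟩ := key
  have hrange : LinearMap.range (homologyToOpcycles K T i) ≤ G.map (toOpcycles K T i) := by
    intro x hx
    obtain ⟨c, rfl⟩ := exists_toOpcycles_eq T i x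
    obtain ⟨g, hg, b, hb, rfl⟩ := Submodule.mem_sup.1 (hle c hx)
    rw [map_add, toOpcycles_boundaries i b hb, add_zero]
    exact Submodule.mem_map_of_mem hg
  have hfg := (hG.map (toOpcycles K T i)).of_le hrange
  have := Module.Finite.iff_fg.2 hfg
  -- Homology embeds in chains modulo boundaries, with image inside a finitely generated submodule;
  -- Noetherianity passes finite generation on to it.
  exact Module.Finite.equiv (LinearEquiv.ofInjective _ (homologyToOpcycles_injective T i)).symm

end SingularChain

/-! ## Coverings of finite CW complexes -/

namespace SingularChain

open Topology Topology.RelCWComplex Metric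

variable {K : Type v} [Field K] {E X : Type*} [TopologicalSpace E] [TopologicalSpace X]
  {p : E → X} {T : E ≃ₜ E} {hT : ∀ e, p (T e) = p e}

/-- Version of `CoverFG.union` for a union of two relatively open sets. -/
theorem CoverFG.union_of_relOpen (hp : Continuous p) {B B₁ B₂ : Set X} (hB : B ⊆ B₁ ∪ B₂)
    (h₁ : ∃ O, IsOpen O ∧ B ∩ O = B₁) (h₂ : ∃ O, IsOpen O ∧ B ∩ O = B₂) (hB₁ : CoverFG K hT B₁)
    (hB₂ : CoverFG K hT B₂) (hB₁₂ : CoverFG K hT (B₁ ∩ B₂)) : CoverFG K hT B := by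
  obtain ⟨O₁, hO₁, rfl⟩ := h₁
  obtain ⟨O₂, hO₂, rfl⟩ := h₂
  rw [← Set.inter_inter_distrib_left] at hB₁₂
  exact CoverFG.union hp hO₁ hO₂ (hB.trans (Set.union_subset_union Set.inter_subset_right
    Set.inter_subset_right)) hB₁ hB₂ hB₁₂

variable {C D : Set X} [RelCWComplex C D] {n : ℕ} (j : cell C n)

theorem continuousOn_map_ball : ContinuousOn (RelCWComplex.map n j) (ball 0 1) :=
  (continuousOn n j).mono ball_subset_closedBall

theorem map_symm_map {x : Fin n → ℝ} (hx : x ∈ ball (0 : Fin n → ℝ) 1) :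
    (RelCWComplex.map n j).symm (RelCWComplex.map n j x) = x :=
  (RelCWComplex.map n j).left_inv (by rwa [source_eq n j])

theorem map_injOn_ball : Set.InjOn (RelCWComplex.map n j) (ball 0 1) := by
  rw [← source_eq n j]
  exact (RelCWComplex.map n j).injOn

theorem target_eq_openCell : (RelCWComplex.map n j).target = openCell n j := by
  rw [openCell, ← source_eq n j, (RelCWComplex.map n j).image_source_eq_target]

/-- The characteristic map has a continuous inverse on the open cell. The open cell need not be open
in `X`, so only relative openness is available, and `CoverFG.union_of_relOpen` needs no more. -/
theorem exists_isOpen_inter_eq {S U : Set (Fin n → ℝ)} (hS : S ⊆ ball 0 1)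
    (hU : IsOpen U) (hUS : U ⊆ S) :
    ∃ O : Set X, IsOpen O ∧ RelCWComplex.map n j '' S ∩ O = RelCWComplex.map n j '' U := by
  obtain ⟨O, hO, hO'⟩ := continuousOn_iff'.1 (continuousOn_symm n j) U hU
  refine ⟨O, hO, ?_⟩
  rw [target_eq_openCell] at hO'
  ext x
  constructor
  · rintro ⟨⟨y, hy, rfl⟩, hx⟩
    have : RelCWComplex.map n j y ∈ O ∩ openCell n j := ⟨hx, y, hS hy, rfl⟩
    rw [← hO'] at this
    have h := this.1
    rw [Set.mem_preimage, map_symm_map j (hS hy)] at h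
    exact ⟨y, h, rfl⟩
  · rintro ⟨y, hy, rfl⟩
    refine ⟨⟨y, hUS hy, rfl⟩, ?_⟩
    have : RelCWComplex.map n j y ∈ (RelCWComplex.map n j).symm ⁻¹' U ∩ openCell n j := by
      refine ⟨?_, y, hS (hUS hy), rfl⟩
      rwa [Set.mem_preimage, map_symm_map j (hS (hUS hy))]
    rw [hO'] at this
    exact this.1

/-- The straight-line contraction of `S`, transported by the characteristic map, reduces the claim
to a point. -/
theorem CoverFG.image_convex (hp : IsCoveringMap p)
    (htrans : ∀ e e', p e = p e' → ∃ k : ℤ, e' = (T ^ k) e) {S : Set (Fin n → ℝ)}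
    (hS : S ⊆ ball 0 1) (hc : Convex ℝ S) : CoverFG K hT (RelCWComplex.map n j '' S) := by
  rcases S.eq_empty_or_nonempty with rfl | ⟨x₀, hx₀⟩
  · rw [Set.image_empty]
    exact CoverFG.empty
  have hinv (b : RelCWComplex.map n j '' S) : (RelCWComplex.map n j).symm b ∈ S := by
    obtain ⟨_, y, hy, rfl⟩ := b
    rwa [map_symm_map j (hS hy)]
  have hmem (t : unitInterval) (b : RelCWComplex.map n j '' S) :
      (1 - (t : ℝ)) • (RelCWComplex.map n j).symm b + (t : ℝ) • x₀ ∈ S :=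
    hc (hinv b) hx₀ (sub_nonneg.2 t.2.2) t.2.1 (by ring)
  have hcont : Continuous fun b : RelCWComplex.map n j '' S => (RelCWComplex.map n j).symm b :=
    (continuousOn_symm n j).comp_continuous continuous_subtype_val fun b => by
      rw [target_eq_openCell]
      exact Set.image_mono hS b.2
  refine CoverFG.of_deformation hp (B' := {RelCWComplex.map n j x₀})
    (Set.singleton_subset_iff.2 ⟨x₀, hx₀, rfl⟩)
    ⟨fun x => RelCWComplex.map n j ((1 - (x.1 : ℝ)) • (RelCWComplex.map n j).symm x.2 + (x.1 : ℝ) • x₀), ?_⟩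
    (fun b => ?_) (fun t b => ⟨_, hmem t b, rfl⟩) (fun b => ?_)
    (CoverFG.singleton hp htrans _)
  · have h1 : Continuous fun x : unitInterval × (RelCWComplex.map n j '' S) => (x.1 : ℝ) := by
      fun_prop
    exact (continuousOn_map_ball j).comp_continuous
      (((continuous_const.sub h1).smul (hcont.comp continuous_snd)).add
        (h1.smul continuous_const)) fun x => hS (hmem x.1 x.2)
  · obtain ⟨_, y, hy, rfl⟩ := b
    simp [map_symm_map j (hS hy)]
  · simp

/-- Split off one set `S` from the list. Its intersection with the union of the others is again a
union of convex open sets, one for each remaining member, so induction on the length covers both the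
remainder and the intersection. -/
theorem CoverFG.image_iUnion_convex (hp : IsCoveringMap p)
    (htrans : ∀ e e', p e = p e' → ∃ k : ℤ, e' = (T ^ k) e) (L : List (Set (Fin n → ℝ)))
    (hL : ∀ S ∈ L, IsOpen S ∧ Convex ℝ S ∧ S ⊆ ball 0 1) :
    CoverFG K hT (RelCWComplex.map n j '' {x | ∃ S ∈ L, x ∈ S}) := by
  obtain ⟨k, hk⟩ : ∃ k, L.length = k := ⟨_, rfl⟩
  induction k generalizing L with
  | zero =>
    rw [List.length_eq_zero_iff] at hk
    subst hk
    simpa using CoverFG.empty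
  | succ k ih =>
    obtain ⟨S, L, rfl⟩ := List.exists_cons_of_length_eq_add_one hk
    have hk : L.length = k := by simpa using hk
    obtain ⟨⟨hSo, hSc, hSb⟩, hL⟩ := List.forall_mem_cons.1 hL
    set U : Set (Fin n → ℝ) := {x | ∃ S ∈ L, x ∈ S} with hU
    have hUo : IsOpen U := by
      have : U = ⋃ S ∈ L, S := by ext; simp [hU]
      rw [this]
      exact isOpen_biUnion fun S hS => (hL S hS).1
    have hUb : U ⊆ ball 0 1 := fun x ⟨S, hS, hx⟩ => (hL S hS).2.2 hx
    have hSU : {x | ∃ S' ∈ S :: L, x ∈ S'} = S ∪ U := by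
      ext x
      simp [hU]
    rw [hSU]
    have hinter : RelCWComplex.map n j '' S ∩ RelCWComplex.map n j '' U =
        RelCWComplex.map n j '' {x | ∃ S' ∈ L.map (S ∩ ·), x ∈ S'} := by
      rw [← (map_injOn_ball j).image_inter hSb hUb]
      congr 1
      ext x
      simp only [hU, Set.mem_inter_iff, Set.mem_ofPred_eq, List.mem_map, exists_exists_and_eq_and]
      grind
    refine CoverFG.union_of_relOpen hp.continuous (B₁ := RelCWComplex.map n j '' S) (B₂ := RelCWComplex.map n j '' U)
      (Set.image_union _ _ _).le
      (exists_isOpen_inter_eq j (Set.union_subset hSb hUb) hSo Set.subset_union_left)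
      (exists_isOpen_inter_eq j (Set.union_subset hSb hUb) hUo Set.subset_union_right)
      (CoverFG.image_convex j hp htrans hSb hSc) (ih L hL hk) ?_
    rw [hinter]
    refine ih _ (fun S' hS' => ?_) (by simpa using hk)
    obtain ⟨S'', hS'', rfl⟩ := List.mem_map.1 hS'
    obtain ⟨h1, h2, h3⟩ := hL S'' hS''
    exact ⟨hSo.inter h1, hSc.inter h2, Set.inter_subset_left.trans hSb⟩

/-- A nonzero vector has a nonzero coordinate, so the 2n half-balls on which some coordinate has a
strict sign cover the punctured ball. This replaces a computation of the homology of spheres. -/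
theorem CoverFG.image_punctured_ball (hp : IsCoveringMap p)
    (htrans : ∀ e e', p e = p e' → ∃ k : ℤ, e' = (T ^ k) e) :
    CoverFG K hT (RelCWComplex.map n j '' (ball 0 1 \ {0})) := by
  let L : List (Set (Fin n → ℝ)) :=
    (List.finRange n).map (fun i => ball 0 1 ∩ {x | 0 < x i}) ++
      (List.finRange n).map (fun i => ball 0 1 ∩ {x | x i < 0})
  have hL : {x | ∃ S ∈ L, x ∈ S} = ball (0 : Fin n → ℝ) 1 \ {0} := by
    ext x
    simp only [L, List.mem_append, List.mem_map, List.mem_finRange, true_and, Set.mem_ofPred_eq,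
      Set.mem_sdiff, Set.mem_singleton_iff]
    constructor
    · rintro ⟨S, ⟨i, rfl⟩ | ⟨i, rfl⟩, hx, hi⟩
      · exact ⟨hx, fun h => by simp [h] at hi⟩
      · exact ⟨hx, fun h => by simp [h] at hi⟩
    · rintro ⟨hx, h0⟩
      obtain ⟨i, hi⟩ := Function.ne_iff.1 h0
      rcases lt_or_gt_of_ne hi with h | h
      · exact ⟨_, Or.inr ⟨i, rfl⟩, hx, h⟩
      · exact ⟨_, Or.inl ⟨i, rfl⟩, hx, h⟩
  rw [← hL]
  refine CoverFG.image_iUnion_convex j hp htrans L fun S hS => ?_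
  rcases List.mem_append.1 hS with h | h <;> obtain ⟨i, -, rfl⟩ := List.mem_map.1 h
  · exact ⟨isOpen_ball.inter (isOpen_lt continuous_const (continuous_apply i)),
      (convex_ball _ _).inter (convex_halfSpace_gt (LinearMap.proj (R := ℝ) i).isLinear 0),
      Set.inter_subset_left⟩
  · exact ⟨isOpen_ball.inter (isOpen_lt (continuous_apply i) continuous_const),
      (convex_ball _ _).inter (convex_halfSpace_lt (LinearMap.proj (R := ℝ) i).isLinear 0),
      Set.inter_subset_left⟩

/-- The radial deformation of the punctured closed ball onto the sphere. -/
def radial (x : unitInterval × (Fin n → ℝ)) : Fin n → ℝ :=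
  ((1 - (x.1 : ℝ)) + x.1 * ‖x.2‖⁻¹) • x.2

theorem norm_radial {s : unitInterval} {x : Fin n → ℝ} (hx : x ≠ 0) :
    ‖radial (s, x)‖ = (1 - s) * ‖x‖ + s := by
  have h0 : 0 ≤ (1 - (s : ℝ)) + s * ‖x‖⁻¹ :=
    add_nonneg (sub_nonneg.2 s.2.2) (mul_nonneg s.2.1 (inv_nonneg.2 (norm_nonneg x)))
  rw [radial, norm_smul, Real.norm_of_nonneg h0, add_mul, mul_assoc,
    inv_mul_cancel₀ (norm_ne_zero_iff.2 hx), mul_one]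

theorem radial_mem {s : unitInterval} {x : Fin n → ℝ} (hx : x ≠ 0)
    (hx1 : x ∈ closedBall (0 : Fin n → ℝ) 1) : radial (s, x) ∈ closedBall (0 : Fin n → ℝ) 1 := by
  rw [mem_closedBall_zero_iff] at hx1 ⊢
  rw [norm_radial hx]
  nlinarith [s.2.1, s.2.2]

theorem radial_ne_zero {s : unitInterval} {x : Fin n → ℝ} (hx : x ≠ 0) : radial (s, x) ≠ 0 := by
  rw [← norm_ne_zero_iff, norm_radial hx]
  have := norm_pos_iff.2 hx
  have h1 := s.2.1
  have h2 := s.2.2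
  intro h
  have h3 : (s : ℝ) = 0 := by nlinarith
  rw [h3] at h
  simp at h
  exact hx h

theorem radial_of_norm_eq_one {s : unitInterval} {x : Fin n → ℝ} (hx : ‖x‖ = 1) :
    radial (s, x) = x := by
  simp [radial, hx]

theorem continuousOn_radial :
    ContinuousOn (radial (n := n)) (Set.univ ×ˢ {0}ᶜ) := by
  have h1 : ContinuousOn (fun x : unitInterval × (Fin n → ℝ) => ‖x.2‖⁻¹)
      (Set.univ ×ˢ {0}ᶜ) :=
    (continuous_snd.norm.continuousOn).inv₀ fun x hx => norm_ne_zero_iff.2 hx.2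
  have h2 : Continuous fun x : unitInterval × (Fin n → ℝ) => (x.1 : ℝ) := by fun_prop
  exact ((continuousOn_const.sub h2.continuousOn).add (h2.continuousOn.mul h1)).smul
    continuous_snd.continuousOn

open Classical in
/-- The deformation of a punctured cell onto its boundary, extended by the identity of `Y`. -/
def cellDeformation (Y : Set X) (x : unitInterval × X) : X :=
  if x.2 ∈ Y then x.2 else RelCWComplex.map n j (radial (x.1, (RelCWComplex.map n j).symm x.2))

section Attach

variable {Y : Set X}

/-- On the sphere the two branches of the definition agree, since the radial map fixes unit vectors.
The formula therefore holds on the whole closed ball. -/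
theorem cellDeformation_map (hfr : cellFrontier n j ⊆ Y) (hdisj : Disjoint (openCell n j) Y)
    (s : unitInterval) {x : Fin n → ℝ} (hx : x ∈ closedBall (0 : Fin n → ℝ) 1) :
    cellDeformation j Y (s, RelCWComplex.map n j x) = RelCWComplex.map n j (radial (s, x)) := by
  rw [cellDeformation]
  split_ifs with h
  · have : ‖x‖ = 1 := by
      refine le_antisymm (mem_closedBall_zero_iff.1 hx) (not_lt.1 fun hlt => ?_)
      exact Set.disjoint_left.1 hdisj ⟨x, mem_ball_zero_iff.2 hlt, rfl⟩ h
    rw [radial_of_norm_eq_one this]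
  · have : x ∈ ball (0 : Fin n → ℝ) 1 := by
      refine mem_ball_zero_iff.2 (lt_of_le_of_ne (mem_closedBall_zero_iff.1 hx) fun he => ?_)
      exact h (hfr ⟨x, mem_sphere_zero_iff_norm.2 he, rfl⟩)
    rw [map_symm_map j this]

variable [T2Space X]

/-- The preimage of a closed set is, within the domain, a closed part over `Y` together with the
image of a compact subset of the closed ball times the interval. That image is closed because `X` is
Hausdorff. -/
theorem continuousOn_cellDeformation (hY : IsClosed Y) (hfr : cellFrontier n j ⊆ Y)
    (hdisj : Disjoint (openCell n j) Y) :
    ContinuousOn (cellDeformation j Y) (Set.univ ×ˢ ((Y ∪ openCell n j) ∩ {RelCWComplex.map n j 0}ᶜ)) := by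
  rw [continuousOn_iff_isClosed]
  intro t ht
  have hg : ContinuousOn (fun x : unitInterval × (Fin n → ℝ) => RelCWComplex.map n j (radial x))
      (Set.univ ×ˢ (closedBall 0 1 ∩ {0}ᶜ)) :=
    (continuousOn n j).comp (continuousOn_radial.mono (Set.prod_mono_right Set.inter_subset_right))
      fun x hx => radial_mem hx.2.2 hx.2.1
  -- The closed set `v` is controlled only away from the centre of the ball. This suffices, as the
  -- image of the centre is removed from the domain.
  obtain ⟨v, hv, hv'⟩ := continuousOn_iff_isClosed.1 hg t ht
  have hK : IsCompact (v ∩ (Set.univ ×ˢ closedBall (0 : Fin n → ℝ) 1)) :=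
    (isCompact_univ.prod (isCompact_closedBall _ _)).inter_left hv
  have hΘ : ContinuousOn (fun x : unitInterval × (Fin n → ℝ) => (x.1, RelCWComplex.map n j x.2))
      (v ∩ (Set.univ ×ˢ closedBall (0 : Fin n → ℝ) 1)) :=
    continuousOn_fst.prodMk ((continuousOn n j).comp continuousOn_snd fun x hx => hx.2.2)
  refine ⟨Set.univ ×ˢ (t ∩ Y) ∪ (fun x : unitInterval × (Fin n → ℝ) => (x.1, RelCWComplex.map n j x.2)) ''
    (v ∩ (Set.univ ×ˢ closedBall (0 : Fin n → ℝ) 1)),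
    (isClosed_univ.prod (ht.inter hY)).union (hK.image_of_continuousOn hΘ).isClosed, ?_⟩
  ext ⟨s, b⟩
  refine and_congr_left fun ⟨_, hb, hb0⟩ => ?_
  have hne {x : Fin n → ℝ} (hx : RelCWComplex.map n j x = b) : x ≠ 0 := by
    rintro rfl
    exact hb0 hx.symm
  constructor
  · intro h
    by_cases hbY : b ∈ Y
    · refine Or.inl ⟨trivial, ?_, hbY⟩
      simpa [cellDeformation, hbY] using h
    · obtain ⟨x, hx, hxb⟩ : b ∈ openCell n j := hb.resolve_left hbY
      refine Or.inr ⟨(s, x), ⟨?_, trivial, ball_subset_closedBall hx⟩, Prod.ext rfl hxb⟩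
      have : (s, x) ∈ (fun x : unitInterval × (Fin n → ℝ) => RelCWComplex.map n j (radial x)) ⁻¹' t ∩
          (Set.univ ×ˢ (closedBall 0 1 ∩ {0}ᶜ)) := by
        refine ⟨?_, trivial, ball_subset_closedBall hx, hne hxb⟩
        rw [Set.mem_preimage, ← hxb, cellDeformation_map j hfr hdisj s
          (ball_subset_closedBall hx)] at h
        exact h
      rw [hv'] at this
      exact this.1
  · rintro (⟨-, hbt, hbY⟩ | ⟨⟨s', x⟩, ⟨hxv, -, hx⟩, hxb⟩)
    · simpa [cellDeformation, hbY] using hbt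
    · obtain ⟨rfl, hxb⟩ := Prod.ext_iff.1 hxb
      have hxb : RelCWComplex.map n j x = b := hxb
      have : (s', x) ∈ v ∩ (Set.univ ×ˢ (closedBall 0 1 ∩ {0}ᶜ)) := ⟨hxv, trivial, hx, hne hxb⟩
      rw [← hv'] at this
      change cellDeformation j Y (s', b) ∈ t
      rw [← hxb, cellDeformation_map j hfr hdisj s' hx]
      exact this.1

/-- Removing the centre of the cell leaves a relatively open set that deforms radially onto `Y`. The
other piece is the open cell, and the overlap is a punctured ball. -/
theorem CoverFG.attach_cell (hp : IsCoveringMap p)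
    (htrans : ∀ e e', p e = p e' → ∃ k : ℤ, e' = (T ^ k) e) (hY : IsClosed Y)
    (hfr : cellFrontier n j ⊆ Y) (hdisj : Disjoint (openCell n j) Y) (h : CoverFG K hT Y) :
    CoverFG K hT (Y ∪ openCell n j) := by
  have h0 : RelCWComplex.map n j 0 ∉ Y := fun h => Set.disjoint_left.1 hdisj (map_zero_mem_openCell n j) h
  have hpre {b : X} (hb : b ∈ (Y ∪ openCell n j) ∩ {RelCWComplex.map n j 0}ᶜ) (hbY : b ∉ Y) :
      ∃ x ∈ ball (0 : Fin n → ℝ) 1, x ≠ 0 ∧ RelCWComplex.map n j x = b := by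
    obtain ⟨x, hx, rfl⟩ := hb.1.resolve_left hbY
    exact ⟨x, hx, fun h => hb.2 (by rw [h]; rfl), rfl⟩
  have hYsub : Y ⊆ (Y ∪ openCell n j) ∩ {RelCWComplex.map n j 0}ᶜ := fun y hy =>
    ⟨Or.inl hy, fun h => h0 (by rwa [← Set.mem_singleton_iff.1 h])⟩
  refine CoverFG.union_of_relOpen hp.continuous (B₁ := (Y ∪ openCell n j) ∩ {RelCWComplex.map n j 0}ᶜ)
    (B₂ := openCell n j) ?_ ⟨_, isOpen_compl_singleton, rfl⟩ ⟨Yᶜ, hY.isOpen_compl, ?_⟩ ?_ ?_ ?_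
  · rintro x (hx | hx)
    exacts [Or.inl (hYsub hx), Or.inr hx]
  · rw [Set.union_inter_distrib_right, Set.inter_compl_self, Set.empty_union,
      Set.inter_eq_left]
    exact hdisj.subset_compl_right
  · refine CoverFG.of_deformation hp hYsub
      ⟨fun x => cellDeformation j Y (x.1, x.2), (continuousOn_cellDeformation j hY hfr
        hdisj).comp_continuous (by fun_prop) fun x => ⟨trivial, x.2.2⟩⟩ ?_ ?_ ?_ h
    · rintro ⟨b, hb⟩
      by_cases hbY : b ∈ Y
      · simp [cellDeformation, hbY]
      · obtain ⟨x, hx, -, rfl⟩ := hpre hb hbY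
        refine (cellDeformation_map j hfr hdisj 0 (ball_subset_closedBall hx)).trans ?_
        simp [radial]
    · rintro t ⟨b, hb⟩
      by_cases hbY : b ∈ Y
      · have : cellDeformation j Y (t, b) = b := by simp [cellDeformation, hbY]
        change cellDeformation j Y (t, b) ∈ _
        rwa [this]
      · obtain ⟨x, hx, hx0, rfl⟩ := hpre hb hbY
        have e := cellDeformation_map j hfr hdisj t (ball_subset_closedBall hx)
        change cellDeformation j Y (t, RelCWComplex.map n j x) ∈ _
        rw [e]
        have hr := radial_mem (s := t) hx0 (ball_subset_closedBall hx)
        by_cases hr1 : ‖radial (t, x)‖ = 1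
        · exact hYsub (hfr ⟨_, mem_sphere_zero_iff_norm.2 hr1, rfl⟩)
        · have hrb : radial (t, x) ∈ ball (0 : Fin n → ℝ) 1 :=
            mem_ball_zero_iff.2 (lt_of_le_of_ne (mem_closedBall_zero_iff.1 hr) hr1)
          refine ⟨Or.inr ⟨_, hrb, rfl⟩, fun he => radial_ne_zero (s := t) hx0 ?_⟩
          exact map_injOn_ball j hrb (mem_ball_self one_pos) he
    · rintro ⟨b, hb⟩
      by_cases hbY : b ∈ Y
      · have : cellDeformation j Y (1, b) = b := by simp [cellDeformation, hbY]
        change cellDeformation j Y (1, b) ∈ _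
        rwa [this]
      · obtain ⟨x, hx, hx0, rfl⟩ := hpre hb hbY
        have e := cellDeformation_map j hfr hdisj 1 (ball_subset_closedBall hx)
        change cellDeformation j Y (1, RelCWComplex.map n j x) ∈ _
        rw [e]
        refine hfr ⟨_, mem_sphere_zero_iff_norm.2 ?_, rfl⟩
        rw [norm_radial hx0]
        simp
  · exact CoverFG.image_convex j hp htrans le_rfl (convex_ball _ _)
  · have : (Y ∪ openCell n j) ∩ {RelCWComplex.map n j 0}ᶜ ∩ openCell n j =
        RelCWComplex.map n j '' (ball 0 1 \ {0}) := by
      ext b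
      constructor
      · rintro ⟨⟨-, hb⟩, x, hx, rfl⟩
        exact ⟨x, ⟨hx, fun h => hb (by rw [Set.mem_singleton_iff.1 h]; rfl)⟩, rfl⟩
      · rintro ⟨x, ⟨hx, hx0⟩, rfl⟩
        refine ⟨⟨Or.inr ⟨x, hx, rfl⟩, fun h => hx0 ?_⟩, x, hx, rfl⟩
        exact map_injOn_ball j hx (mem_ball_self one_pos) h
    rw [this]
    exact CoverFG.image_punctured_ball j hp htrans

end Attach

/-- Cells are attached one at a time, dimension by dimension, starting from the empty set. Finite
dimensionality makes the process reach all of `X`. -/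
theorem CoverFG.univ_of_finite [T2Space X] [CWComplex (Set.univ : Set X)]
    [CWComplex.Finite (Set.univ : Set X)] (hp : IsCoveringMap p)
    (htrans : ∀ e e', p e = p e' → ∃ k : ℤ, e' = (T ^ k) e) : CoverFG K hT (Set.univ : Set X) := by
  have hfin (n : ℕ) : _root_.Finite (cell (Set.univ : Set X) n) :=
    RelCWComplex.FiniteType.finite_cell (D := ∅) n
  have hsk (n : ℕ) : CoverFG K hT (skeletonLT (Set.univ : Set X) (n : ℕ∞) : Set X) := by
    induction n with
    | zero =>
      have : (skeletonLT (Set.univ : Set X) ((0 : ℕ) : ℕ∞) : Set X) = ∅ :=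
        CWComplex.skeletonLT_zero_eq_empty
      rw [this]
      exact CoverFG.empty
    | succ n ih =>
      have := Fintype.ofFinite (cell (Set.univ : Set X) n)
      have key (s : Finset (cell (Set.univ : Set X) n)) : CoverFG K hT
          ((skeletonLT (Set.univ : Set X) (n : ℕ∞) : Set X) ∪
            ⋃ j ∈ s, closedCell (C := (Set.univ : Set X)) n j) := by
        classical
        induction s using Finset.induction_on with
        | empty => simpa using ih
        | insert j s hj ihs =>
          set Y := (skeletonLT (Set.univ : Set X) (n : ℕ∞) : Set X) ∪
            ⋃ j ∈ s, closedCell (C := (Set.univ : Set X)) n j with hYdef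
          have hfr : cellFrontier n j ⊆ Y :=
            (cellFrontier_subset_skeletonLT n j).trans Set.subset_union_left
          have hY : IsClosed Y := (skeletonLT (Set.univ : Set X) (n : ℕ∞)).closed.union
            (s.finite_toSet.isClosed_biUnion fun j _ => isClosed_closedCell)
          have hdisj : Disjoint (openCell n j) Y := by
            have hd : Disjoint (openCell n j) (skeletonLT (Set.univ : Set X) (n : ℕ∞) : Set X) :=
              (disjoint_skeletonLT_openCell le_rfl).symm
            refine Set.disjoint_union_right.2 ⟨hd, ?_⟩
            refine Set.disjoint_iUnion₂_right.2 fun j' hj' => ?_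
            rw [← cellFrontier_union_openCell_eq_closedCell]
            refine Set.disjoint_union_right.2
              ⟨hd.mono_right (cellFrontier_subset_skeletonLT n j'), ?_⟩
            refine disjoint_openCell_of_ne fun h => hj ?_
            obtain rfl : j = j' := by simpa using h
            exact hj'
          -- The frontier of the new closed cell is already in `Y`, so only its open cell is added.
          have e : (skeletonLT (Set.univ : Set X) (n : ℕ∞) : Set X) ∪
              ⋃ j' ∈ insert j s, closedCell (C := (Set.univ : Set X)) n j' = Y ∪ openCell n j := by
            rw [Finset.set_biUnion_insert, ← cellFrontier_union_openCell_eq_closedCell, hYdef]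
            ext x
            have := @hfr x
            simp only [hYdef, Set.mem_union] at this ⊢
            tauto
          rw [e]
          exact CoverFG.attach_cell j hp htrans hY hfr hdisj ihs
      have h := key Finset.univ
      have e := skeletonLT_union_iUnion_closedCell_eq_skeletonLT_succ (C := (Set.univ : Set X)) n
      simp only [Finset.mem_univ, Set.iUnion_true] at h
      rw [e] at h
      exact_mod_cast h
  obtain ⟨N, hN⟩ := Filter.eventually_atTop.1
    (RelCWComplex.FiniteDimensional.eventually_isEmpty_cell (C := (Set.univ : Set X)) (D := ∅))
  have e : (skeletonLT (Set.univ : Set X) (N : ℕ∞) : Set X) = Set.univ := by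
    refine Set.eq_univ_of_forall fun x => ?_
    have hx : x ∈ ⋃ (n : ℕ) (j : cell (Set.univ : Set X) n), openCell n j := by
      rw [CWComplex.iUnion_openCell_eq_complex]
      trivial
    obtain ⟨m, j, hx⟩ := Set.mem_iUnion₂.1 hx
    refine CWComplex.mem_skeletonLT_iff.2 ⟨m, ?_, j, hx⟩
    by_contra hlt
    exact (hN m (by simpa using hlt)).false j
  exact e ▸ hsk N

end SingularChain

/-! ## Coverings and lifts -/

/-- The characteristic maps present `X` as a quotient of a finite disjoint union of closed balls,
and local path connectedness passes to quotients. It is needed for the lifting criterion. -/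
theorem locallyPathConnectedSpace_of_finite_CW {X : Type*} [TopologicalSpace X] [T2Space X]
    [Topology.CWComplex (Set.univ : Set X)] [Topology.CWComplex.Finite (Set.univ : Set X)] :
    LocallyPathConnectedSpace X := by
  open Topology RelCWComplex Metric in
  let B (c : Σ n, cell (Set.univ : Set X) n) : Set (Fin c.1 → ℝ) := closedBall 0 1
  let φ : (Σ c, B c) → X := fun x => RelCWComplex.map x.1.1 x.1.2 x.2
  have hφ : Continuous φ := continuous_sigma fun c =>
    (RelCWComplex.continuousOn c.1 c.2).comp_continuous continuous_subtype_val fun x => x.2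
  have : _root_.Finite (Σ n, cell (Set.univ : Set X) n) :=
    RelCWComplex.finite_cells_of_finite (D := ∅)
  have hc c : CompactSpace (B c) := isCompact_iff_compactSpace.1 (isCompact_closedBall _ _)
  have hl c : LocallyPathConnectedSpace (B c) := (convex_closedBall 0 1).locallyPathConnectedSpace
  have hs : Function.Surjective φ := fun x => by
    have hx : x ∈ ⋃ (n : ℕ) (j : cell (Set.univ : Set X) n), openCell n j := by
      rw [CWComplex.iUnion_openCell_eq_complex]
      trivial
    obtain ⟨m, j, y, hy, rfl⟩ := Set.mem_iUnion₂.1 hx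
    exact ⟨⟨⟨m, j⟩, y, ball_subset_closedBall hy⟩, rfl⟩
  exact (hφ.isClosedMap.isQuotientMap hφ hs).locallyPathConnectedSpace

theorem IsLocalHomeomorph.locallyPathConnectedSpace {E X : Type*} [TopologicalSpace E]
    [TopologicalSpace X] [LocallyPathConnectedSpace X] {p : E → X} (hp : IsLocalHomeomorph p) :
    LocallyPathConnectedSpace E := by
  have key (x : E) : ∃ e : OpenPartialHomeomorph E X, x ∈ e.source := by
    obtain ⟨e, he, -⟩ := hp x
    exact ⟨e, he⟩
  choose e he using key
  let _ : ChartedSpace X E :=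
    { atlas := Set.range e
      chartAt := e
      mem_chart_source := he
      chart_mem_atlas := fun x => ⟨x, rfl⟩ }
  exact ChartedSpace.locallyPathConnectedSpace X E

namespace IsCoveringMap

variable {E D X : Type*} [TopologicalSpace E] [TopologicalSpace D] [TopologicalSpace X]
  {p : E → X} {q : D → X} (hp : IsCoveringMap p) (hq : IsCoveringMap q)

/-- A map over the base sends lifts of a path to lifts of the same path, and these are unique. -/
theorem monodromy_naturality (f : C(E, D)) (hf : ∀ e, q (f e) = p e) {x y : X}
    (γ : Path.Homotopic.Quotient x y) (e : E) (h : p e = x) (h' : q (f e) = x) :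
    (hq.monodromy γ ⟨f e, h'⟩ : D) = f (hp.monodromy γ ⟨e, h⟩ : E) := by
  obtain ⟨γ⟩ := γ
  have h0 : (γ : C(unitInterval, X)) 0 = p e := γ.source.trans h.symm
  have h0' : (γ : C(unitInterval, X)) 0 = q (f e) := γ.source.trans h'.symm
  have : f.comp (hp.liftPath γ e h0) = hq.liftPath γ (f e) h0' := by
    refine (hq.eq_liftPath_iff' h0').2 ⟨?_, ?_⟩
    · ext t
      exact (hf _).trans (congrFun (hp.liftPath_lifts γ e h0) t)
    · exact congrArg f (hp.liftPath_zero γ e h0)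
  exact (DFunLike.congr_fun this 1).symm

theorem monodromy_eq_self_iff {x : X} (γ : FundamentalGroup X x) (e : E) (h : p e = x) :
    (hp.monodromy (FundamentalGroup.toPath γ) ⟨e, h⟩ : E) = e ↔
      γ ∈ (FundamentalGroup.mapOfEq (⟨p, hp.continuous⟩ : C(E, X)) h).range := by
  subst h
  constructor
  · intro h
    induction γ using Quotient.inductionOn with | _ γ
    have h0 : (γ : C(unitInterval, X)) 0 = p e := γ.source
    refine ⟨FundamentalGroup.fromPath (Path.Homotopic.Quotient.mk
      ⟨hp.liftPath γ e h0, hp.liftPath_zero γ e h0, h⟩), ?_⟩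
    rw [FundamentalGroup.mapOfEq_apply]
    refine congrArg Path.Homotopic.Quotient.mk ?_
    ext t
    exact congrFun (hp.liftPath_lifts γ e h0) t
  · rintro ⟨Γ, rfl⟩
    rw [FundamentalGroup.mapOfEq_apply]
    refine congrArg Subtype.val ((congrArg (hp.monodromy · _) ?_).trans
      (hp.monodromy_map (FundamentalGroup.toPath Γ)))
    induction Γ using Quotient.inductionOn with | _ Γ
    rfl

end IsCoveringMap

theorem deck_zpow {E X : Type*} [TopologicalSpace E] {p : E → X} {T : E ≃ₜ E}
    (hT : ∀ e, p (T e) = p e) (k : ℤ) (e : E) : p ((T ^ k) e) = p e := by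
  induction k generalizing e with
  | zero => simp
  | succ k ih =>
    rw [zpow_add_one]
    exact (ih (T e)).trans (hT e)
  | pred k ih =>
    rw [zpow_sub_one]
    exact (ih (T.symm e)).trans (SingularChain.symm_deck hT e)

theorem Homeomorph.zpow_add_apply {E : Type*} [TopologicalSpace E] (T : E ≃ₜ E) (k l : ℤ) (e : E) :
    (T ^ (k + l)) e = (T ^ k) ((T ^ l) e) := by
  rw [zpow_add]
  rfl

namespace IsInfiniteCyclicCover

variable {X : Type u} [TopologicalSpace X] {x₀ : X} {ν : FundamentalGroup X x₀ →* Multiplicative ℤ}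
  {E : Type u} [TopologicalSpace E] {p : E → X} {T : E ≃ₜ E} (hp : IsInfiniteCyclicCover p T ν)
include hp

theorem monodromy_zpow {x y : X} (γ : Path.Homotopic.Quotient x y) (k : ℤ) (e : E) (h : p e = x)
    (h' : p ((T ^ k) e) = x) : (hp.isCoveringMap.monodromy γ ⟨(T ^ k) e, h'⟩ : E) =
      (T ^ k) (hp.isCoveringMap.monodromy γ ⟨e, h⟩ : E) :=
  hp.isCoveringMap.monodromy_naturality hp.isCoveringMap ((T ^ k : E ≃ₜ E) : C(E, E))
    (deck_zpow hp.map_deck k) γ e h h'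

/-- Over `x₀`, a path from `e₀` to `e` projects to a loop whose lift ends at a power of T applied to
`e₀`. Other fibres are carried to this one by monodromy, which is injective and commutes with T. -/
theorem exists_zpow_eq (e e' : E) (h : p e = p e') : ∃ k : ℤ, e' = (T ^ k) e := by
  have := hp.pathConnectedSpace
  obtain ⟨e₀, h₀, hmon⟩ := hp.exists_monodromy_eq
  have key (e : E) (he : p e = x₀) : ∃ k : ℤ, e = (T ^ k) e₀ := by
    subst h₀
    let α := Path.Homotopic.Quotient.mk (PathConnectedSpace.somePath e₀ e)
    let γ : Path.Homotopic.Quotient (p e₀) (p e₀) :=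
      (α.map ⟨p, hp.isCoveringMap.continuous⟩).cast rfl he.symm
    refine ⟨Multiplicative.toAdd (ν (FundamentalGroup.fromPath γ)), ?_⟩
    rw [← hmon]
    exact (congrArg Subtype.val (hp.isCoveringMap.monodromy_eq_of_map_eq (γ := γ)
      (ex := ⟨e₀, rfl⟩) (ey := ⟨e, he⟩) α (by rfl))).symm
  subst h₀
  let β := (Path.Homotopic.Quotient.mk (PathConnectedSpace.somePath e e₀)).map
    ⟨p, hp.isCoveringMap.continuous⟩
  have hβ : hp.isCoveringMap.monodromy β ⟨e, rfl⟩ = ⟨e₀, rfl⟩ := hp.isCoveringMap.monodromy_map _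
  obtain ⟨k, hk⟩ := key (hp.isCoveringMap.monodromy β ⟨e', h.symm⟩) (hp.isCoveringMap.monodromy β ⟨e', h.symm⟩).2
  refine ⟨k, ?_⟩
  have h1 := hp.monodromy_zpow β k e rfl (deck_zpow hp.map_deck k e)
  rw [hβ, ← hk] at h1
  exact congrArg Subtype.val ((hp.isCoveringMap.monodromy_bijective β).1 (Subtype.ext h1)).symm

/-- The definition of the covering gives this at one point of the fibre; transitivity and the
commutation of monodromy with T extend it to all of them. -/
theorem monodromy_loop (γ : FundamentalGroup X x₀) (e : E) (h : p e = x₀) :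
    (hp.isCoveringMap.monodromy (FundamentalGroup.toPath γ) ⟨e, h⟩ : E) =
      (T ^ Multiplicative.toAdd (ν γ)) e := by
  obtain ⟨e₀, h₀, hmon⟩ := hp.exists_monodromy_eq
  obtain ⟨k, rfl⟩ := hp.exists_zpow_eq e₀ e (h₀.trans h.symm)
  rw [hp.monodromy_zpow _ k e₀ h₀, hmon]
  rw [← T.zpow_add_apply, ← T.zpow_add_apply, add_comm]

theorem zpow_eq_of_apply_eq {A : Type*} [TopologicalSpace A] [PreconnectedSpace A] {k l : ℤ}
    {f g : C(A, E)} (h : ∀ a, p (f a) = p (g a)) (a : A) (he : (T ^ k) (f a) = (T ^ l) (g a))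
    (b : A) : (T ^ k) (f b) = (T ^ l) (g b) := by
  refine congrFun (hp.isCoveringMap.eq_of_comp_eq ((T ^ k).continuous.comp f.continuous)
    ((T ^ l).continuous.comp g.continuous) (funext fun b => ?_) a he) b
  exact (deck_zpow hp.map_deck k _).trans ((h b).trans (deck_zpow hp.map_deck l _).symm)

/-- If T^k fixes one point, it is the identity by uniqueness of lifts. A loop γ with `ν γ = k` then
lifts to a loop at the chosen point, so γ lies in the kernel of `ν`. -/
theorem eq_zero_of_zpow_apply_eq (hν : Function.Surjective ν) {k : ℤ} {e : E}
    (h : (T ^ k) e = e) : k = 0 := by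
  have := hp.pathConnectedSpace
  obtain ⟨e₁, h₁, hrange⟩ := hp.exists_range_eq
  have hk : (T ^ k) e₁ = e₁ := hp.zpow_eq_of_apply_eq (l := 0) (f := ContinuousMap.id E)
    (g := ContinuousMap.id E) (fun _ => rfl) e h e₁
  obtain ⟨γ, hγ⟩ := hν (Multiplicative.ofAdd k)
  have hmem : γ ∈ ν.ker := by
    rw [← hrange, ← hp.isCoveringMap.monodromy_eq_self_iff, hp.monodromy_loop, hγ]
    exact hk
  rw [MonoidHom.mem_ker, hγ] at hmem
  exact hmem

theorem zpow_apply_injective (hν : Function.Surjective ν) {k l : ℤ} {e : E}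
    (h : (T ^ k) e = (T ^ l) e) : k = l := by
  refine sub_eq_zero.1 (hp.eq_zero_of_zpow_apply_eq hν (e := (T ^ l) e) ?_)
  rw [← T.zpow_add_apply, sub_add_cancel, h]

/-- The map from the infinite cyclic covering to a finite cyclic covering. -/
theorem exists_map_finiteCover [LocallyPathConnectedSpace X] {N : ℕ} {D : Type u}
    [TopologicalSpace D] {q : D → X} (hq : IsCoverOfSubgroup q x₀ (reduceMod ν N).ker)
    (hν : Function.Surjective ν) :
    ∃ f : C(E, D), (∀ e, q (f e) = p e) ∧ (∀ (k : ℤ) e, f ((T ^ k) e) = f e ↔ (N : ℤ) ∣ k) ∧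
      Function.Surjective f := by
  have := hp.pathConnectedSpace
  have := hq.pathConnectedSpace
  have := hp.isCoveringMap.isLocalHomeomorph.locallyPathConnectedSpace
  obtain ⟨e₁, rfl, hrange⟩ := hp.exists_range_eq
  obtain ⟨d₁, h₁, hrange'⟩ := hq.exists_range_eq
  have hker (γ) : γ ∈ (reduceMod ν N).ker ↔ (N : ℤ) ∣ Multiplicative.toAdd (ν γ) := by
    rw [← ZMod.intCast_zmod_eq_zero_iff_dvd]
    rfl
  -- This is the lifting criterion, applicable since the kernel of `ν` is contained in the kernel of
  -- `ν` modulo `N`.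
  obtain ⟨f, ⟨hf₁, hf⟩, -⟩ := hq.isCoveringMap.existsUnique_continuousMap_lifts_of_range_le
    (f := ⟨p, hp.isCoveringMap.continuous⟩) (a₀ := e₁) (e₀ := d₁) h₁ (by
      rw [hrange']
      intro γ hγ
      have hγ' : γ ∈ ν.ker := by
        refine hrange.le ?_
        obtain ⟨Γ, rfl⟩ := hγ
        refine ⟨Γ, ?_⟩
        rw [FundamentalGroup.mapOfEq_apply]
        induction Γ using Quotient.inductionOn with | _ Γ
        rfl
      rw [hker, MonoidHom.mem_ker.1 hγ']
      exact dvd_zero _)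
  have hf (e) : q (f e) = p e := congrFun hf e
  refine ⟨f, hf, fun k e => ?_, fun d => ?_⟩
  · obtain ⟨γ, hγ⟩ := hν (Multiplicative.ofAdd k)
    -- Both `f ∘ T ^ k` and `f` lift `p`, so agreement at one point is agreement everywhere, and the
    -- base point suffices.
    have h1 : f ((T ^ k) e) = f e ↔ f ((T ^ k) e₁) = f e₁ := by
      have key (e e' : E) (h : f ((T ^ k) e) = f e) : f ((T ^ k) e') = f e' :=
        congrFun (hq.isCoveringMap.eq_of_comp_eq (f.continuous.comp (T ^ k).continuous)
          f.continuous (funext fun b => by simp [hf, deck_zpow hp.map_deck]) e h) e'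
      exact ⟨key _ _, key _ _⟩
    have h2 := hp.isCoveringMap.monodromy_naturality hq.isCoveringMap f hf
      (FundamentalGroup.toPath γ) e₁ rfl (hf e₁)
    rw [hp.monodromy_loop, hγ] at h2
    -- The lift of γ to the finite covering ends at `f (T ^ k e₁)`; it closes up exactly when γ is
    -- in the subgroup defining that covering.
    have h3 : f ((T ^ k) e₁) = f e₁ ↔ γ ∈ (reduceMod ν N).ker := by
      rw [← hrange', ← hq.isCoveringMap.monodromy_eq_self_iff]
      subst hf₁
      exact (congrArg (· = f e₁) h2).to_iff.symm
    rw [h1, h3, hker, hγ]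
    rfl
  · let α := PathConnectedSpace.somePath d₁ d
    let β := (Path.Homotopic.Quotient.mk α).map ⟨q, hq.isCoveringMap.continuous⟩
    have h1 := hq.isCoveringMap.monodromy_map (Path.Homotopic.Quotient.mk α)
    have h2 := hp.isCoveringMap.monodromy_naturality hq.isCoveringMap f hf β e₁ h₁.symm
      ((hf e₁).trans h₁.symm)
    refine ⟨_, h2.symm.trans ?_⟩
    subst hf₁
    exact congrArg Subtype.val h1

end IsInfiniteCyclicCover

/-! ## Sections of a character local system on the infinite cyclic covering -/

namespace IsInfiniteCyclicCover

variable {X : Type u} [TopologicalSpace X] {x₀ : X} {ν : FundamentalGroup X x₀ →* Multiplicative ℤ}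
  {E : Type u} [TopologicalSpace E] {p : E → X} {T : E ≃ₜ E} (hp : IsInfiniteCyclicCover p T ν)
  {e₀ : E} (h₀ : p e₀ = x₀)

/-- The integer `k` such that the lift of `q` starting at `e₀` ends at `T ^ k e`. -/
def exponent (e : E) (q : FundamentalGroupoid.mk x₀ ⟶ FundamentalGroupoid.mk (p e)) : ℤ :=
  (hp.exists_zpow_eq e (hp.isCoveringMap.monodromy q ⟨e₀, h₀⟩)
    (hp.isCoveringMap.monodromy q ⟨e₀, h₀⟩).2.symm).choose

theorem monodromy_exponent (e : E) (q : FundamentalGroupoid.mk x₀ ⟶ FundamentalGroupoid.mk (p e)) :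
    (hp.isCoveringMap.monodromy q ⟨e₀, h₀⟩ : E) = (T ^ hp.exponent h₀ e q) e :=
  (hp.exists_zpow_eq e (hp.isCoveringMap.monodromy q ⟨e₀, h₀⟩)
    (hp.isCoveringMap.monodromy q ⟨e₀, h₀⟩).2.symm).choose_spec

section

variable (hν : Function.Surjective ν)
include hν

theorem exponent_eq {e : E} {q : FundamentalGroupoid.mk x₀ ⟶ FundamentalGroupoid.mk (p e)} {k : ℤ}
    (h : (hp.isCoveringMap.monodromy q ⟨e₀, h₀⟩ : E) = (T ^ k) e) : hp.exponent h₀ e q = k :=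
  hp.zpow_apply_injective hν ((hp.monodromy_exponent h₀ e q).symm.trans h)

/-- The lift of the composite first reaches `T ^ ν(g) e₀`, and from there follows the translate of
the lift of `q`. -/
theorem exponent_loop_comp (e : E) (g : FundamentalGroup X x₀)
    (q : FundamentalGroupoid.mk x₀ ⟶ FundamentalGroupoid.mk (p e)) :
    hp.exponent h₀ e (FundamentalGroup.toArrow g ≫ q) =
      Multiplicative.toAdd (ν g) + hp.exponent h₀ e q := by
  refine hp.exponent_eq h₀ hν ?_
  have h1 := hp.isCoveringMap.monodromy_trans_apply (FundamentalGroup.toPath g) q ⟨e₀, h₀⟩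
  have h2 : hp.isCoveringMap.monodromy (FundamentalGroup.toPath g) ⟨e₀, h₀⟩ =
      ⟨(T ^ Multiplicative.toAdd (ν g)) e₀, (deck_zpow hp.map_deck _ _).trans h₀⟩ :=
    Subtype.ext (hp.monodromy_loop g e₀ h₀)
  rw [h2] at h1
  refine (congrArg Subtype.val h1).trans ?_
  rw [hp.monodromy_zpow q _ e₀ h₀, hp.monodromy_exponent h₀ e q, T.zpow_add_apply]

/-- The identity T^k e = T^(k-1) (T e) lowers the exponent by one. The paths are compared by `HEq`
because `p (T e) = p e` is only a propositional equality. -/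
theorem exponent_deck (e : E) (q : FundamentalGroupoid.mk x₀ ⟶ FundamentalGroupoid.mk (p e))
    (q' : FundamentalGroupoid.mk x₀ ⟶ FundamentalGroupoid.mk (p (T e))) (h : HEq q q') :
    hp.exponent h₀ (T e) q' = hp.exponent h₀ e q - 1 := by
  refine hp.exponent_eq h₀ hν ?_
  have h1 : (hp.isCoveringMap.monodromy q' ⟨e₀, h₀⟩ : E) =
      (hp.isCoveringMap.monodromy q ⟨e₀, h₀⟩ : E) := by
    have key (x : X) (hx : x = p e)
        (q' : FundamentalGroupoid.mk x₀ ⟶ FundamentalGroupoid.mk x) (h : HEq q q') :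
        (hp.isCoveringMap.monodromy q' ⟨e₀, h₀⟩ : E) =
          (hp.isCoveringMap.monodromy q ⟨e₀, h₀⟩ : E) := by
      subst hx
      rw [eq_of_heq h]
    exact key _ (hp.map_deck e) q' h
  rw [h1, hp.monodromy_exponent h₀ e q]
  conv_lhs => rw [← sub_add_cancel (hp.exponent h₀ e q) 1, T.zpow_add_apply, zpow_one]

theorem exponent_comp (e e' : E) (α : FundamentalGroupoid.mk e ⟶ FundamentalGroupoid.mk e')
    (q : FundamentalGroupoid.mk x₀ ⟶ FundamentalGroupoid.mk (p e)) :
    hp.exponent h₀ e' (q ≫ (FundamentalGroupoid.map ⟨p, hp.isCoveringMap.continuous⟩).map α) =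
      hp.exponent h₀ e q := by
  refine hp.exponent_eq h₀ hν ?_
  have h1 := hp.isCoveringMap.monodromy_trans_apply q
    ((FundamentalGroupoid.map ⟨p, hp.isCoveringMap.continuous⟩).map α) ⟨e₀, h₀⟩
  have h2 : hp.isCoveringMap.monodromy q ⟨e₀, h₀⟩ =
      ⟨(T ^ hp.exponent h₀ e q) e, deck_zpow hp.map_deck _ _⟩ :=
    Subtype.ext (hp.monodromy_exponent h₀ e q)
  rw [h2] at h1
  refine (congrArg Subtype.val h1).trans ?_
  exact (hp.monodromy_zpow _ _ e rfl _).trans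
    (congrArg (fun y => (T ^ _) (Subtype.val y)) (hp.isCoveringMap.monodromy_map α))

end

variable {K : Type v} [Field K] (hν : Function.Surjective ν) (ρ : Kˣ)

/-- The section at `p e` of the local system `L_ρ` given by a point `e` of the covering. -/
def stalkSection (e : E) : characterStalk ((zpowersHom Kˣ ρ).comp ν) (FundamentalGroupoid.mk (p e)) where
  val q := ((ρ ^ hp.exponent h₀ e q)⁻¹ : Kˣ)
  property g q := by
    beta_reduce
    rw [hp.exponent_loop_comp h₀ hν]
    change _ = ((ρ ^ Multiplicative.toAdd (ν g) : Kˣ) : K) * _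
    rw [← Units.val_mul, zpow_add, mul_inv_rev, mul_comm (_)⁻¹, mul_inv_cancel_left]

/-- The exponent is unchanged along a path of the covering, so these sections form a flat
trivialization of the pullback of L_ρ to X^ν. -/
theorem transport_stalkSection (e e' : E) (α : FundamentalGroupoid.mk e ⟶ FundamentalGroupoid.mk e') :
    characterTransport ((zpowersHom Kˣ ρ).comp ν)
      ((FundamentalGroupoid.map ⟨p, hp.isCoveringMap.continuous⟩).map α)
      (hp.stalkSection h₀ hν ρ e) = hp.stalkSection h₀ hν ρ e' := by
  refine Subtype.ext (funext fun q => ?_)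
  change (((ρ ^ hp.exponent h₀ e (q ≫ Groupoid.inv _))⁻¹ : Kˣ) : K) =
    ((ρ ^ hp.exponent h₀ e' q)⁻¹ : Kˣ)
  let β : FundamentalGroupoid.mk (p e) ⟶ FundamentalGroupoid.mk (p e') :=
    (FundamentalGroupoid.map ⟨p, hp.isCoveringMap.continuous⟩).map α
  have hβ (q : FundamentalGroupoid.mk x₀ ⟶ FundamentalGroupoid.mk (p e')) :
      (q ≫ Groupoid.inv β) ≫ β = q := by
    rw [Category.assoc, Groupoid.inv_comp, Category.comp_id]
  rw [← hp.exponent_comp h₀ hν e e' α]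
  exact congrArg (fun q => ((ρ ^ hp.exponent h₀ e' q : Kˣ)⁻¹ : Kˣ).val) (hβ q)

/-- This factor is the reason why the operator whose cokernel computes L_ρ is t - ρ. -/
theorem stalkSection_deck (e : E) :
    HEq (hp.stalkSection h₀ hν ρ (T e)) ((ρ : K) • hp.stalkSection h₀ hν ρ e) := by
  have key (x : X) (hx : x = p e)
      (s : characterStalk ((zpowersHom Kˣ ρ).comp ν) (FundamentalGroupoid.mk x))
      (h : ∀ (q : FundamentalGroupoid.mk x₀ ⟶ FundamentalGroupoid.mk x)
        (q' : FundamentalGroupoid.mk x₀ ⟶ FundamentalGroupoid.mk (p e)), HEq q' q →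
          s.1 q = (ρ : K) * (hp.stalkSection h₀ hν ρ e).1 q') :
      HEq s ((ρ : K) • hp.stalkSection h₀ hν ρ e) := by
    subst hx
    exact heq_of_eq (Subtype.ext (funext fun q => h q q HEq.rfl))
  refine key _ (hp.map_deck e) _ fun q q' h => ?_
  change (((ρ ^ hp.exponent h₀ (T e) q)⁻¹ : Kˣ) : K) = ρ * ((ρ ^ hp.exponent h₀ e q')⁻¹ : Kˣ)
  rw [hp.exponent_deck h₀ hν e q' q h, ← Units.val_mul, zpow_sub_one, mul_inv_rev, inv_inv]

theorem exists_stalkSection_apply_eq_one (e : E) :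
    ∃ q : FundamentalGroupoid.mk x₀ ⟶ FundamentalGroupoid.mk (p e),
      (hp.stalkSection h₀ hν ρ e).1 q = 1 := by
  have := hp.pathConnectedSpace
  subst h₀
  refine ⟨(Path.Homotopic.Quotient.mk (PathConnectedSpace.somePath e₀ e)).map
    ⟨p, hp.isCoveringMap.continuous⟩, ?_⟩
  change (((ρ ^ hp.exponent rfl e _)⁻¹ : Kˣ) : K) = 1
  rw [hp.exponent_eq rfl hν (k := 0) (congrArg Subtype.val (hp.isCoveringMap.monodromy_map _))]
  simp

/-- Any two paths from `x₀` to `p e` differ by a loop, so equivariance determines a section from its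
value at one path; a path where the reference section equals 1 is used. -/
theorem exists_smul_stalkSection (e : E)
    (s : characterStalk ((zpowersHom Kˣ ρ).comp ν) (FundamentalGroupoid.mk (p e))) :
    ∃ a : K, s = a • hp.stalkSection h₀ hν ρ e := by
  obtain ⟨q₀, hq₀⟩ := hp.exists_stalkSection_apply_eq_one h₀ hν ρ e
  refine ⟨s.1 q₀, Subtype.ext (funext fun q => ?_)⟩
  let g : FundamentalGroup X x₀ := FundamentalGroup.fromArrow (q ≫ Groupoid.inv q₀)
  have hg : FundamentalGroup.toArrow g ≫ q₀ = q := by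
    change (q ≫ Groupoid.inv q₀) ≫ q₀ = q
    rw [Category.assoc, Groupoid.inv_comp, Category.comp_id]
  have h1 := s.2 g q₀
  have h2 := (hp.stalkSection h₀ hν ρ e).2 g q₀
  rw [hg] at h1 h2
  rw [hq₀] at h2
  have h3 := Units.ne_zero (((zpowersHom Kˣ ρ).comp ν) g)
  refine mul_left_cancel₀ h3 ?_
  change _ = _ * (s.1 q₀ * (hp.stalkSection h₀ hν ρ e).1 q)
  rw [← h1, mul_left_comm, ← h2, mul_one]

end IsInfiniteCyclicCover

/-! ## Coinvariants of a free permutation module -/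

namespace Finsupp

variable {K : Type*} [Field K] {A : Type*} (g : Equiv.Perm A) (c : Kˣ)

/-- The operator `g - c` on the vector space with basis permuted by `g`. -/
def permSub : (A →₀ K) →ₗ[K] (A →₀ K) :=
  Finsupp.lmapDomain K K g - (c : K) • LinearMap.id

theorem permSub_single (a : A) (x : K) :
    permSub g c (single a x) = single (g a) x - (c : K) • single a x := by
  simp [permSub]

/-- A vector in the kernel has support stable under `g`. If nonzero, the support would contain an
infinite orbit. -/
theorem permSub_injective (hg : ∀ (k : ℤ) (a : A), (g ^ k) a = a → k = 0) :
    Function.Injective (permSub g c) := by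
  refine (injective_iff_map_eq_zero _).2 fun x hx => ?_
  have h (a : A) : x a = c * x (g a) := by
    have := DFunLike.congr_fun (sub_eq_zero.1 hx) (g a)
    rw [Finsupp.lmapDomain_apply, Finsupp.mapDomain_apply g.injective] at this
    simpa using this
  by_contra hne
  obtain ⟨a, ha⟩ := Finsupp.ne_iff.1 hne
  have hmem (n : ℕ) : (g ^ n) a ∈ x.support := by
    rw [Finsupp.mem_support_iff]
    induction n with
    | zero => exact ha
    | succ n ih =>
      rw [h] at ih
      rw [pow_succ']
      exact right_ne_zero_of_mul ih
  refine not_injective_infinite_finite (fun n : ℕ => (⟨(g ^ n) a, hmem n⟩ : x.support)) ?_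
  intro n m hnm
  have hnm : (g ^ n) a = (g ^ m) a := congrArg Subtype.val hnm
  have := hg (-m + n) a (by
    rw [zpow_add, Equiv.Perm.mul_apply, zpow_natCast, hnm, ← zpow_natCast, ← Equiv.Perm.mul_apply,
      ← zpow_add]
    simp)
  omega

theorem single_zpow_sub_mem (k : ℤ) (a : A) :
    single ((g ^ k) a) 1 - ((c ^ k : Kˣ) : K) • single a 1 ∈ LinearMap.range (permSub g c) := by
  induction k with
  | zero => simp
  | succ k ih =>
    have := add_mem (LinearMap.mem_range_self (permSub g c) (single ((g ^ (k : ℤ)) a) 1))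
      (Submodule.smul_mem _ (c : K) ih)
    rw [permSub_single, smul_sub, sub_add_sub_cancel, smul_smul, ← Units.val_mul,
      ← Equiv.Perm.mul_apply, ← zpow_one_add, ← zpow_one_add, add_comm] at this
    exact this
  | pred k ih =>
    have h := Submodule.smul_mem _ ((c⁻¹ : Kˣ) : K) (sub_mem ih
      (LinearMap.mem_range_self (permSub g c) (single ((g ^ (-(k : ℤ) - 1)) a) 1)))
    have e : g ((g ^ (-(k : ℤ) - 1)) a) = (g ^ (-(k : ℤ))) a := by
      rw [← Equiv.Perm.mul_apply, ← zpow_one_add]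
      congr 2
      ring
    rw [permSub_single, e] at h
    convert h using 1
    rw [sub_sub_sub_cancel_left, smul_sub, smul_smul, smul_smul, ← Units.val_mul, ← Units.val_mul,
      inv_mul_cancel, ← zpow_neg_one, ← zpow_add]
    simp [add_comm, sub_eq_add_neg]

variable {M : Type*} [AddCommGroup M] [Module K M] (ψ : (A →₀ K) →ₗ[K] M)

/-- Modulo the range, every vector is equivalent to one supported on orbit representatives. The
functionals in `hind` each see a single orbit, so `ψ` is injective on such vectors. -/
theorem ker_le_range_permSub
    (hψ : ∀ a, ψ (single (g a) 1) = (c : K) • ψ (single a 1))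
    (hind : ∀ a, ∃ φ : M →ₗ[K] K, φ (ψ (single a 1)) ≠ 0 ∧
      ∀ a', φ (ψ (single a' 1)) ≠ 0 → ∃ k : ℤ, a' = (g ^ k) a) :
    LinearMap.ker ψ ≤ LinearMap.range (permSub g c) := by
  intro x hx
  let s (a : A) : A := (Quotient.mk (Equiv.Perm.SameCycle.setoid g) a).out
  have hs (a : A) : ∃ k : ℤ, (g ^ k) (s a) = a :=
    Quotient.exact (s := Equiv.Perm.SameCycle.setoid g) (Quotient.out_eq _)
  have hss {a b : A} (k : ℤ) (h : s a = (g ^ k) (s b)) : s a = s b := by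
    have h1 : Quotient.mk (Equiv.Perm.SameCycle.setoid g) (s b) =
      Quotient.mk (Equiv.Perm.SameCycle.setoid g) (s a) := Quotient.sound ⟨k, h.symm⟩
    simp only [s, Quotient.out_eq] at h1
    simp only [s, h1]
  choose k hk using hs
  -- Normal form modulo the range: the basis vector at `a = g ^ k (s a)` becomes `c ^ k` times the
  -- one at `s a`.
  let θ : (A →₀ K) →ₗ[K] (A →₀ K) :=
    Finsupp.lsum K fun a => ((c ^ k a : Kˣ) : K) • Finsupp.lsingle (s a)
  have hθ (y : A →₀ K) : y - θ y ∈ LinearMap.range (permSub g c) ∧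
      θ y ∈ Finsupp.supported K K (Set.range s) := by
    induction y using Finsupp.induction_linear with
    | zero => simp
    | add y z hy hz =>
      rw [map_add, add_sub_add_comm]
      exact ⟨add_mem hy.1 hz.1, add_mem hy.2 hz.2⟩
    | single a t =>
      have e : θ (single a t) = t • ((c ^ k a : Kˣ) : K) • single (s a) 1 := by
        simp [θ, mul_comm]
      rw [e]
      constructor
      · have := Submodule.smul_mem _ t (single_zpow_sub_mem g c (k a) (s a))
        rw [hk, smul_sub, Finsupp.smul_single, smul_eq_mul, mul_one] at this
        exact this
      · exact Submodule.smul_mem _ _ (Submodule.smul_mem _ _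
          (Finsupp.single_mem_supported K _ ⟨a, rfl⟩))
  have hψD (y : A →₀ K) : ψ (permSub g c y) = 0 := by
    have : ψ ∘ₗ permSub g c = 0 := by
      refine Finsupp.lhom_ext' fun a => LinearMap.ext_ring ?_
      change ψ (permSub g c (single a 1)) = 0
      rw [permSub_single, map_sub, map_smul, hψ, sub_self]
    exact LinearMap.congr_fun this y
  have hψθ : ψ (θ x) = 0 := by
    obtain ⟨y, hy⟩ := (hθ x).1
    have h := hψD y
    rw [hy, map_sub, LinearMap.mem_ker.1 hx, zero_sub, neg_eq_zero] at h
    exact h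
  have hzero : θ x = 0 := by
    by_contra hne
    obtain ⟨b, hb⟩ := Finsupp.ne_iff.1 hne
    have hsupp := (Finsupp.mem_supported K _).1 (hθ x).2
    obtain ⟨a, rfl⟩ := hsupp (Finsupp.mem_support_iff.2 hb)
    obtain ⟨φ, hφ, hφ'⟩ := hind (s a)
    have h : φ (ψ (θ x)) = (θ x) (s a) * φ (ψ (single (s a) 1)) := by
      conv_lhs => rw [← Finsupp.sum_single (θ x)]
      rw [Finsupp.sum, map_sum, map_sum, Finset.sum_eq_single (s a)]
      · rw [← mul_one ((θ x) (s a)), ← smul_eq_mul, ← Finsupp.smul_single, map_smul, map_smul]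
        simp
      · intro b hb' hbs
        obtain ⟨a', rfl⟩ := hsupp hb'
        rw [← mul_one ((θ x) (s a')), ← smul_eq_mul, ← Finsupp.smul_single, map_smul, map_smul]
        by_contra h
        obtain ⟨k, hk⟩ := hφ' (s a') (right_ne_zero_of_mul h)
        exact hbs (hss k hk)
      · intro hb'
        exact absurd (Finsupp.mem_support_iff.2 hb) hb'
    rw [hψθ, map_zero] at h
    exact mul_ne_zero hb hφ h.symm
  have := (hθ x).1
  rwa [hzero, sub_zero] at this

end Finsupp

/-! ## Dimensions in a long exact sequence -/

/-- The dimension of the middle term of an exact sequence that starts with a cokernel. -/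
theorem Module.finite_and_finrank_of_surjective {K A H : Type*} [Field K] [AddCommGroup A]
    [Module K A] [AddCommGroup H] [Module K H] (Φ : A →ₗ[K] A) (α : A →ₗ[K] H)
    (hα : LinearMap.range Φ = LinearMap.ker α) (hs : Function.Surjective α)
    [Module.Finite K (A ⧸ LinearMap.range Φ)] :
    Module.Finite K H ∧ Module.finrank K H = Module.finrank K (A ⧸ LinearMap.range Φ) := by
  let e : (A ⧸ LinearMap.range Φ) ≃ₗ[K] H :=
    (Submodule.quotEquivOfEq _ _ hα).trans (α.quotKerEquivOfSurjective hs)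
  exact ⟨Module.Finite.equiv e, e.finrank_eq.symm⟩

/-- The middle term is an extension of the kernel of `Ψ` by the cokernel of `Φ`. -/
theorem Module.finite_and_finrank_of_exact {K A H B : Type*} [Field K] [AddCommGroup A]
    [Module K A] [AddCommGroup H] [Module K H] [AddCommGroup B] [Module K B]
    (Φ : A →ₗ[K] A) (α : A →ₗ[K] H) (δ : H →ₗ[K] B) (Ψ : B →ₗ[K] B)
    (hα : LinearMap.range Φ = LinearMap.ker α) (hδ : LinearMap.range α = LinearMap.ker δ)
    (hΨ : LinearMap.range δ = LinearMap.ker Ψ)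
    [Module.Finite K (A ⧸ LinearMap.range Φ)] [Module.Finite K (LinearMap.ker Ψ)] :
    Module.Finite K H ∧ Module.finrank K H =
      Module.finrank K (A ⧸ LinearMap.range Φ) + Module.finrank K (LinearMap.ker Ψ) := by
  let e₁ : (A ⧸ LinearMap.range Φ) ≃ₗ[K] LinearMap.ker δ :=
    (Submodule.quotEquivOfEq _ _ hα).trans
      (α.quotKerEquivRange.trans (LinearEquiv.ofEq _ _ hδ))
  let e₂ : (H ⧸ LinearMap.ker δ) ≃ₗ[K] LinearMap.ker Ψ :=
    δ.quotKerEquivRange.trans (LinearEquiv.ofEq _ _ hΨ)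
  have : Module.Finite K (LinearMap.ker δ) := Module.Finite.equiv e₁
  have : Module.Finite K (H ⧸ LinearMap.ker δ) := Module.Finite.equiv e₂.symm
  have : Module.Finite K H := Module.Finite.of_submodule_quotient (LinearMap.ker δ)
  refine ⟨this, ?_⟩
  rw [e₁.finrank_eq, ← e₂.finrank_eq, add_comm, Submodule.finrank_quotient_add_finrank]

section

variable {K : Type v} [Field K] {C M : ChainComplex (ModuleCat.{w} K) ℕ} (φ : C ⟶ C) (ψ : C ⟶ M)
  (hinj : ∀ n, Function.Injective (φ.f n))
  (hex : ∀ n, LinearMap.range (φ.f n).hom = LinearMap.ker (ψ.f n).hom)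
  (hsurj : ∀ n, Function.Surjective (ψ.f n))
include hinj hex hsurj

theorem exists_shortExact_of_degreewise :
    ∃ h : φ ≫ ψ = 0, (ShortComplex.mk φ ψ h).ShortExact := by
  have h0 : φ ≫ ψ = 0 := by
    ext n x
    exact (hex n).le ⟨x, rfl⟩
  refine ⟨h0, HomologicalComplex.shortExact_of_degreewise_shortExact _ fun n => ?_⟩
  have hmono : Mono (φ.f n) := (ModuleCat.mono_iff_injective _).2 (hinj n)
  have hepi : Epi (ψ.f n) := (ModuleCat.epi_iff_surjective _).2 (hsurj n)
  exact { exact := (ShortComplex.moduleCat_exact_iff_range_eq_ker _).2 (hex n)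
          mono_f := hmono
          epi_g := hepi }

theorem finrank_homology_zero
    [Module.Finite K (C.homology 0 ⧸ LinearMap.range (HomologicalComplex.homologyMap φ 0).hom)] :
    Module.Finite K (M.homology 0) ∧ Module.finrank K (M.homology 0) =
      Module.finrank K (C.homology 0 ⧸
        LinearMap.range (HomologicalComplex.homologyMap φ 0).hom) := by
  obtain ⟨h0, hS⟩ := exists_shortExact_of_degreewise φ ψ hinj hex hsurj
  have : Epi (ψ.f 0) := (ModuleCat.epi_iff_surjective _).2 (hsurj 0)
  have hepi : Epi (HomologicalComplex.homologyMap ψ 0) :=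
    HomologicalComplex.epi_homologyMap_of_epi_of_not_rel _ _ (by simp)
  exact Module.finite_and_finrank_of_surjective _ (HomologicalComplex.homologyMap ψ 0).hom
    (hS.homology_exact₂ 0).moduleCat_range_eq_ker ((ModuleCat.epi_iff_surjective _).1 hepi)

theorem finrank_homology_succ (i : ℕ)
    [Module.Finite K (C.homology (i + 1) ⧸
      LinearMap.range (HomologicalComplex.homologyMap φ (i + 1)).hom)]
    [Module.Finite K (LinearMap.ker (HomologicalComplex.homologyMap φ i).hom)] :
    Module.Finite K (M.homology (i + 1)) ∧ Module.finrank K (M.homology (i + 1)) =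
      Module.finrank K (C.homology (i + 1) ⧸
        LinearMap.range (HomologicalComplex.homologyMap φ (i + 1)).hom) +
      Module.finrank K (LinearMap.ker (HomologicalComplex.homologyMap φ i).hom) := by
  obtain ⟨h0, hS⟩ := exists_shortExact_of_degreewise φ ψ hinj hex hsurj
  have hij : (ComplexShape.down ℕ).Rel (i + 1) i := rfl
  exact Module.finite_and_finrank_of_exact _ (HomologicalComplex.homologyMap ψ (i + 1)).hom
    (hS.δ (i + 1) i hij).hom _
    (hS.homology_exact₂ (i + 1)).moduleCat_range_eq_ker
    (hS.homology_exact₃ (i + 1) i hij).moduleCat_range_eq_ker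
    (hS.homology_exact₁ (i + 1) i hij).moduleCat_range_eq_ker

end

/-! ## Chains of cyclic coverings -/

/-- The permutation of the maps to `E` given by a self-homeomorphism of `E`. -/
def Homeomorph.compPerm (A : Type*) [TopologicalSpace A] {E : Type*} [TopologicalSpace E] :
    (E ≃ₜ E) →* Equiv.Perm C(A, E) :=
  MonoidHom.toHomPerm
    { toFun S := fun σ => (S : C(E, E)).comp σ
      map_one' := rfl
      map_mul' _ _ := rfl }

theorem Homeomorph.compPerm_zpow_apply {A E : Type*} [TopologicalSpace A] [TopologicalSpace E]
    (S : E ≃ₜ E) (k : ℤ) (σ : C(A, E)) :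
    (compPerm A S ^ k) σ = ((S ^ k : E ≃ₜ E) : C(E, E)).comp σ := by
  rw [← map_zpow]
  rfl

theorem HomologicalComplex.homologyMap_smul {K : Type v} [Field K] {ι : Type*} {c : ComplexShape ι}
    {C D : HomologicalComplex (ModuleCat.{w} K) c} (a : K) (f : C ⟶ D) (i : ι) :
    homologyMap (a • f) i = a • homologyMap f i :=
  ShortComplex.homologyMap_smul (φ := (shortComplexFunctor _ c i).map f) a

namespace SingularChain

variable {K : Type v} [Field K] {E : Type u} [TopologicalSpace E]

variable (K) in
/-- The chain map `S - c` for a self-homeomorphism `S` and a scalar `c`. -/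
def complexSub (S : E ≃ₜ E) (c : K) : complex K E ⟶ complex K E :=
  complexMap (S : C(E, E)) - c • 𝟙 _

theorem complexSub_toComplex (S : E ≃ₜ E) (c : Kˣ) (n : ℕ) (x : Chain K E (n + 1)) :
    ((complexSub K S (c : K)).f n).hom (toComplex n x) =
      toComplex n (Finsupp.permSub (Homeomorph.compPerm _ S) c x) := by
  have h : ((complexSub K S (c : K)).f n).hom (toComplex n x) =
      ((complexMap (S : C(E, E))).f n).hom (toComplex n x) - (c : K) • toComplex n x := rfl
  rw [h, complexMap_toComplex, ← map_smul, ← map_sub]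
  rfl

theorem homologyMap_complexSub (S : E ≃ₜ E) (c : K) (i : ℕ) :
    (HomologicalComplex.homologyMap (complexSub K S c) i).hom =
      fieldHomologyMap K (S : C(E, E)) i - c • LinearMap.id := by
  rw [complexSub, HomologicalComplex.homologyMap_sub, HomologicalComplex.homologyMap_smul,
    HomologicalComplex.homologyMap_id]
  rfl

/-- A criterion for exactness in terms of singular simplices. -/
theorem complexSub_exact {S : E ≃ₜ E} (hS : ∀ (k : ℤ) e, (S ^ k) e = e → k = 0) (c : Kˣ) {n : ℕ}
    {M : ModuleCat.{max u v} K} (ψ : (complex K E).X n ⟶ M)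
    (hψ : ∀ σ, ψ.hom (toComplex n (Finsupp.single ((S : C(E, E)).comp σ) 1)) =
      (c : K) • ψ.hom (toComplex n (Finsupp.single σ 1)))
    (hind : ∀ σ, ∃ φ : M →ₗ[K] K, φ (ψ.hom (toComplex n (Finsupp.single σ 1))) ≠ 0 ∧
      ∀ τ, φ (ψ.hom (toComplex n (Finsupp.single τ 1))) ≠ 0 →
        ∃ k : ℤ, τ = ((S ^ k : E ≃ₜ E) : C(E, E)).comp σ) :
    Function.Injective ((complexSub K S (c : K)).f n) ∧
      LinearMap.range ((complexSub K S (c : K)).f n).hom = LinearMap.ker ψ.hom := by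
  let g := Homeomorph.compPerm (stdSimplex ℝ (Fin (n + 1))) S
  have hg (k : ℤ) (σ) (h : (g ^ k) σ = σ) : k = 0 := by
    rw [Homeomorph.compPerm_zpow_apply] at h
    exact hS k (σ (Classical.arbitrary _)) (DFunLike.congr_fun h _)
  have hker := Finsupp.ker_le_range_permSub g c (ψ.hom ∘ₗ toComplex n) hψ fun σ => by
    obtain ⟨φ, h, h'⟩ := hind σ
    refine ⟨φ, h, fun τ hτ => ?_⟩
    obtain ⟨k, hk⟩ := h' τ hτ
    exact ⟨k, hk.trans (Homeomorph.compPerm_zpow_apply S k σ).symm⟩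
  constructor
  · intro x y hxy
    obtain ⟨x, rfl⟩ := (toComplex_bijective n).2 x
    obtain ⟨y, rfl⟩ := (toComplex_bijective n).2 y
    have hxy : ((complexSub K S (c : K)).f n).hom (toComplex n x) =
      ((complexSub K S (c : K)).f n).hom (toComplex n y) := hxy
    rw [complexSub_toComplex, complexSub_toComplex] at hxy
    rw [Finsupp.permSub_injective g c hg ((toComplex_bijective n).1 hxy)]
  · refine le_antisymm ?_ fun x hx => ?_
    · rintro _ ⟨x, rfl⟩
      obtain ⟨x, rfl⟩ := (toComplex_bijective n).2 x
      rw [complexSub_toComplex, LinearMap.mem_ker]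
      have : (ψ.hom ∘ₗ toComplex n) ∘ₗ Finsupp.permSub g c = 0 := by
        refine Finsupp.lhom_ext' fun σ => LinearMap.ext_ring ?_
        change (ψ.hom ∘ₗ toComplex n) (Finsupp.permSub g c (Finsupp.single σ 1)) = 0
        rw [Finsupp.permSub_single, map_sub, map_smul, sub_eq_zero]
        exact hψ σ
      exact LinearMap.congr_fun this x
    · obtain ⟨x, rfl⟩ := (toComplex_bijective n).2 x
      obtain ⟨y, rfl⟩ := hker hx
      exact ⟨toComplex n y, complexSub_toComplex S c n y⟩

end SingularChain

namespace IsInfiniteCyclicCover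

open SingularChain

variable {X : Type u} [TopologicalSpace X] {x₀ : X} {ν : FundamentalGroup X x₀ →* Multiplicative ℤ}
  {E : Type u} [TopologicalSpace E] {p : E → X} {T : E ≃ₜ E} (hp : IsInfiniteCyclicCover p T ν)
  (hν : Function.Surjective ν) (K : Type v) [Field K]

instance locallyPathConnectedSpace_stdSimplex (n : ℕ) :
    LocallyPathConnectedSpace (stdSimplex ℝ (Fin (n + 1))) :=
  (convex_stdSimplex ℝ _).locallyPathConnectedSpace

instance simplyConnectedSpace_stdSimplex (n : ℕ) :
    SimplyConnectedSpace (stdSimplex ℝ (Fin (n + 1))) := by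
  have : ContractibleSpace (stdSimplex ℝ (Fin (n + 1))) :=
    (convex_stdSimplex ℝ _).contractibleSpace Set.Nonempty.of_subtype
  infer_instance

include hp in
theorem surjective [PathConnectedSpace X] : Function.Surjective p := by
  intro x
  obtain ⟨e₀, h₀, -⟩ := hp.exists_range_eq
  exact ⟨_, (hp.isCoveringMap.monodromy (.mk (PathConnectedSpace.somePath x₀ x)) ⟨e₀, h₀⟩).2⟩

include hp in
theorem exists_lift_simplex [PathConnectedSpace X] {n : ℕ} (σ : C(stdSimplex ℝ (Fin (n + 1)), X)) :
    ∃ τ : C(stdSimplex ℝ (Fin (n + 1)), E), ∀ a, p (τ a) = σ a := by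
  obtain ⟨e, he⟩ := hp.surjective (σ (Classical.arbitrary _))
  obtain ⟨τ, ⟨-, hτ⟩, -⟩ := hp.isCoveringMap.existsUnique_continuousMap_lifts σ _ e he
  exact ⟨τ, congrFun hτ⟩

include hp in
-- Two lifts of a simplex agree up to a power of T at one point, hence everywhere by connectedness.
theorem exists_zpow_comp_eq {n : ℕ} {σ τ : C(stdSimplex ℝ (Fin (n + 1)), E)}
    (h : ∀ a, p (σ a) = p (τ a)) : ∃ k : ℤ, τ = ((T ^ k : E ≃ₜ E) : C(E, E)).comp σ := by
  obtain ⟨k, hk⟩ := hp.exists_zpow_eq _ _ (h (Classical.arbitrary _))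
  exact ⟨k, ContinuousMap.ext fun a => (hp.zpow_eq_of_apply_eq (k := k) (l := 0) h _ hk.symm a).symm⟩

-- Simplices lift to X^ν because they are simply connected, which gives surjectivity. Two simplices
-- of X^ν have the same image exactly when they differ by a power of T^N, which identifies the
-- kernel.
include hp hν in
theorem finiteCover_exact [LocallyPathConnectedSpace X] {N : ℕ} (hN : 0 < N) {D : Type u}
    [TopologicalSpace D] {q : D → X} (hq : IsCoverOfSubgroup q x₀ (reduceMod ν N).ker) :
    ∃ ψ : complex K E ⟶ complex K D, ∀ n,
      Function.Injective ((complexSub K (T ^ N) (1 : K)).f n) ∧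
      LinearMap.range ((complexSub K (T ^ N) (1 : K)).f n).hom = LinearMap.ker (ψ.f n).hom ∧
      Function.Surjective (ψ.f n) := by
  obtain ⟨f, hf, hfT, hfs⟩ := hp.exists_map_finiteCover hq hν
  refine ⟨complexMap f, fun n => ?_⟩
  have hψ (σ : C(stdSimplex ℝ (Fin (n + 1)), E)) (a : K) :
      ((complexMap (K := K) f).f n).hom (toComplex n (Finsupp.single σ a)) =
        toComplex n (Finsupp.single (f.comp σ) a) := by
    rw [complexMap_toComplex, map_single]
  have hlift (σ : C(stdSimplex ℝ (Fin (n + 1)), D)) :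
      ∃ τ : C(stdSimplex ℝ (Fin (n + 1)), E), f.comp τ = σ := by
    obtain ⟨e, he⟩ := hfs (σ (Classical.arbitrary _))
    obtain ⟨τ, ⟨hτ₀, hτ⟩, -⟩ := hp.isCoveringMap.existsUnique_continuousMap_lifts
      ((⟨q, hq.isCoveringMap.continuous⟩ : C(D, X)).comp σ) (Classical.arbitrary _) e
      (by rw [← hf, he]; rfl)
    refine ⟨τ, DFunLike.coe_injective (hq.isCoveringMap.eq_of_comp_eq
      (f.continuous.comp τ.continuous) σ.continuous (funext fun a => ?_) (Classical.arbitrary _) ?_)⟩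
    · exact (hf _).trans (congrFun hτ a)
    · exact (congrArg f hτ₀).trans he
  have h := complexSub_exact (K := K) (S := T ^ N) (fun k e h => ?_) 1
    ((complexMap (K := K) f).f n) (fun σ => ?_) (fun σ => ?_)
  · refine ⟨h.1, h.2, fun y => ?_⟩
    obtain ⟨y, rfl⟩ := (toComplex_bijective n).2 y
    induction y using Finsupp.induction_linear with
    | zero => exact ⟨0, by simp⟩
    | add y z hy hz =>
      obtain ⟨y', hy⟩ := hy
      obtain ⟨z', hz⟩ := hz
      exact ⟨y' + z', by rw [map_add, map_add, hy, hz]⟩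
    | single σ a =>
      obtain ⟨τ, rfl⟩ := hlift σ
      exact ⟨_, hψ τ a⟩
  · rw [← zpow_natCast, ← zpow_mul] at h
    have := hp.eq_zero_of_zpow_apply_eq hν h
    rcases mul_eq_zero.1 this with h | h
    · omega
    · exact h
  · rw [hψ, hψ, Units.val_one, one_smul]
    congr 2
    ext a
    have := (hfT N (σ a)).2 dvd_rfl
    rwa [zpow_natCast] at this
  -- The separating functional is the coefficient of the simplex `f ∘ σ`.
  · let e := LinearEquiv.ofBijective (toComplex (K := K) (Y := D) n) (toComplex_bijective n)
    have he (y : Chain K D (n + 1)) : e.symm (toComplex n y) = y := e.symm_apply_apply y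
    refine ⟨Finsupp.lapply (f.comp σ) ∘ₗ e.symm.toLinearMap, ?_, fun τ hτ => ?_⟩
    · rw [hψ, LinearMap.comp_apply, LinearEquiv.coe_coe, he]
      simp
    · rw [hψ, LinearMap.comp_apply, LinearEquiv.coe_coe, he] at hτ
      have hfe : f.comp τ = f.comp σ := by
        by_contra hne
        exact hτ (Finsupp.single_eq_of_ne (Ne.symm hne))
      obtain ⟨k, rfl⟩ := hp.exists_zpow_comp_eq (σ := σ) (τ := τ) fun a => by
        rw [← hf, ← hf]
        exact congrArg q (DFunLike.congr_fun hfe.symm a)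
      obtain ⟨l, rfl⟩ := (hfT k _).1 (DFunLike.congr_fun hfe (Classical.arbitrary _))
      exact ⟨l, by rw [← zpow_natCast, ← zpow_mul]⟩

end IsInfiniteCyclicCover

/-! ## Chains with coefficients in a character local system -/

namespace IsInfiniteCyclicCover

open SingularChain

variable {X : Type u} [TopologicalSpace X] {x₀ : X} {ν : FundamentalGroup X x₀ →* Multiplicative ℤ}
  {E : Type u} [TopologicalSpace E] {p : E → X} {T : E ≃ₜ E} (hp : IsInfiniteCyclicCover p T ν)
  (hν : Function.Surjective ν) {e₀ : E} (h₀ : p e₀ = x₀) {K : Type v} [Field K] (ρ : Kˣ)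

/-- The singular simplex of `X` below a singular simplex of the covering. -/
abbrev mapSimplex {n : SimplexCategoryᵒᵖ} (τ : SingularSimplex E n) : SingularSimplex X n :=
  (TopCat.toSSet.map (TopCat.ofHom (⟨p, hp.isCoveringMap.continuous⟩ : C(E, X)))).app n τ

/-- The coefficient over a singular simplex of `X` given by a lift to the covering. -/
def simplexSection {n : SimplexCategoryᵒᵖ} (τ : SingularSimplex E n) :
    ModuleCat.of K (ULift.{u} K) ⟶ (pulledBackLocalSystem ν ρ).coeff (hp.mapSimplex τ) :=
  ModuleCat.ofHom ((LinearMap.toSpanSingleton K _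
    (hp.stalkSection h₀ hν ρ (τ.toMap (simplexBase n.unop)))) ∘ₗ
      (ULift.moduleEquiv (R := K) (M := K)).toLinearMap)

/-- Flatness of the sections makes the map compatible with the parallel transport hidden in the
simplicial operators. -/
theorem simplexSection_transport {n m : SimplexCategoryᵒᵖ} (f : n ⟶ m) (τ : SingularSimplex E n) :
    hp.simplexSection hν h₀ ρ τ ≫ (pulledBackLocalSystem ν ρ).transport f (hp.mapSimplex τ) =
      hp.simplexSection hν h₀ ρ ((TopCat.toSSet.obj (TopCat.of E)).map f τ) := by
  have h := hp.transport_stalkSection h₀ hν ρ _ _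
    ((FundamentalGroupoid.map τ.toMap).map (simplexEdge f.unop))
  have e : (FundamentalGroupoid.map ⟨p, hp.isCoveringMap.continuous⟩).map
      ((FundamentalGroupoid.map τ.toMap).map (simplexEdge.{u} f.unop)) =
      (FundamentalGroupoid.map (hp.mapSimplex τ).toMap).map (simplexEdge.{u} f.unop) := by
    generalize simplexEdge.{u} f.unop = q
    induction q using Quotient.inductionOn with | _ q => rfl
  ext a
  exact (congrArg (fun β => characterTransport ((zpowersHom Kˣ ρ).comp ν) β
    (a.down • hp.stalkSection h₀ hν ρ (τ.toMap (simplexBase n.unop)))) e.symm).trans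
    ((LinearMap.map_smul _ a.down _).trans (congrArg (a.down • ·) h))

/-- The map from the chains of the covering to the chains with coefficients in `L_ρ`. -/
def twistedMap : (((SimplicialObject.whiskering _ _).obj
      (sigmaConst.obj (ModuleCat.of K (ULift.{u} K)))).obj (TopCat.toSSet.obj (TopCat.of E))) ⟶
    (pulledBackLocalSystem ν ρ).simplicialObject where
  app n := Sigma.desc fun τ : SingularSimplex E n => hp.simplexSection hν h₀ ρ τ ≫
    Sigma.ι (fun σ : SingularSimplex X n => (pulledBackLocalSystem ν ρ).coeff σ) (hp.mapSimplex τ)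
  naturality n m f := by
    refine Sigma.hom_ext _ _ fun τ => ?_
    refine (Sigma.ι_comp_map'_assoc _ _ _ _).trans ?_
    rw [Category.id_comp]
    refine (Sigma.ι_desc _ _).trans ?_
    have h := Sigma.ι_desc_assoc (fun τ : SingularSimplex E n => hp.simplexSection hν h₀ ρ τ ≫
      Sigma.ι (fun σ : SingularSimplex X n => (pulledBackLocalSystem ν ρ).coeff σ)
        (hp.mapSimplex τ)) τ ((pulledBackLocalSystem ν ρ).simplicialObject.map f)
    refine Eq.trans ?_ (h.symm.trans rfl)
    refine Eq.trans ?_ (Category.assoc _ _ _).symm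
    refine Eq.trans ?_ (congrArg (hp.simplexSection hν h₀ ρ τ ≫ ·)
      (Sigma.ι_comp_map' ((TopCat.toSSet.obj (TopCat.of X)).map f)
        ((pulledBackLocalSystem ν ρ).transport f) (hp.mapSimplex τ)).symm)
    refine Eq.trans ?_ (Category.assoc _ _ _)
    exact congrArg (· ≫ Sigma.ι (fun σ : SingularSimplex X m =>
      (pulledBackLocalSystem ν ρ).coeff σ) _) (hp.simplexSection_transport hν h₀ ρ f τ).symm

/-- The chain map from the covering to the chains with coefficients in `L_ρ`. -/
def twistedChainMap : complex K E ⟶ (pulledBackLocalSystem ν ρ).chainComplex :=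
  (AlgebraicTopology.alternatingFaceMapComplex _).map (hp.twistedMap hν h₀ ρ)

theorem twistedChainMap_single {n : ℕ} (τ : C(stdSimplex ℝ (Fin (n + 1)), E)) (a : K) :
    ((hp.twistedChainMap hν h₀ ρ).f n).hom (toComplex n (Finsupp.single τ a)) =
      (Sigma.ι (fun σ : SingularSimplex X _ => (pulledBackLocalSystem ν ρ).coeff σ)
        (hp.mapSimplex (toSimplex τ))).hom
          (a • hp.stalkSection h₀ hν ρ (SingularSimplex.toMap (toSimplex τ) (simplexBase _))) := by
  rw [toComplex_single]
  exact ConcreteCategory.congr_hom (Sigma.ι_desc (fun τ : SingularSimplex E _ =>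
    hp.simplexSection hν h₀ ρ τ ≫ Sigma.ι (fun σ : SingularSimplex X _ =>
      (pulledBackLocalSystem ν ρ).coeff σ) (hp.mapSimplex τ)) (toSimplex τ)) (ULift.up a)

theorem ι_coeff_congr {L : LocalSystem X (ModuleCat.{max u v} K)}
    {n : SimplexCategoryᵒᵖ} {σ τ : SingularSimplex X n} (h : σ = τ) {s : L.coeff σ} {t : L.coeff τ}
    (hst : HEq s t) :
    (Sigma.ι (fun σ : SingularSimplex X n => L.coeff σ) σ).hom s =
      (Sigma.ι (fun σ : SingularSimplex X n => L.coeff σ) τ).hom t := by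
  subst h
  rw [eq_of_heq hst]

theorem mapSimplex_deck {n : ℕ} (τ : C(stdSimplex ℝ (Fin (n + 1)), E)) :
    hp.mapSimplex (toSimplex ((T : C(E, E)).comp τ)) = hp.mapSimplex (toSimplex τ) := by
  have : (⟨p, hp.isCoveringMap.continuous⟩ : C(E, X)).comp ((T : C(E, E)).comp τ) =
      (⟨p, hp.isCoveringMap.continuous⟩ : C(E, X)).comp τ :=
    ContinuousMap.ext fun a => hp.map_deck _
  exact congrArg toSimplex this

theorem twistedChainMap_deck {n : ℕ} (τ : C(stdSimplex ℝ (Fin (n + 1)), E)) :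
    ((hp.twistedChainMap hν h₀ ρ).f n).hom
        (toComplex n (Finsupp.single ((T : C(E, E)).comp τ) 1)) =
      (ρ : K) • ((hp.twistedChainMap hν h₀ ρ).f n).hom (toComplex n (Finsupp.single τ 1)) := by
  rw [twistedChainMap_single, twistedChainMap_single, one_smul, one_smul]
  refine Eq.trans ?_ (LinearMap.map_smul (Sigma.ι (fun σ : SingularSimplex X _ =>
    (pulledBackLocalSystem ν ρ).coeff σ) (hp.mapSimplex (toSimplex τ))).hom (ρ : K) _)
  exact ι_coeff_congr (L := pulledBackLocalSystem ν ρ) (hp.mapSimplex_deck τ)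
    (hp.stalkSection_deck h₀ hν ρ _)

/-- Each summand is the stalk over a simplex of `X`. The simplex lifts to the covering, and the
section of the lift spans the stalk. -/
theorem twistedChainMap_surjective [PathConnectedSpace X] (n : ℕ) :
    Function.Surjective ((hp.twistedChainMap hν h₀ ρ).f n) := by
  refine (ModuleCat.epi_iff_surjective _).1 ⟨fun {W} g h hgh => Sigma.hom_ext _ _ fun σ => ?_⟩
  obtain ⟨τ, hτ⟩ := hp.exists_lift_simplex (TopCat.toSSetObjEquiv (TopCat.of X) _ σ)
  obtain rfl : hp.mapSimplex (toSimplex τ) = σ := by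
    have : (⟨p, hp.isCoveringMap.continuous⟩ : C(E, X)).comp τ =
        TopCat.toSSetObjEquiv (TopCat.of X) _ σ := ContinuousMap.ext hτ
    refine (congrArg toSimplex this).trans ?_
    exact Equiv.symm_apply_apply _ _
  ext s
  obtain ⟨a, rfl⟩ := hp.exists_smul_stalkSection h₀ hν ρ _ s
  have := ConcreteCategory.congr_hom hgh (toComplex n (Finsupp.single τ a))
  have e := hp.twistedChainMap_single hν h₀ ρ τ a
  exact (congrArg g e.symm).trans (this.trans (congrArg h e))

/-- Project to the summand of the image of σ and evaluate at a path where its section equals 1; all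
other summands are sent to zero. -/
theorem exists_functional [PathConnectedSpace X] {n : ℕ} (σ : C(stdSimplex ℝ (Fin (n + 1)), E)) :
    ∃ φ : (pulledBackLocalSystem ν ρ).chainComplex.X n →ₗ[K] K,
      φ (((hp.twistedChainMap hν h₀ ρ).f n).hom (toComplex n (Finsupp.single σ 1))) ≠ 0 ∧
      ∀ τ, φ (((hp.twistedChainMap hν h₀ ρ).f n).hom (toComplex n (Finsupp.single τ 1))) ≠ 0 →
        hp.mapSimplex (toSimplex σ) = hp.mapSimplex (toSimplex τ) := by
  classical
  obtain ⟨q, hq⟩ := hp.exists_stalkSection_apply_eq_one h₀ hν ρ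
    (SingularSimplex.toMap (toSimplex σ) (simplexBase _))
  let ev : (pulledBackLocalSystem ν ρ).coeff (hp.mapSimplex (toSimplex σ)) ⟶
      ModuleCat.of K (ULift.{u} K) :=
    ModuleCat.ofHom ((ULift.moduleEquiv (R := K) (M := K)).symm.toLinearMap ∘ₗ
      LinearMap.proj q ∘ₗ Submodule.subtype _)
  let F (σ' : SingularSimplex X (Opposite.op (SimplexCategory.mk n))) :
      (pulledBackLocalSystem ν ρ).coeff σ' ⟶ ModuleCat.of K (ULift.{u} K) :=
    if h : hp.mapSimplex (toSimplex σ) = σ' then h ▸ ev else 0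
  let φ : (pulledBackLocalSystem ν ρ).chainComplex.X n ⟶ ModuleCat.of K (ULift.{u} K) :=
    Sigma.desc F
  have hφ (τ : C(stdSimplex ℝ (Fin (n + 1)), E)) :
      φ.hom (((hp.twistedChainMap hν h₀ ρ).f n).hom (toComplex n (Finsupp.single τ 1))) =
        (F (hp.mapSimplex (toSimplex τ))).hom
          ((1 : K) • hp.stalkSection h₀ hν ρ (SingularSimplex.toMap (toSimplex τ) (simplexBase _))) := by
    rw [twistedChainMap_single]
    exact ConcreteCategory.congr_hom (Sigma.ι_desc F (hp.mapSimplex (toSimplex τ))) _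
  refine ⟨(ULift.moduleEquiv (R := K) (M := K)).toLinearMap ∘ₗ φ.hom, ?_, fun τ hτ => ?_⟩
  · rw [LinearMap.comp_apply, hφ, one_smul]
    have hF : F (hp.mapSimplex (toSimplex σ)) = ev := dif_pos rfl
    rw [hF]
    change (hp.stalkSection h₀ hν ρ _).1 q ≠ 0
    rw [hq]
    exact one_ne_zero
  · by_contra hne
    have hF : F (hp.mapSimplex (toSimplex τ)) = 0 := dif_neg hne
    rw [LinearMap.comp_apply, hφ, hF] at hτ
    exact hτ rfl

-- Two simplices of X^ν over the same simplex of `X` differ by a power of T, and on chains T becomes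
-- multiplication by ρ. The orbit criterion `complexSub_exact` then applies.
include hp hν in
theorem pulledBackLocalSystem_exact [PathConnectedSpace X] :
    ∃ ψ : complex K E ⟶ (pulledBackLocalSystem ν ρ).chainComplex, ∀ n,
      Function.Injective ((complexSub K T (ρ : K)).f n) ∧
      LinearMap.range ((complexSub K T (ρ : K)).f n).hom = LinearMap.ker (ψ.f n).hom ∧
      Function.Surjective (ψ.f n) := by
  obtain ⟨e₀, h₀, -⟩ := hp.exists_range_eq
  refine ⟨hp.twistedChainMap hν h₀ ρ, fun n => ?_⟩
  have h := complexSub_exact (fun k e h => hp.eq_zero_of_zpow_apply_eq hν h) ρ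
    ((hp.twistedChainMap hν h₀ ρ).f n) (hp.twistedChainMap_deck hν h₀ ρ) fun σ => by
      obtain ⟨φ, hφ, hφ'⟩ := hp.exists_functional hν h₀ ρ σ
      refine ⟨φ, hφ, fun τ hτ => hp.exists_zpow_comp_eq fun a => ?_⟩
      have := congrArg (TopCat.toSSetObjEquiv (TopCat.of X) _) (hφ' τ hτ)
      exact DFunLike.congr_fun this a
  exact ⟨h.1, h.2, hp.twistedChainMap_surjective hν h₀ ρ n⟩

end IsInfiniteCyclicCover

/-! ## Endomorphisms with finite dimensional kernel and cokernel -/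

section Index

variable {K : Type*} [Field K] {A B : Type*} [AddCommGroup A] [Module K A] [AddCommGroup B]
  [Module K B]

/-- The endomorphism `Φ` has finite dimensional kernel and cokernel, and the dimensions of the
cokernel and of the kernel differ by `n`. -/
structure HasCoindex (Φ : A →ₗ[K] A) (n : ℕ) : Prop where
  finite_coker : Module.Finite K (A ⧸ LinearMap.range Φ)
  finite_ker : Module.Finite K (LinearMap.ker Φ)
  finrank_coker : Module.finrank K (A ⧸ LinearMap.range Φ) = n + Module.finrank K (LinearMap.ker Φ)

theorem HasCoindex.of_finite [Module.Finite K A] (Φ : A →ₗ[K] A) : HasCoindex Φ 0 where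
  finite_coker := inferInstance
  finite_ker := inferInstance
  finrank_coker := by
    have h1 := Submodule.finrank_quotient_add_finrank (LinearMap.range Φ)
    have h2 := LinearMap.finrank_range_add_finrank_ker Φ
    omega

theorem HasCoindex.conj {Φ : A →ₗ[K] A} {n : ℕ} (h : HasCoindex Φ n) (e : A ≃ₗ[K] B)
    {Ψ : B →ₗ[K] B} (hΨ : ∀ a, e (Φ a) = Ψ (e a)) : HasCoindex Ψ n := by
  have h1 := h.finite_coker
  have h2 := h.finite_ker
  have hr : (LinearMap.range Φ).map (e : A →ₗ[K] B) = LinearMap.range Ψ := by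
    ext b
    constructor
    · rintro ⟨_, ⟨a, rfl⟩, rfl⟩
      exact ⟨e a, (hΨ a).symm⟩
    · rintro ⟨b, rfl⟩
      refine ⟨_, ⟨e.symm b, rfl⟩, ?_⟩
      rw [LinearEquiv.coe_coe, hΨ, e.apply_symm_apply]
  have hk : (LinearMap.ker Φ).map (e : A →ₗ[K] B) = LinearMap.ker Ψ := by
    ext b
    constructor
    · rintro ⟨a, ha, rfl⟩
      rw [LinearMap.mem_ker, LinearEquiv.coe_coe, ← hΨ, LinearMap.mem_ker.1 ha, map_zero]
    · intro hb
      refine ⟨e.symm b, ?_, e.apply_symm_apply b⟩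
      refine LinearMap.mem_ker.2 (e.injective ?_)
      rw [hΨ, e.apply_symm_apply, LinearMap.mem_ker.1 hb, map_zero]
  let e₁ := Submodule.Quotient.equiv _ _ e hr
  let e₂ : LinearMap.ker Φ ≃ₗ[K] LinearMap.ker Ψ :=
    (e.submoduleMap (LinearMap.ker Φ)).trans (LinearEquiv.ofEq _ _ hk)
  exact ⟨Module.Finite.equiv e₁, Module.Finite.equiv e₂, by
    rw [← e₁.finrank_eq, ← e₂.finrank_eq, h.finrank_coker]⟩

theorem HasCoindex.prod {Φ : A →ₗ[K] A} {Ψ : B →ₗ[K] B} {n m : ℕ} (h : HasCoindex Φ n)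
    (h' : HasCoindex Ψ m) : HasCoindex (Φ.prodMap Ψ) (n + m) := by
  have h1 := h.finite_coker
  have h2 := h.finite_ker
  have h3 := h'.finite_coker
  have h4 := h'.finite_ker
  let q := (LinearMap.range Φ).mkQ.prodMap (LinearMap.range Ψ).mkQ
  have hq : Function.Surjective q :=
    Function.Surjective.prodMap (Submodule.mkQ_surjective _) (Submodule.mkQ_surjective _)
  have hker : LinearMap.range (Φ.prodMap Ψ) = LinearMap.ker q := by
    ext ⟨a, b⟩
    simp [q]
  let e₁ := (Submodule.quotEquivOfEq _ _ hker).trans (q.quotKerEquivOfSurjective hq)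
  let e₂ : LinearMap.ker (Φ.prodMap Ψ) ≃ₗ[K] LinearMap.ker Φ × LinearMap.ker Ψ :=
    { toFun := fun x => (⟨x.1.1, congrArg Prod.fst x.2⟩, ⟨x.1.2, congrArg Prod.snd x.2⟩)
      invFun := fun x => ⟨(x.1.1, x.2.1), Prod.ext x.1.2 x.2.2⟩
      map_add' := fun _ _ => rfl
      map_smul' := fun _ _ => rfl
      left_inv := fun _ => rfl
      right_inv := fun _ => rfl }
  refine ⟨Module.Finite.equiv e₁.symm, Module.Finite.equiv e₂.symm, ?_⟩
  rw [e₁.finrank_eq, e₂.finrank_eq, Module.finrank_prod, Module.finrank_prod, h.finrank_coker,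
    h'.finrank_coker]
  omega

end Index

/-! ## Finitely generated modules over Laurent polynomials -/

namespace LaurentPolynomial

open Polynomial (toLaurent)

variable {K : Type v} [Field K]

instance instIsPrincipalIdealRing : IsPrincipalIdealRing (LaurentPolynomial K) where
  principal I := by
    obtain ⟨g, hg⟩ := IsPrincipalIdealRing.principal
      (I.under (Polynomial K))
    refine ⟨algebraMap _ _ g, ?_⟩
    rw [← IsLocalization.map_under (Submonoid.powers (Polynomial.X : Polynomial K))
      (LaurentPolynomial K) I, hg]
    exact (Ideal.map_span _ _).trans (by rw [Set.image_singleton])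

theorem isCoprime_X {g : Polynomial K} (hg : g.coeff 0 ≠ 0) : IsCoprime Polynomial.X g := by
  refine (Polynomial.irreducible_X.coprime_iff_not_dvd).2 fun h => hg ?_
  exact Polynomial.X_dvd_iff.1 h

/-- The quotient of the Laurent polynomials by a polynomial with nonzero constant coefficient. -/
theorem exists_quotient_equiv {g : Polynomial K} (hg : g.coeff 0 ≠ 0) :
    Nonempty ((Polynomial K ⧸ Ideal.span {g}) ≃ₗ[K]
      (LaurentPolynomial K ⧸ LinearMap.range
        (Algebra.lsmul K K (LaurentPolynomial K) (toLaurent g)))) := by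
  set P := LinearMap.range (Algebra.lsmul K K (LaurentPolynomial K) (toLaurent g)) with hP
  let φ : Polynomial K →ₗ[K] (LaurentPolynomial K ⧸ P) :=
    P.mkQ ∘ₗ (Polynomial.toLaurentAlg (R := K)).toLinearMap
  have hmem (x : LaurentPolynomial K) : x ∈ P ↔ toLaurent g ∣ x := by
    constructor
    · rintro ⟨y, rfl⟩
      exact ⟨y, rfl⟩
    · rintro ⟨y, rfl⟩
      exact ⟨y, rfl⟩
  have hφs : Function.Surjective φ := by
    intro x
    obtain ⟨x, rfl⟩ := P.mkQ_surjective x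
    obtain ⟨n, f, hf⟩ := exists_T_pow x
    -- With `x = f t^(-n)` and `a X^n + b g = 1`, the polynomial `a f` represents `x` modulo `g`:
    -- powers of X are already invertible there.
    obtain ⟨a, b, hab⟩ := (isCoprime_X hg).pow_left (m := n)
    refine ⟨a * f, ?_⟩
    refine (Submodule.Quotient.eq P).2 ((hmem _).2 ⟨-(toLaurent b * x), ?_⟩)
    have h := congrArg toLaurent hab
    simp only [map_add, map_mul, Polynomial.toLaurent_X_pow, map_one] at h
    change toLaurent (a * f) - x = _
    rw [map_mul, hf]
    linear_combination x * h
  have hker : (Ideal.span {g}).restrictScalars K = LinearMap.ker φ := by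
    ext f
    rw [Submodule.restrictScalars_mem, Ideal.mem_span_singleton, LinearMap.mem_ker]
    change _ ↔ P.mkQ (toLaurent f) = 0
    rw [Submodule.mkQ_apply, Submodule.Quotient.mk_eq_zero, hmem]
    refine ⟨map_dvd _, ?_⟩
    rintro ⟨y, hy⟩
    obtain ⟨n, h, hh⟩ := exists_T_pow y
    have : Polynomial.X ^ n * f = g * h := by
      refine Polynomial.toLaurent_injective ?_
      rw [map_mul, map_mul, hh, hy, Polynomial.toLaurent_X_pow]
      ring
    exact (isCoprime_X hg).symm.pow_right.dvd_of_dvd_mul_left ⟨h, this⟩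
  exact ⟨(Submodule.quotEquivOfEq _ _ hker).trans (φ.quotKerEquivOfSurjective hφs)⟩

theorem toLaurent_ne_zero_of_coeff {g : Polynomial K} (hg : g.coeff 0 ≠ 0) : toLaurent g ≠ 0 := by
  rw [Polynomial.toLaurent_ne_zero]
  rintro rfl
  exact hg rfl

theorem hasCoindex_lsmul {g : Polynomial K} (hg : g.coeff 0 ≠ 0) :
    HasCoindex (Algebra.lsmul K K (LaurentPolynomial K) (toLaurent g)) g.natDegree := by
  obtain ⟨e⟩ := exists_quotient_equiv hg
  have hg0 : g ≠ 0 := by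
    rintro rfl
    exact hg rfl
  have hfin : Module.Finite K (Polynomial K ⧸ Ideal.span {g}) :=
    (AdjoinRoot.powerBasis hg0).finite
  have hker : LinearMap.ker (Algebra.lsmul K K (LaurentPolynomial K) (toLaurent g)) = ⊥ := by
    refine LinearMap.ker_eq_bot'.2 fun x hx => ?_
    exact (mul_eq_zero.1 hx).resolve_left (toLaurent_ne_zero_of_coeff hg)
  refine ⟨Module.Finite.equiv e, ?_, ?_⟩
  · rw [hker]
    infer_instance
  · rw [hker, finrank_bot, ← e.finrank_eq, finrank_quotient_span_eq_natDegree]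
    rfl

theorem hasCoindex_lsmul_pi {g : Polynomial K} (hg : g.coeff 0 ≠ 0) (n : ℕ) :
    HasCoindex (Algebra.lsmul K K (Fin n → LaurentPolynomial K) (toLaurent g))
      (n * g.natDegree) := by
  induction n with
  | zero =>
    rw [zero_mul]
    exact HasCoindex.of_finite _
  | succ n ih =>
    rw [add_mul, one_mul, add_comm (n * _)]
    exact ((hasCoindex_lsmul hg).prod ih).conj
      (Ψ := Algebra.lsmul K K (Fin (n + 1) → LaurentPolynomial K) (toLaurent g))
      ((Fin.consLinearEquiv (LaurentPolynomial K)
        (fun _ : Fin (n + 1) => LaurentPolynomial K)).restrictScalars K) fun a =>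
        map_smul (Fin.consLinearEquiv (LaurentPolynomial K)
          (fun _ : Fin (n + 1) => LaurentPolynomial K)) (toLaurent g) a

/-- The quotient of the Laurent polynomials by a nonzero ideal is finite dimensional. -/
theorem finite_quotient {f : LaurentPolynomial K} (hf : f ≠ 0) :
    Module.Finite K (LaurentPolynomial K ⧸ Ideal.span {f}) := by
  obtain ⟨n, p, hp⟩ := exists_T_pow f
  have hp0 : p ≠ 0 := by
    rintro rfl
    rw [map_zero, eq_comm] at hp
    exact hf ((isUnit_T (n : ℤ)).mul_left_eq_zero.1 hp)
  -- Removing all factors X from `p` changes it only by a unit of Λ and leaves a polynomial with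
  -- nonzero constant term.
  obtain ⟨g, hg, hgX⟩ := Polynomial.exists_eq_pow_rootMultiplicity_mul_and_not_dvd p hp0 0
  rw [map_zero, sub_zero] at hgX hg
  have hg0 : g.coeff 0 ≠ 0 := fun h => hgX (Polynomial.X_dvd_iff.2 h)
  have hspan : LinearMap.range (Algebra.lsmul K K (LaurentPolynomial K) (toLaurent g)) =
      (Ideal.span {f}).restrictScalars K := by
    have h1 := congrArg toLaurent hg
    rw [map_mul, Polynomial.toLaurent_X_pow, hp] at h1
    have h2 : Associated f (toLaurent g) := by
      have h3 : Associated (f * T n) (toLaurent g) := by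
        rw [h1]
        exact (associated_unit_mul_left _ _ (isUnit_T _))
      exact (associated_mul_unit_left _ _ (isUnit_T _)).symm.trans h3
    ext x
    rw [Submodule.restrictScalars_mem, Ideal.mem_span_singleton, h2.dvd_iff_dvd_left]
    exact ⟨fun ⟨y, hy⟩ => ⟨y, hy.symm⟩, fun ⟨y, hy⟩ => ⟨y, hy.symm⟩⟩
  have := (hasCoindex_lsmul hg0).finite_coker
  exact Module.Finite.equiv ((Submodule.quotEquivOfEq _ _ hspan).trans
    (Submodule.Quotient.restrictScalarsEquiv K (Ideal.span {f})))

end LaurentPolynomial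

/-! ### Rank and torsion of finitely generated modules over Λ. -/

namespace LaurentPolynomial

open Polynomial (toLaurent)

variable {K : Type v} [Field K]

theorem coeff_X_sub_C_ne_zero (ρ : Kˣ) : (Polynomial.X - Polynomial.C (ρ : K)).coeff 0 ≠ 0 := by
  simp

/-- Multiplication by t - 1 has coindex 1, whereas every endomorphism of a finite dimensional space
has coindex 0. -/
theorem not_finite : ¬ Module.Finite K (LaurentPolynomial K) := by
  intro h
  have h1 := (hasCoindex_lsmul (coeff_X_sub_C_ne_zero (1 : Kˣ))).finrank_coker
  rw [(HasCoindex.of_finite _).finrank_coker, Polynomial.natDegree_X_sub_C] at h1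
  omega

/-- An element that is not torsion would embed Λ in the finite dimensional space `N`. -/
theorem finrank_eq_zero_of_finite {N : Type*} [AddCommGroup N] [Module (LaurentPolynomial K) N]
    [Module K N] [IsScalarTower K (LaurentPolynomial K) N] [Module.Finite K N] :
    Module.finrank (LaurentPolynomial K) N = 0 := by
  have : Module.Finite (LaurentPolynomial K) N :=
    Module.Finite.of_restrictScalars_finite K (LaurentPolynomial K) N
  rw [Module.finrank_eq_zero_iff_isTorsion]
  intro x
  by_contra hx
  let φ : LaurentPolynomial K →ₗ[K] N :=
    (LinearMap.toSpanSingleton (LaurentPolynomial K) N x).restrictScalars K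
  refine not_finite (K := K) (Module.Finite.of_injective φ ?_)
  refine (injective_iff_map_eq_zero φ).2 fun r hr => ?_
  by_contra h0
  exact hx ⟨⟨r, mem_nonZeroDivisors_of_ne_zero h0⟩, hr⟩

/-- In the structure theorem over a principal ideal domain, the torsion summands are quotients by
nonzero ideals, hence finite dimensional. They do not contribute to the rank, so the free part has
exactly the rank of `M`. -/
theorem exists_equiv_pi_prod (M : Type*) [AddCommGroup M] [Module (LaurentPolynomial K) M]
    [Module.Finite (LaurentPolynomial K) M] :
    ∃ (N : Type v) (_ : AddCommGroup N) (_ : Module (LaurentPolynomial K) N) (_ : Module K N)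
      (_ : IsScalarTower K (LaurentPolynomial K) N), Module.Finite K N ∧
      Nonempty (M ≃ₗ[LaurentPolynomial K]
        (Fin (Module.finrank (LaurentPolynomial K) M) → LaurentPolynomial K) × N) := by
  obtain ⟨n, ι, _, p, hp, e, ⟨f⟩⟩ := Module.equiv_free_prod_directSum (LaurentPolynomial K) M
  let N := (i : ι) → (LaurentPolynomial K ⧸ Ideal.span {p i ^ e i})
  have hN : Module.Finite K N := by
    have (i : ι) : Module.Finite K (LaurentPolynomial K ⧸ Ideal.span {p i ^ e i}) :=
      finite_quotient (pow_ne_zero _ (hp i).ne_zero)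
    infer_instance
  have : Module.Finite (LaurentPolynomial K) N :=
    Module.Finite.of_restrictScalars_finite K (LaurentPolynomial K) N
  let f' : M ≃ₗ[LaurentPolynomial K] (Fin n → LaurentPolynomial K) × N :=
    f.trans ((Finsupp.linearEquivFunOnFinite _ _ _).prodCongr
      (DirectSum.linearEquivFunOnFintype _ _ _))
  have hn : Module.finrank (LaurentPolynomial K) M = n := by
    rw [f'.finrank_eq, ← Submodule.finrank_quotient_add_finrank
      (LinearMap.ker (LinearMap.fst (LaurentPolynomial K) (Fin n → LaurentPolynomial K) N)),
      ((LinearMap.fst (LaurentPolynomial K) (Fin n → LaurentPolynomial K)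
        N).quotKerEquivOfSurjective LinearMap.fst_surjective).finrank_eq,
      Module.finrank_fin_fun, ← LinearMap.range_inr, LinearMap.finrank_range_of_inj
        LinearMap.inr_injective, finrank_eq_zero_of_finite (K := K), add_zero]
  subst hn
  exact ⟨N, inferInstance, inferInstance, inferInstance, inferInstance, hN, ⟨f'⟩⟩

variable (M : Type*) [AddCommGroup M] [Module (LaurentPolynomial K) M] [Module K M]
  [IsScalarTower K (LaurentPolynomial K) M] [Module.Finite (LaurentPolynomial K) M]

/-- Only the free part contributes to the coindex. The kernel projects injectively to the torsion
part `N`, so its dimension is a uniform bound for all `g`. -/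
theorem exists_hasCoindex :
    ∃ d : ℕ, ∀ g : Polynomial K, g.coeff 0 ≠ 0 →
      HasCoindex (Algebra.lsmul K K M (toLaurent g))
        (Module.finrank (LaurentPolynomial K) M * g.natDegree) ∧
      Module.finrank K (LinearMap.ker (Algebra.lsmul K K M (toLaurent g))) ≤ d := by
  obtain ⟨N, _, _, _, _, hN, ⟨e⟩⟩ := exists_equiv_pi_prod (K := K) M
  refine ⟨Module.finrank K N, fun g hg => ⟨?_, ?_⟩⟩
  · exact ((hasCoindex_lsmul_pi hg _).prod (HasCoindex.of_finite
      (Algebra.lsmul K K N (toLaurent g)))).conj (Ψ := Algebra.lsmul K K M (toLaurent g))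
      (e.symm.restrictScalars K) fun a => map_smul e.symm (toLaurent g) a
  · let φ : LinearMap.ker (Algebra.lsmul K K M (toLaurent g)) →ₗ[K] N :=
      (LinearMap.snd _ _ N ∘ₗ e.toLinearMap).restrictScalars K ∘ₗ Submodule.subtype _
    refine LinearMap.finrank_le_finrank_of_injective (f := φ) ?_
    refine (injective_iff_map_eq_zero φ).2 fun x hx => ?_
    have h1 : toLaurent g • (e x.1).1 = 0 := by
      rw [← Prod.smul_fst, ← map_smul]
      exact congrArg (fun y => (e y).1) x.2 |>.trans (by simp)
    have h2 : (e x.1).1 = 0 :=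
      (smul_eq_zero.1 h1).resolve_left (toLaurent_ne_zero_of_coeff hg)
    have h3 : e x.1 = 0 := Prod.ext h2 hx
    exact Subtype.ext (e.map_eq_zero_iff.1 h3)

/-- A nonzero element killed by t - ρ has zero free component, so its torsion component is an
eigenvector of t on `N` with eigenvalue ρ. -/
theorem finite_setOf_ker_ne_bot :
    {ρ : Kˣ | LinearMap.ker (Algebra.lsmul K K M
      (toLaurent (Polynomial.X - Polynomial.C (ρ : K)))) ≠ ⊥}.Finite := by
  obtain ⟨N, _, _, _, _, hN, ⟨e⟩⟩ := exists_equiv_pi_prod (K := K) M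
  refine Set.Finite.of_finite_image (f := fun ρ : Kˣ => (ρ : K)) (Set.Finite.subset
    (Module.End.finite_hasEigenvalue (Algebra.lsmul K K N (T 1 : LaurentPolynomial K))) ?_) Units.val_injective.injOn
  rintro _ ⟨ρ, hρ, rfl⟩
  obtain ⟨x, hx, hx0⟩ := Submodule.exists_mem_ne_zero_of_ne_bot hρ
  have h : toLaurent (Polynomial.X - Polynomial.C (ρ : K)) • e x = 0 := by
    rw [← map_smul]
    exact (congrArg e hx).trans (map_zero e)
  have h2 : (e x).1 = 0 := (smul_eq_zero.1 (congrArg Prod.fst h)).resolve_left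
    (toLaurent_ne_zero_of_coeff (coeff_X_sub_C_ne_zero ρ))
  refine Module.End.hasEigenvalue_of_hasEigenvector (x := (e x).2) ⟨?_, fun h3 => ?_⟩
  · refine Module.End.mem_eigenspace_iff.2 (sub_eq_zero.1 ?_)
    have h3 : toLaurent (Polynomial.X - Polynomial.C (ρ : K)) • (e x).2 = 0 := congrArg Prod.snd h
    rw [map_sub, Polynomial.toLaurent_X, Polynomial.toLaurent_C, sub_smul, C_eq_algebraMap,
      algebraMap_smul] at h3
    exact h3
  · exact hx0 (e.map_eq_zero_iff.1 (Prod.ext h2 h3))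

end LaurentPolynomial

/-! ## Homology of the finite cyclic coverings and of the rank one local systems -/

/-- In positive degree the upper bound is an equality, from the long exact sequence and the coindex.
For i = 0 the truncated `i - 1` repeats the kernel in degree 0, a harmless excess in an upper bound.
-/
theorem finrank_homology_bounds {K : Type v} [Field K] {C M : ChainComplex (ModuleCat.{w} K) ℕ}
    (φ : C ⟶ C) (ψ : C ⟶ M) (hinj : ∀ n, Function.Injective (φ.f n))
    (hex : ∀ n, LinearMap.range (φ.f n).hom = LinearMap.ker (ψ.f n).hom)
    (hsurj : ∀ n, Function.Surjective (ψ.f n)) {r : ℕ → ℕ}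
    (h : ∀ i, HasCoindex (HomologicalComplex.homologyMap φ i).hom (r i)) (i : ℕ) :
    Module.Finite K (M.homology i) ∧ r i ≤ Module.finrank K (M.homology i) ∧
      Module.finrank K (M.homology i) ≤ r i +
        Module.finrank K (LinearMap.ker (HomologicalComplex.homologyMap φ i).hom) +
        Module.finrank K (LinearMap.ker (HomologicalComplex.homologyMap φ (i - 1)).hom) := by
  have h1 := (h i).finite_coker
  have h2 := (h (i - 1)).finite_ker
  have h3 := (h i).finrank_coker
  cases i with
  | zero =>
    obtain ⟨h4, h5⟩ := finrank_homology_zero φ ψ hinj hex hsurj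
    exact ⟨h4, by omega, by omega⟩
  | succ i =>
    rw [Nat.add_sub_cancel] at h2 ⊢
    obtain ⟨h4, h5⟩ := finrank_homology_succ φ ψ hinj hex hsurj i
    exact ⟨h4, by omega, by omega⟩

namespace SingularChain

open Polynomial (toLaurent)

variable {K : Type v} [Field K] {E : Type u} [TopologicalSpace E] (T : E ≃ₜ E)

theorem fieldHomologyMap_pow (N i : ℕ) :
    fieldHomologyMap K ((T ^ N : E ≃ₜ E) : C(E, E)) i =
      ((fieldHomologyUnit K T i : (Module.End K (fieldHomology K E i))ˣ) :
        Module.End K (fieldHomology K E i)) ^ N := by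
  induction N with
  | zero => exact fieldHomologyMap_id K E i
  | succ N ih =>
    rw [pow_succ T N]
    refine (fieldHomologyMap_comp K ((T ^ N : E ≃ₜ E) : C(E, E)) (T : C(E, E)) i).trans ?_
    rw [ih]
    exact (pow_succ (fieldHomologyUnit K T i : Module.End K (fieldHomology K E i)) N).symm

theorem homologyMap_complexSub_pow (N i : ℕ) (c : K) :
    (HomologicalComplex.homologyMap (complexSub K (T ^ N) c) i).hom =
      unitAction (fieldHomologyUnit K T i)
        (toLaurent (Polynomial.X ^ N - Polynomial.C c)) := by
  rw [homologyMap_complexSub, fieldHomologyMap_pow, map_sub, map_sub, Polynomial.toLaurent_X_pow,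
    Polynomial.toLaurent_C, unitAction_T, LaurentPolynomial.C_eq_algebraMap, AlgHom.commutes,
    zpow_natCast, Units.val_pow_eq_pow_val, Module.algebraMap_end_eq_smul_id]
  rfl

variable (hfin : ∀ i, Module.Finite (LaurentPolynomial K) (AlexanderModule K T i))
include hfin

/-- The chain map induces the action of t^N - c, of degree `N`; it has nonzero constant term because
N > 0. The bound `d` depends on neither `N` nor `c`. -/
theorem exists_hasCoindex_homologyMap (i : ℕ) :
    ∃ d : ℕ, ∀ (N : ℕ) (c : Kˣ), 0 < N →
      HasCoindex (HomologicalComplex.homologyMap (complexSub K (T ^ N) (c : K)) i).hom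
        (Module.finrank (LaurentPolynomial K) (AlexanderModule K T i) * N) ∧
      Module.finrank K (LinearMap.ker
        (HomologicalComplex.homologyMap (complexSub K (T ^ N) (c : K)) i).hom) ≤ d := by
  have : Module.Finite (LaurentPolynomial K) (UnitModule (fieldHomologyUnit K T i)) := hfin i
  obtain ⟨d, hd⟩ := LaurentPolynomial.exists_hasCoindex (K := K) (UnitModule (fieldHomologyUnit K T i))
  refine ⟨d, fun N c hN => ?_⟩
  have h := hd (Polynomial.X ^ N - Polynomial.C (c : K)) (by
    simp [Polynomial.coeff_X_pow, hN.ne])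
  rw [Polynomial.natDegree_X_pow_sub_C] at h
  rw [homologyMap_complexSub_pow]
  exact h

theorem finite_setOf_ker_homologyMap_ne_bot (i : ℕ) :
    {ρ : Kˣ | LinearMap.ker
      (HomologicalComplex.homologyMap (complexSub K T (ρ : K)) i).hom ≠ ⊥}.Finite := by
  have : Module.Finite (LaurentPolynomial K) (UnitModule (fieldHomologyUnit K T i)) := hfin i
  have h := LaurentPolynomial.finite_setOf_ker_ne_bot (K := K) (UnitModule (fieldHomologyUnit K T i))
  refine h.subset fun ρ hρ => ?_
  have e := homologyMap_complexSub_pow T 1 i (ρ : K)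
  rw [pow_one, pow_one] at e
  rw [Set.mem_ofPred_eq, e] at hρ
  exact hρ

end SingularChain

namespace IsInfiniteCyclicCover

open SingularChain

variable {X : Type u} [TopologicalSpace X] {x₀ : X} {ν : FundamentalGroup X x₀ →* Multiplicative ℤ}
  {E : Type u} [TopologicalSpace E] {p : E → X} {T : E ≃ₜ E} (hp : IsInfiniteCyclicCover p T ν)
  (hν : Function.Surjective ν) (K : Type v) [Field K]
  (hfin : ∀ i, Module.Finite (LaurentPolynomial K) (AlexanderModule K T i))
include hp hν hfin

/-- The homology of the finite cyclic coverings, up to a bounded error. -/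
theorem exists_finrank_finiteCover_bounds [LocallyPathConnectedSpace X] (i : ℕ) :
    ∃ d : ℕ, ∀ (N : ℕ), 0 < N → ∀ (D : Type u) [TopologicalSpace D] (q : D → X),
      IsCoverOfSubgroup q x₀ (reduceMod ν N).ker →
      Module.Finite K (fieldHomology K D i) ∧
      Module.finrank (LaurentPolynomial K) (AlexanderModule K T i) * N ≤
        Module.finrank K (fieldHomology K D i) ∧
      Module.finrank K (fieldHomology K D i) ≤
        Module.finrank (LaurentPolynomial K) (AlexanderModule K T i) * N + d := by
  choose d hd using exists_hasCoindex_homologyMap T hfin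
  refine ⟨d i + d (i - 1), fun N hN D _ q hq => ?_⟩
  obtain ⟨ψ, hψ⟩ := hp.finiteCover_exact hν K hN hq
  obtain ⟨h1, h2, h3⟩ := finrank_homology_bounds (complexSub K (T ^ N) ((1 : Kˣ) : K)) ψ
    (fun n => (hψ n).1) (fun n => (hψ n).2.1) (fun n => (hψ n).2.2)
    (fun j => (hd j N 1 hN).1) i
  have h4 := (hd i N 1 hN).2
  have h5 := (hd (i - 1) N 1 hN).2
  refine ⟨h1, h2, h3.trans ?_⟩
  omega

/-- The exceptional ρ are among those for which t - ρ fails to be injective on homology in degree i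
or i - 1. -/
theorem finrank_pulledBackLocalSystem [PathConnectedSpace X] (i : ℕ) :
    (∀ ρ : Kˣ, Module.Finite K ((pulledBackLocalSystem ν ρ).homology i)) ∧
    {ρ : Kˣ | Module.finrank K ((pulledBackLocalSystem ν ρ).homology i) ≠
      Module.finrank (LaurentPolynomial K) (AlexanderModule K T i)}.Finite := by
  choose d hd using exists_hasCoindex_homologyMap T hfin
  have key (ρ : Kˣ) : Module.Finite K ((pulledBackLocalSystem ν ρ).homology i) ∧
      Module.finrank (LaurentPolynomial K) (AlexanderModule K T i) ≤
        Module.finrank K ((pulledBackLocalSystem ν ρ).homology i) ∧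
      Module.finrank K ((pulledBackLocalSystem ν ρ).homology i) ≤
        Module.finrank (LaurentPolynomial K) (AlexanderModule K T i) +
        Module.finrank K (LinearMap.ker
          (HomologicalComplex.homologyMap (complexSub K T (ρ : K)) i).hom) +
        Module.finrank K (LinearMap.ker
          (HomologicalComplex.homologyMap (complexSub K T (ρ : K)) (i - 1)).hom) := by
    obtain ⟨ψ, hψ⟩ := hp.pulledBackLocalSystem_exact hν ρ
    refine finrank_homology_bounds (complexSub K T (ρ : K)) ψ
      (r := fun j => Module.finrank (LaurentPolynomial K) (AlexanderModule K T j))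
      (fun n => (hψ n).1) (fun n => (hψ n).2.1) (fun n => (hψ n).2.2) (fun j => ?_) i
    have h := (hd j 1 ρ one_pos).1
    rwa [pow_one, mul_one] at h
  refine ⟨fun ρ => (key ρ).1, ((finite_setOf_ker_homologyMap_ne_bot T hfin i).union
    (finite_setOf_ker_homologyMap_ne_bot T hfin (i - 1))).subset fun ρ hρ => ?_⟩
  by_contra hne
  rw [Set.mem_union, not_or] at hne
  have h1 := not_not.1 hne.1
  have h2 := not_not.1 hne.2
  have h := (key ρ).2
  rw [h1, h2, finrank_bot, finrank_bot] at h
  exact hρ (by omega)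

end IsInfiniteCyclicCover

end

/-! ### Conclusion: finiteness, the limit and the generic dimension. -/

theorem mainTheorem8 {X : Type u} [TopologicalSpace X] [T2Space X] [ConnectedSpace X]
    [Topology.CWComplex (Set.univ : Set X)] [Topology.CWComplex.Finite (Set.univ : Set X)]
    (x₀ : X) (ν : FundamentalGroup X x₀ →* Multiplicative ℤ) (hν : Function.Surjective ν)
    -- the infinite cyclic covering `X^ν`, with its deck transformation `T`
    {Xν : Type u} [TopologicalSpace Xν] (p : Xν → X) (T : Xν ≃ₜ Xν)
    (hp : IsInfiniteCyclicCover p T ν)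
    -- the coverings `X^{ν,N}`
    (XνN : ℕ → Type u) [∀ N, TopologicalSpace (XνN N)] (pN : ∀ N, XνN N → X)
    (hpN : ∀ N, 0 < N → IsCoverOfSubgroup (pN N) x₀ (reduceMod ν N).ker)
    (K : Type v) [Field K] (i : ℕ) :
    -- all the dimensions and the rank are finite
    (∀ N, 0 < N → Module.Finite K (fieldHomology K (XνN N) i)) ∧
    Module.Finite (LaurentPolynomial K) (AlexanderModule K T i) ∧
    (∀ ρ : Kˣ, Module.Finite K ((pulledBackLocalSystem ν ρ).homology i)) ∧
    -- the limit exists and is the rank of the Alexander module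
    Filter.Tendsto (fun N : ℕ => (Module.finrank K (fieldHomology K (XνN N) i) : ℝ) / (N : ℝ))
      Filter.atTop
      (nhds (Module.finrank (LaurentPolynomial K) (AlexanderModule K T i) : ℝ)) ∧
    -- all but finitely many `ρ` have `dim H_i(X, L_ρ)` equal to this rank
    {ρ : Kˣ | Module.finrank K ((pulledBackLocalSystem ν ρ).homology i) ≠
      Module.finrank (LaurentPolynomial K) (AlexanderModule K T i)}.Finite := by
  have hX : LocallyPathConnectedSpace X := locallyPathConnectedSpace_of_finite_CW
  have hX' : PathConnectedSpace X := pathConnectedSpace_iff_connectedSpace.2 inferInstance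
  have hfin (i : ℕ) : Module.Finite (LaurentPolynomial K) (AlexanderModule K T i) :=
    SingularChain.CoverFG.moduleFinite (hT := hp.map_deck)
      (SingularChain.CoverFG.univ_of_finite hp.isCoveringMap hp.exists_zpow_eq) i
  obtain ⟨d, hd⟩ := hp.exists_finrank_finiteCover_bounds hν K hfin i
  have hL := hp.finrank_pulledBackLocalSystem hν K hfin i
  refine ⟨fun N hN => (hd N hN _ _ (hpN N hN)).1, hfin i, hL.1, ?_, hL.2⟩
  set r := Module.finrank (LaurentPolynomial K) (AlexanderModule K T i)
  -- The bounds rN and rN + d, divided by N, squeeze the sequence. They are claimed only for N > 0,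
  -- where the hypothesis on the coverings applies.
  have hlim : Filter.Tendsto (fun N : ℕ => (r : ℝ) + (d : ℝ) / N) Filter.atTop (nhds (r : ℝ)) := by
    simpa using tendsto_const_nhds.add (tendsto_const_div_atTop_nhds_zero_nat (d : ℝ))
  refine tendsto_of_tendsto_of_tendsto_of_le_of_le' tendsto_const_nhds hlim ?_ ?_
  · filter_upwards [Filter.eventually_gt_atTop 0] with N hN
    rw [le_div_iff₀ (by exact_mod_cast hN)]
    exact_mod_cast (hd N hN _ _ (hpN N hN)).2.1
  · filter_upwards [Filter.eventually_gt_atTop 0] with N hN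
    have hN' : (0 : ℝ) < N := by exact_mod_cast hN
    rw [div_le_iff₀ hN', add_mul, div_mul_cancel₀ _ hN'.ne']
    exact_mod_cast (hd N hN _ _ (hpN N hN)).2.2
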